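/- **Setting.** Let $n_x,n_u,k,H,N_1,N_2,T$ be natural numbers with $H\ge 1$ and $2k\le n_x$. Let $A\in\mathbb R^{n_x\times n_x}$, $B\in\mathbb R^{n_x\times n_u}$, $\sigma_z>0$, $\Phi_\star\in\mathbb R^{k\times n_x}$, $F_\star^{(1)},\dots,F_\star^{(H+1)}\in\mathbb R^{n_u\times k}$, and let $\Sigma_w^{(1)},\dots,\Sigma_w^{(H+1)}\in\mathbb R^{n_x\times n_x}$ be positive definite. Put $K^{(h)}=F_\star^{(h)}\Phi_\star$ and assume that every $A+BK^{(h)}$ has spectral radius less than one. Let $\Sigma_x^{(h)}$ be the (unique, positive definite) solution of $$\Sigma_x^{(h)}=(A+BK^{(h)})\Sigma_x^{(h)}(A+BK^{(h)})^\top+\sigma_z^2BB^\top+\Sigma_w^{(h)}.$$ An expert trajectory of task $h$ is $(x[t],u[t])_{0\le t<T}$ with $x[0]\sim\mathcal N(0,\Sigma_x^{(h)})$, $u[t]=K^{(h)}x[t]+z[t]$, $x[t+1]=Ax[t]+Bu[t]+w[t]$, where $z[t]\sim\mathcal N(0,\sigma_z^2I)$, $w[t]\sim\mathcal N(0,\Sigma_w^{(h)})$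 and $x[0]$, all $z[t]$, all $w[t]$ are independent. The data are independent expert trajectories $(x^{(h)}_i,u^{(h)}_i)$: $N_1$ of them for each source task $h\le H$, and $N_2$ for the target task $H+1$. **Estimator.** $\hat\Phi\in\mathbb R^{k\times n_x}$ is a measurable function of the source data and is almost surely the $\Phi$-part of a minimizer of $\sum_{h=1}^H\sum_{i=1}^{N_1}\sum_{t=0}^{T-1}\|F^{(h)}\Phi x_i^{(h)}[t]-u_i^{(h)}[t]\|^2$ over $(\Phi,F^{(1)},\dots,F^{(H)})$; almost surely, $\hat F^{(H+1)}$ minimizes $\sum_{i=1}^{N_2}\sum_{t=0}^{T-1}\|F\hat\Phi x_i^{(H+1)}[t]-u_i^{(H+1)}[t]\|^2$ over $F\in\mathbb R^{n_u\times k}$. Its excess risk is $$\mathrm{ER}(\hat\Phi,\hat F^{(H+1)})=\frac1{2T}\,\mathbb E\Big[\sum_{t=0}^{T-1}\big\|(F_\star^{(H+1)}\Phi_\star-\hat F^{(H+1)}\hat\Phi)x[t]\big\|^2\Big],$$ where the expectation is over a fresh expert state trajectory $x$ of the target task only. **Notation.** $\mathcal J(M)=\sum_{t\ge0}\|M^t\|$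 (spectral norm), $\kappa(\Sigma)=\lambda_{\max}(\Sigma)/\lambda_{\min}(\Sigma)$, $\bar\lambda=\max_{h\le H}\lambda_{\max}(\Sigma_x^{(h)})$, $\underline\lambda=\min_{h\le H}\lambda_{\min}(\Sigma_x^{(h)})$, $c=\min_{h\le H}\lambda_{\min}\big((\Sigma_x^{(H+1)})^{-1/2}\Sigma_x^{(h)}(\Sigma_x^{(H+1)})^{-1/2}\big)$, and $\mathbf F_\star\in\mathbb R^{Hn_u\times k}$ is the matrix of the stacked source weights $F_\star^{(1)},\dots,F_\star^{(H)}$, with Moore–Penrose pseudo-inverse $\mathbf F_\star^\dagger$. **Theorem 3.1.** There is a universal constant $C_b>0$, and for all $C_0,C_1\in\mathbb R$ there is a constant $C>0$ depending only on $C_0,C_1$, such that the following holds in the above setting for every $\delta\in(0,1)$. Assume 1. (diverse sources) $\|F_\star^{(H+1)}\mathbf F_\star^\dagger\|^2\le C_0/H$, and the row space of $F_\star^{(H+1)}$ is contained in that of $\mathbf F_\star$ (automatic when $\mathbf F_\star$ has rank $k$); 2. $N_2\le C_1\,c\,N_1$; 3. $N_1T\ge C_b\max_{h\le H}\mathcal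 J(A+BK^{(h)})^2\,\kappa(\Sigma_x^{(h)})\,(n_x+\log(H/\delta))$; 4. $N_2T\ge C_b\,\mathcal J(A+BK^{(H+1)})^2\,\kappa(\Sigma_x^{(H+1)})\,(k+\log(1/\delta))$. Then, with probability at least $1-\delta$, $$\mathrm{ER}(\hat\Phi,\hat F^{(H+1)})\le C\,\sigma_z^2\left(\frac{k\,n_x\log\big(N_1T\,\bar\lambda/\underline\lambda\big)}{c\,N_1TH}+\frac{k\,n_u+\log(1/\delta)}{N_2T}\right).$$ -/

import Mathlib

/-!
Multi-task imitation learning over linear systems: expert closed loops, Gaussian trajectory data,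
the two-stage least-squares estimator and its excess risk on the target task.
`‖M‖` is the spectral norm of a (rectangular) real matrix `M` throughout.
-/

open MeasureTheory ProbabilityTheory
open scoped Matrix MatrixOrder Matrix.Norms.L2Operator

noncomputable section

namespace MultiTaskIL

/-! ### Matrix notions -/

/-- The largest eigenvalue of a symmetric real matrix (of positive size). -/
def lambdaMax {n : Type*} [Fintype n] [DecidableEq n] (M : Matrix n n ℝ) : ℝ :=
  sSup (spectrum ℝ M)

/-- The smallest eigenvalue of a symmetric real matrix (of positive size). -/
def lambdaMin {n : Type*} [Fintype n] [DecidableEq n] (M : Matrix n n ℝ) : ℝ :=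
  sInf (spectrum ℝ M)

/-- The condition number `κ(M) = λ_max(M) / λ_min(M)` of a positive definite matrix. -/
def condNumber {n : Type*} [Fintype n] [DecidableEq n] (M : Matrix n n ℝ) : ℝ :=
  lambdaMax M / lambdaMin M

/-- The spectral radius of a real square matrix is less than one (complex eigenvalues count). -/
def IsSchurStable {n : Type*} [Fintype n] [DecidableEq n] (M : Matrix n n ℝ) : Prop :=
  spectralRadius ℂ (M.map (algebraMap ℝ ℂ)) < 1

/-- `𝒥(M) = ∑_{t ≥ 0} ‖M ^ t‖`, a convergent series when `M` is stable. -/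
def stabilityConst {n : Type*} [Fintype n] [DecidableEq n] (M : Matrix n n ℝ) : ℝ :=
  ∑' t : ℕ, ‖M ^ t‖

/-- The Moore-Penrose pseudo-inverse `M† = (Mᵀ M)† Mᵀ`, where `(Mᵀ M)†` inverts the nonzero
eigenvalues of the symmetric matrix `Mᵀ M` and keeps the zero ones (recall `0⁻¹ = 0` in Lean). -/
def pinv {m n : Type*} [Fintype m] [Fintype n] [DecidableEq n] (M : Matrix m n ℝ) :
    Matrix n m ℝ :=
  cfc (fun x : ℝ => x⁻¹) (Mᵀ * M) * Mᵀ

/-- The four Penrose equations, which determine the pseudo-inverse. -/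
theorem pinv_penrose {m n : Type*} [Fintype m] [Fintype n] [DecidableEq n] (M : Matrix m n ℝ) :
    M * pinv M * M = M ∧ pinv M * M * pinv M = pinv M ∧
      (M * pinv M)ᵀ = M * pinv M ∧ (pinv M * M)ᵀ = pinv M * M := by
  have hS : IsSelfAdjoint (Mᵀ * M) := by
    rw [isSelfAdjoint_iff, Matrix.star_eq_conjTranspose, Matrix.conjTranspose_eq_transpose_of_trivial]
    simp
  set G := cfc (fun x : ℝ => x⁻¹) (Mᵀ * M) with hG
  have hc : ∀ f : ℝ → ℝ, ContinuousOn f (spectrum ℝ (Mᵀ * M)) := fun f => by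
    have : (spectrum ℝ (Mᵀ * M)).Finite := Matrix.finite_real_spectrum
    exact this.continuousOn f
  have hGt : Gᵀ = G := by
    have : IsSelfAdjoint G := cfc_predicate _ _
    rwa [isSelfAdjoint_iff, Matrix.star_eq_conjTranspose,
      Matrix.conjTranspose_eq_transpose_of_trivial] at this
  have hid : cfc (fun x : ℝ => x) (Mᵀ * M) = Mᵀ * M := cfc_id' ℝ _
  have h1 : G * (Mᵀ * M) = cfc (fun x : ℝ => x⁻¹ * x) (Mᵀ * M) := by
    rw [cfc_mul _ _ _ (hc _) (hc _), hid]
  have h2 : (Mᵀ * M) * G = cfc (fun x : ℝ => x⁻¹ * x) (Mᵀ * M) := by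
    have : (fun x : ℝ => x⁻¹ * x) = fun x => x * x⁻¹ := by ext; ring
    rw [this, cfc_mul _ _ _ (hc _) (hc _), hid]
  have h3 : (Mᵀ * M) * (G * (Mᵀ * M)) = Mᵀ * M := by
    conv_rhs => rw [← hid]
    rw [← mul_assoc, h2]
    nth_rewrite 2 [← hid]
    rw [← cfc_mul _ _ _ (hc _) (hc _)]
    congr 1; ext x; by_cases hx : x = 0 <;> simp [hx]
  have h4 : G * (Mᵀ * M) * G = G := by
    rw [h1, hG, ← cfc_mul _ _ _ (hc _) (hc _)]
    congr 1; ext x; by_cases hx : x = 0 <;> simp [hx]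
  have h5 : M * (G * (Mᵀ * M)) = M := by
    have hz : (M * (G * (Mᵀ * M)) - M)ᴴ * (M * (G * (Mᵀ * M)) - M) = 0 := by
      rw [Matrix.conjTranspose_eq_transpose_of_trivial, Matrix.transpose_sub,
        Matrix.transpose_mul M, Matrix.sub_mul, Matrix.mul_sub, Matrix.mul_sub]
      have e1 : (G * (Mᵀ * M))ᵀ * Mᵀ * (M * (G * (Mᵀ * M)))
          = (G * (Mᵀ * M))ᵀ * ((Mᵀ * M) * (G * (Mᵀ * M))) := by simp only [Matrix.mul_assoc]
      have e2 : Mᵀ * (M * (G * (Mᵀ * M))) = (Mᵀ * M) * (G * (Mᵀ * M)) := by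
        simp only [Matrix.mul_assoc]
      rw [e1, e2, h3, Matrix.mul_assoc]
      simp
    exact sub_eq_zero.mp (Matrix.conjTranspose_mul_self_eq_zero.mp hz)
  refine ⟨?_, ?_, ?_, ?_⟩
  · change M * (G * Mᵀ) * M = M
    simpa only [Matrix.mul_assoc] using h5
  · change G * Mᵀ * M * (G * Mᵀ) = G * Mᵀ
    have := congrArg (· * Mᵀ) h4
    simpa only [Matrix.mul_assoc] using this
  · change (M * (G * Mᵀ))ᵀ = M * (G * Mᵀ)
    simp [Matrix.transpose_mul, hGt, Matrix.mul_assoc]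
  · change (G * Mᵀ * M)ᵀ = G * Mᵀ * M
    have := h1.trans h2.symm
    simp only [Matrix.transpose_mul, Matrix.transpose_transpose, hGt, Matrix.mul_assoc] at this ⊢
    exact this.symm

/-! ### The systems and their experts -/

/-- A family of `H + 1` linear closed loops with a common plant `(A, B)`. Task `h : Fin (H + 1)` has
the expert gain `K h = Fstar h * Φstar`, process noise covariance `covW h` and stationary state
covariance `covX h`. The tasks `h.castSucc` with `h : Fin H` are the sources, `Fin.last H` is the
target. Since the closed loops are stable, the Lyapunov equation has exactly one solution `covX h`,
and it is positive definite. -/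
structure TaskFamily (nx nu k H : ℕ) where
  A : Matrix (Fin nx) (Fin nx) ℝ
  B : Matrix (Fin nx) (Fin nu) ℝ
  /-- Standard deviation of the actuator noise. -/
  sigmaZ : ℝ
  Φstar : Matrix (Fin k) (Fin nx) ℝ
  Fstar : Fin (H + 1) → Matrix (Fin nu) (Fin k) ℝ
  covW : Fin (H + 1) → Matrix (Fin nx) (Fin nx) ℝ
  covX : Fin (H + 1) → Matrix (Fin nx) (Fin nx) ℝ
  sigmaZ_pos : 0 < sigmaZ
  covW_posDef : ∀ h, (covW h).PosDef
  stable : ∀ h, IsSchurStable (A + B * (Fstar h * Φstar))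
  lyapunov : ∀ h, covX h = (A + B * (Fstar h * Φstar)) * covX h * (A + B * (Fstar h * Φstar))ᵀ
    + sigmaZ ^ 2 • (B * Bᵀ) + covW h

variable {nx nu k H : ℕ}

/-- The randomness driving one trajectory of length `T`:
initial state, actuator noises `z[t]`, process noises `w[t]`. -/
abbrev TrajNoise (nx nu T : ℕ) : Type :=
  EuclideanSpace ℝ (Fin nx) × (Fin T → EuclideanSpace ℝ (Fin nu)) ×
    (Fin T → EuclideanSpace ℝ (Fin nx))

/-- An observed trajectory of length `T`: the pairs `(x[t], u[t])`, `0 ≤ t < T`. -/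
abbrev Trajectory (nx nu T : ℕ) : Type :=
  Fin T → EuclideanSpace ℝ (Fin nx) × EuclideanSpace ℝ (Fin nu)

namespace TaskFamily

variable (S : TaskFamily nx nu k H)

/-- The expert gain `K⁽ʰ⁾ = F⋆⁽ʰ⁾ Φ⋆`. -/
def K (h : Fin (H + 1)) : Matrix (Fin nu) (Fin nx) ℝ := S.Fstar h * S.Φstar

/-- The closed-loop matrix `A + B K⁽ʰ⁾`. -/
def Acl (h : Fin (H + 1)) : Matrix (Fin nx) (Fin nx) ℝ := S.A + S.B * S.K h

/-- The states of task `h`: `x[t+1] = A x[t] + B u[t] + w[t]` with `u[t] = K⁽ʰ⁾ x[t] + z[t]`.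
Only times `t < T` are used, later ones are set to `0`. -/
def state (h : Fin (H + 1)) {T : ℕ} (ξ : TrajNoise nx nu T) : ℕ → EuclideanSpace ℝ (Fin nx)
  | 0 => ξ.1
  | t + 1 =>
    if ht : t < T then
      (S.A).toEuclideanLin (state h ξ t)
        + (S.B).toEuclideanLin ((S.K h).toEuclideanLin (state h ξ t) + ξ.2.1 ⟨t, ht⟩)
        + ξ.2.2 ⟨t, ht⟩
    else 0

/-- The trajectory of the expert of task `h`: states `x[t]` and inputs `u[t] = K⁽ʰ⁾ x[t] + z[t]`. -/
def trajectory (h : Fin (H + 1)) {T : ℕ} (ξ : TrajNoise nx nu T) : Trajectory nx nu T :=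
  fun t => (S.state h ξ t, (S.K h).toEuclideanLin (S.state h ξ t) + ξ.2.1 t)

/-- The law of the randomness of one trajectory of task `h`: `x[0] ∼ N(0, covX)`,
`z[t] ∼ N(0, sigmaZ² I)`, `w[t] ∼ N(0, covW)`, all independent. -/
def noiseLaw (h : Fin (H + 1)) (T : ℕ) : Measure (TrajNoise nx nu T) :=
  (multivariateGaussian 0 (S.covX h)).prod
    ((Measure.pi fun _ : Fin T => multivariateGaussian 0 (S.sigmaZ ^ 2 • (1 : Matrix _ _ ℝ))).prod
      (Measure.pi fun _ : Fin T => multivariateGaussian 0 (S.covW h)))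

/-- The law of the state trajectory `(x[0], …, x[T-1])` of the target task. -/
def targetStateLaw (T : ℕ) : Measure (Fin T → EuclideanSpace ℝ (Fin nx)) :=
  (S.noiseLaw (Fin.last H) T).map fun ξ t => S.state (Fin.last H) ξ t

theorem measurable_state (h : Fin (H + 1)) (T t : ℕ) :
    Measurable fun ξ : TrajNoise nx nu T => S.state h ξ t := by
  induction t with
  | zero => exact measurable_fst
  | succ t ih =>
    by_cases ht : t < T
    · simp only [state, ht, dite_true]
      have hm : ∀ {p q : ℕ} (M : Matrix (Fin p) (Fin q) ℝ), Measurable (M.toEuclideanLin) :=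
        fun M => (LinearMap.continuous_of_finiteDimensional _).measurable
      exact (((hm _).comp ih).add ((hm _).comp (((hm _).comp ih).add (by fun_prop)))).add
        (by fun_prop)
    · simp [state, ht]

/-- The excess risk `ER(Φ, F) = (2T)⁻¹ 𝔼 ∑_{t < T} ‖(F⋆⁽ᴴ⁺¹⁾ Φ⋆ - F Φ) x[t]‖²` over a fresh
expert trajectory of the target task. -/
def excessRisk (T : ℕ) (Φ : Matrix (Fin k) (Fin nx) ℝ) (F : Matrix (Fin nu) (Fin k) ℝ) : ℝ :=
  1 / (2 * (T : ℝ)) * ∫ x : Fin T → EuclideanSpace ℝ (Fin nx),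
    ∑ t, ‖(S.Fstar (Fin.last H) * S.Φstar - F * Φ).toEuclideanLin (x t)‖ ^ 2 ∂S.targetStateLaw T

/-- `λ̄ = max_{h ∈ [H]} λ_max(covX⁽ʰ⁾)`, over the source tasks. -/
def lambdaBar : ℝ := ⨆ h : Fin H, lambdaMax (S.covX h.castSucc)

/-- `λ̲ = min_{h ∈ [H]} λ_min(covX⁽ʰ⁾)`, over the source tasks. -/
def lambdaUnderbar : ℝ := ⨅ h : Fin H, lambdaMin (S.covX h.castSucc)

/-- The covariance coverage constant
`c = min_{h ∈ [H]} λ_min((covX⁽ᴴ⁺¹⁾)^{-1/2} covX⁽ʰ⁾ (covX⁽ᴴ⁺¹⁾)^{-1/2})`. -/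
def coverage : ℝ :=
  ⨅ h : Fin H, lambdaMin ((CFC.sqrt (S.covX (Fin.last H)))⁻¹ * S.covX h.castSucc *
    (CFC.sqrt (S.covX (Fin.last H)))⁻¹)

/-- The source weights `F⋆⁽¹⁾, …, F⋆⁽ᴴ⁾` stacked on top of each other. -/
def stackedWeights : Matrix (Fin H × Fin nu) (Fin k) ℝ :=
  fun p j => S.Fstar p.1.castSucc p.2 j

/-- Diverse source controllers with constant `C₀`:
`‖F⋆⁽ᴴ⁺¹⁾ [F⋆⁽¹⁾; …; F⋆⁽ᴴ⁾]†‖² ≤ C₀ / H`. -/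
def DiverseSources (C₀ : ℝ) : Prop :=
  ‖S.Fstar (Fin.last H) * pinv S.stackedWeights‖ ^ 2 ≤ C₀ / H

/-- The target weights vanish wherever all source weights vanish, i.e. the row space of `F⋆⁽ᴴ⁺¹⁾` is
contained in that of the stacked source weights. This holds in particular when the latter have full
column rank `k`, and when some source weights equal the target weights. -/
def SourcesSpanTarget : Prop :=
  ∀ v : Fin k → ℝ, S.stackedWeights *ᵥ v = 0 → S.Fstar (Fin.last H) *ᵥ v = 0

end TaskFamily

/-! ### The two-stage estimator -/

/-- The squared prediction error `∑_{i, t} ‖F Φ x_i[t] - u_i[t]‖²` on a data set. -/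
def sqLoss {N T : ℕ} (D : Fin N → Trajectory nx nu T) (Φ : Matrix (Fin k) (Fin nx) ℝ)
    (F : Matrix (Fin nu) (Fin k) ℝ) : ℝ :=
  ∑ i, ∑ t, ‖F.toEuclideanLin (Φ.toEuclideanLin (D i t).1) - (D i t).2‖ ^ 2

/-- `Φ` is the representation part of a minimizer `(Φ, F⁽¹⁾, …, F⁽ᴴ⁾)` of the total squared loss on
the source data. -/
def IsPretrained {N T : ℕ} (D : Fin H → Fin N → Trajectory nx nu T)
    (Φ : Matrix (Fin k) (Fin nx) ℝ) : Prop :=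
  ∃ F : Fin H → Matrix (Fin nu) (Fin k) ℝ,
    ∀ (Φ' : Matrix (Fin k) (Fin nx) ℝ) (F' : Fin H → Matrix (Fin nu) (Fin k) ℝ),
      ∑ h, sqLoss (D h) Φ (F h) ≤ ∑ h, sqLoss (D h) Φ' (F' h)

/-- `F` minimizes the squared loss on the target data, for the given representation `Φ`. -/
def IsFineTuned {N T : ℕ} (D : Fin N → Trajectory nx nu T) (Φ : Matrix (Fin k) (Fin nx) ℝ)
    (F : Matrix (Fin nu) (Fin k) ℝ) : Prop :=
  ∀ F' : Matrix (Fin nu) (Fin k) ℝ, sqLoss D Φ F ≤ sqLoss D Φ F'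

/-- Independent expert demonstrations: `N₁` trajectories of length `T` of each source task and
`N₂` of the target task, given through the noise that drives them. -/
structure IsDemonstrationNoise (S : TaskFamily nx nu k H) {N₁ N₂ T : ℕ} {Ω : Type*}
    [MeasurableSpace Ω] (μ : Measure Ω) (src : Fin H → Fin N₁ → Ω → TrajNoise nx nu T)
    (tgt : Fin N₂ → Ω → TrajNoise nx nu T) : Prop where
  law_src : ∀ h i, HasLaw (src h i) (S.noiseLaw h.castSucc T) μ
  law_tgt : ∀ i, HasLaw (tgt i) (S.noiseLaw (Fin.last H) T) μ
  indep : iIndepFun (Sum.elim (fun p : Fin H × Fin N₁ => src p.1 p.2) tgt) μ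

end MultiTaskIL

end

/-!
The states of a stable closed loop driven by Gaussian noise are Gaussian, and the Lyapunov equation makes
the noise contributions to the variance of a linear functional `∑ ⟪v t, x[t]⟫` telescope. This bounds the
temporal correlation of a trajectory by a multiple of `𝒥 (A + B K) * √κ` (`variance_sum_inner_state_le`), so that
`∑ ‖D x[t]‖²` has the exponential moments of a sum of weakly dependent terms
(`lintegral_exp_output_le`). Over `N` independent trajectories, a `1/4`-net then shows that the empirical
norm `‖design D‖` is comparable to the population norm `√(N T) * ‖weight D‖` uniformly over a subspace
(`measure_not_design_bounds_le`). The actuator noise `z[t]` is independent of `x[0], …, x[t]`, so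
`exp (∑ (⟪z[t], D x[t]⟫ - σ² / 2 * ‖D x[t]‖²))` has expectation at most one, and the same net bounds the
self-normalized process `⟪actuator, design D⟫` on the subspace (`measure_inner_actuator_gt_le`).

For the sources, the errors `F h * Φ - K h` of all heads have their rows in the span of the rows of `Φ` and
`Φstar`, that is, they are `G h * Ψ` with `Ψ` a `2 k × nx` matrix with orthonormal rows. Replacing `Ψ` by a
point of a fine grid leaves a union of finitely many subspaces of dimension `2 k * nu * H`, on which the
process is controlled simultaneously. The basic inequality of least squares then bounds the total
population error of the sources (`measure_source_error_gt_le`); it costs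
`log #grid ≈ k * nx * log (N T λ̄ / λ̲)` and `k * nu * H` degrees of freedom.

The pseudo-inverse of the stacked source weights turns the source heads into a head for the target whose
bias is at most `C₀ / (c H)` times the source error (`exists_target_head`). Conditionally on the source
data, `Φ` is fixed, and fine-tuning is a misspecified linear regression with `k * nu` parameters whose bias
is that of the head just constructed (`measure_not_fineTuningEvent_le`,
`excessRisk_le_of_fineTuningEvent`). The two steps are combined by Fubini on the product of the laws of the
source and the target data (`measure_prod_union_le`).
-/

namespace MultiTaskIL

/-! ### Nets of spheres -/

open Metric Module in
/-- Balls of radius `1/8` around `1/4`-separated unit vectors are disjoint and contained in the ball of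
radius `9/8`, so comparing volumes bounds the number of such vectors. -/
theorem card_le_of_separated_sphere {E : Type*} [NormedAddCommGroup E] [NormedSpace ℝ E]
    [FiniteDimensional ℝ E] (s : Finset E) (hs : ∀ c ∈ s, ‖c‖ ≤ 1)
    (h : ∀ c ∈ s, ∀ d ∈ s, c ≠ d → 1 / 4 ≤ ‖c - d‖) : s.card ≤ 9 ^ finrank ℝ E := by
  borelize E
  let μ : Measure E := Measure.addHaar
  set A := ⋃ c ∈ s, ball (c : E) (1 / 8) with hA
  have D : Set.Pairwise (s : Set E) (Function.onFun Disjoint fun c => ball (c : E) (1 / 8)) := by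
    rintro c hc d hd hcd
    apply ball_disjoint_ball
    rw [dist_eq_norm]
    convert h c hc d hd hcd
    norm_num
  have A_subset : A ⊆ ball (0 : E) (9 / 8) := by
    refine Set.iUnion₂_subset fun x hx => ?_
    apply ball_subset_ball'
    calc
      1 / 8 + dist x 0 ≤ 1 / 8 + 1 := by rw [dist_zero_right]; exact add_le_add le_rfl (hs x hx)
      _ = 9 / 8 := by norm_num
  have I : (s.card : ENNReal) * ENNReal.ofReal ((1 / 8 : ℝ) ^ finrank ℝ E) * μ (ball 0 1) ≤
      ENNReal.ofReal ((9 / 8 : ℝ) ^ finrank ℝ E) * μ (ball 0 1) :=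
    calc
      (s.card : ENNReal) * ENNReal.ofReal ((1 / 8 : ℝ) ^ finrank ℝ E) * μ (ball 0 1) = μ A := by
        rw [hA, measure_biUnion_finset D fun c _ => measurableSet_ball]
        simp only [μ.addHaar_ball_of_pos _ (show (0 : ℝ) < 1 / 8 by norm_num),
          Finset.sum_const, nsmul_eq_mul, mul_assoc]
      _ ≤ μ (ball (0 : E) (9 / 8)) := measure_mono A_subset
      _ = ENNReal.ofReal ((9 / 8 : ℝ) ^ finrank ℝ E) * μ (ball 0 1) := by
        simp only [μ.addHaar_ball_of_pos _ (show (0 : ℝ) < 9 / 8 by norm_num)]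
  have J : (s.card : ENNReal) * ENNReal.ofReal ((1 / 8 : ℝ) ^ finrank ℝ E) ≤
      ENNReal.ofReal ((9 / 8 : ℝ) ^ finrank ℝ E) :=
    (ENNReal.mul_le_mul_iff_left (measure_ball_pos _ _ zero_lt_one).ne' measure_ball_lt_top.ne).1 I
  have K : (s.card : ℝ) ≤ (9 : ℝ) ^ finrank ℝ E := by
    have := ENNReal.toReal_le_of_le_ofReal (by positivity) J
    simp only [ENNReal.toReal_mul, ENNReal.toReal_natCast] at this
    rw [ENNReal.toReal_ofReal (by positivity)] at this
    have h9 : (9 / 8 : ℝ) ^ finrank ℝ E = 9 ^ finrank ℝ E * (1 / 8) ^ finrank ℝ E := by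
      rw [← mul_pow]; norm_num
    rw [h9] at this
    exact le_of_mul_le_mul_right this (by positivity)
  exact_mod_cast K

/-- A maximal `1/4`-separated subset of the unit sphere is a `1/4`-net. -/
theorem exists_net_sphere (E : Type*) [NormedAddCommGroup E] [NormedSpace ℝ E]
    [FiniteDimensional ℝ E] : ∃ s : Finset E, s.card ≤ 9 ^ Module.finrank ℝ E ∧
      (∀ c ∈ s, ‖c‖ = 1) ∧ ∀ v : E, ‖v‖ = 1 → ∃ c ∈ s, ‖v - c‖ ≤ 1 / 4 := by
  classical
  let P : ℕ → Prop := fun m => ∃ s : Finset E, s.card = m ∧ (∀ c ∈ s, ‖c‖ = 1) ∧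
    ∀ c ∈ s, ∀ d ∈ s, c ≠ d → 1 / 4 ≤ ‖c - d‖
  have hP : ∀ m, P m → m ≤ 9 ^ Module.finrank ℝ E := by
    rintro m ⟨s, rfl, h1, h2⟩
    exact card_le_of_separated_sphere s (fun c hc => (h1 c hc).le) h2
  obtain ⟨s, hc, h1, h2⟩ : P (Nat.findGreatest P (9 ^ Module.finrank ℝ E)) :=
    Nat.findGreatest_spec (m := 0) (Nat.zero_le _) ⟨∅, by simp⟩
  refine ⟨s, hP _ ⟨s, rfl, h1, h2⟩, h1, fun v hv => ?_⟩
  by_contra! hcon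
  have hvs : v ∉ s := fun h => by have := hcon v h; norm_num at this
  have hnew : P (s.card + 1) := by
    refine ⟨insert v s, Finset.card_insert_of_notMem hvs, ?_, ?_⟩
    · simpa [hv] using h1
    · intro c hc d hd hcd
      rcases Finset.mem_insert.1 hc with hcv | hcs <;> rcases Finset.mem_insert.1 hd with hdv | hds
      · exact absurd (hcv.trans hdv.symm) hcd
      · rw [hcv]; exact (hcon d hds).le
      · rw [hdv, norm_sub_rev]; exact (hcon c hcs).le
      · exact h2 c hcs d hds hcd
  have := Nat.le_findGreatest (hP _ hnew) hnew
  omega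

/-- A net of the unit sphere of a finite-dimensional subspace `W`, for the seminorm `‖L ·‖`. -/
theorem exists_net_submodule {V E : Type*} [AddCommGroup V] [Module ℝ V] [NormedAddCommGroup E]
    [NormedSpace ℝ E] (L : V →ₗ[ℝ] E) (W : Submodule ℝ V) [FiniteDimensional ℝ W] :
    ∃ s : Finset V, s.card ≤ 9 ^ Module.finrank ℝ W ∧ (∀ c ∈ s, c ∈ W ∧ ‖L c‖ = 1) ∧
      ∀ v ∈ W, ‖L v‖ = 1 → ∃ c ∈ s, ‖L (v - c)‖ ≤ 1 / 4 := by
  classical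
  obtain ⟨s, h1, h2, h3⟩ := exists_net_sphere (W.map L)
  have hpre : ∀ c : W.map L, ∃ v ∈ W, L v = c := fun c => Submodule.mem_map.1 c.2
  choose g hgW hgL using hpre
  refine ⟨s.image g, ?_, ?_, ?_⟩
  · exact (Finset.card_image_le.trans h1).trans
      (Nat.pow_le_pow_right (by norm_num) (Submodule.finrank_map_le L W))
  · intro c hc
    obtain ⟨d, hd, rfl⟩ := Finset.mem_image.1 hc
    exact ⟨hgW d, by rw [hgL]; exact h2 d hd⟩
  · intro v hv hv1
    obtain ⟨d, hd, hdv⟩ := h3 ⟨L v, Submodule.mem_map_of_mem hv⟩ hv1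
    refine ⟨g d, Finset.mem_image_of_mem g hd, ?_⟩
    rw [map_sub, hgL]
    exact hdv

/-- A sublinear function that is at most `a` on a `1/4`-net of the unit sphere, and that is known to be
bounded, is at most `4/3 * a` on the unit sphere. -/
theorem sublinear_le_of_net {V E : Type*} [AddCommGroup V] [Module ℝ V] [NormedAddCommGroup E]
    [NormedSpace ℝ E] {L : V →ₗ[ℝ] E} {W : Submodule ℝ V} {s : Finset V}
    (hsW : ∀ c ∈ s, c ∈ W) (hnet : ∀ v ∈ W, ‖L v‖ = 1 → ∃ c ∈ s, ‖L (v - c)‖ ≤ 1 / 4)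
    {g : V → ℝ} (hadd : ∀ u v, g (u + v) ≤ g u + g v) (hsmul : ∀ (c : ℝ) v, 0 ≤ c → g (c • v) = c * g v)
    {C : ℝ} (hC : ∀ v ∈ W, g v ≤ C * ‖L v‖) {a : ℝ} (ha : 0 ≤ a) (hg : ∀ c ∈ s, g c ≤ a) :
    ∀ v ∈ W, g v ≤ 4 / 3 * a * ‖L v‖ := by
  have step : ∀ M : ℝ, 0 ≤ M → (∀ v ∈ W, g v ≤ M * ‖L v‖) →
      ∀ v ∈ W, g v ≤ (a + M / 4) * ‖L v‖ := by
    intro M hM0 hM v hv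
    rcases eq_or_ne ‖L v‖ 0 with h0 | h0
    · have := hM v hv
      rw [h0] at this ⊢
      simpa using this
    · have hpos : 0 < ‖L v‖ := lt_of_le_of_ne (norm_nonneg _) h0.symm
      set w := ‖L v‖⁻¹ • v with hw
      have hwW : w ∈ W := W.smul_mem _ hv
      have hw1 : ‖L w‖ = 1 := by
        rw [hw, map_smul, norm_smul, norm_inv, norm_norm, inv_mul_cancel₀ h0]
      obtain ⟨c, hc, hcw⟩ := hnet w hwW hw1
      have h1 : g w ≤ a + M / 4 := by
        calc g w = g (c + (w - c)) := by congr 1; abel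
          _ ≤ g c + g (w - c) := hadd _ _
          _ ≤ a + M * ‖L (w - c)‖ := add_le_add (hg c hc) (hM _ (W.sub_mem hwW (hsW c hc)))
          _ ≤ a + M * (1 / 4) := by gcongr
          _ = a + M / 4 := by ring
      have h2 : g v = ‖L v‖ * g w := by
        rw [hw, hsmul _ _ (by positivity), ← mul_assoc, mul_inv_cancel₀ h0, one_mul]
      rw [h2, mul_comm]
      gcongr
  -- the least admissible constant is a fixed point of the improvement step
  let S : Set ℝ := {M | 0 ≤ M ∧ ∀ v ∈ W, g v ≤ M * ‖L v‖}
  have hne : S.Nonempty := ⟨max C 0, le_max_right _ _, fun v hv => (hC v hv).trans (by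
    gcongr; exact le_max_left _ _)⟩
  have hbdd : BddBelow S := ⟨0, fun M hM => hM.1⟩
  have hclosed : IsClosed S := by
    have : S = Set.Ici 0 ∩ ⋂ v ∈ W, {M | g v ≤ M * ‖L v‖} := by
      ext M; simp [S]
    rw [this]
    refine isClosed_Ici.inter (isClosed_biInter fun v _ => ?_)
    exact isClosed_le continuous_const (by fun_prop)
  have hmem := hclosed.csInf_mem hne hbdd
  have h2 : a + sInf S / 4 ∈ S := ⟨by have := hmem.1; positivity, step _ hmem.1 hmem.2⟩
  have h3 := csInf_le hbdd h2
  intro v hv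
  refine (hmem.2 v hv).trans ?_
  gcongr
  linarith

/-- Two-sided bounds for a linear map `X` on a net of the unit sphere extend to the whole subspace. -/
theorem norm_bounds_of_net {V E F : Type*} [AddCommGroup V] [Module ℝ V] [NormedAddCommGroup E]
    [NormedSpace ℝ E] [NormedAddCommGroup F] [NormedSpace ℝ F] {L : V →ₗ[ℝ] E} {W : Submodule ℝ V}
    {s : Finset V} (hsW : ∀ c ∈ s, c ∈ W)
    (hnet : ∀ v ∈ W, ‖L v‖ = 1 → ∃ c ∈ s, ‖L (v - c)‖ ≤ 1 / 4)
    (X : V →ₗ[ℝ] F) {C : ℝ} (hC : ∀ v ∈ W, ‖X v‖ ≤ C * ‖L v‖) {a b : ℝ} (ha : 0 ≤ a)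
    (hub : ∀ c ∈ s, ‖X c‖ ≤ a) (hlb : ∀ c ∈ s, b ≤ ‖X c‖) :
    ∀ v ∈ W, ‖X v‖ ≤ 4 / 3 * a * ‖L v‖ ∧ (b - a / 3) * ‖L v‖ ≤ ‖X v‖ := by
  have hup : ∀ v ∈ W, ‖X v‖ ≤ 4 / 3 * a * ‖L v‖ :=
    sublinear_le_of_net hsW hnet (g := fun v => ‖X v‖)
      (fun u v => by simpa using norm_add_le _ _)
      (fun c v hc => by simp [norm_smul, abs_of_nonneg hc]) hC ha hub
  refine fun v hv => ⟨hup v hv, ?_⟩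
  rcases eq_or_ne ‖L v‖ 0 with h0 | h0
  · rw [h0, mul_zero]; exact norm_nonneg _
  · set w := ‖L v‖⁻¹ • v with hw
    have hwW : w ∈ W := W.smul_mem _ hv
    have hw1 : ‖L w‖ = 1 := by
      rw [hw, map_smul, norm_smul, norm_inv, norm_norm, inv_mul_cancel₀ h0]
    obtain ⟨c, hc, hcw⟩ := hnet w hwW hw1
    have h1 : b - a / 3 ≤ ‖X w‖ := by
      have e : ‖X c‖ ≤ ‖X w‖ + ‖X (w - c)‖ := by
        have : X c = X w - X (w - c) := by simp
        rw [this]; exact norm_sub_le _ _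
      have e2 := hup _ (W.sub_mem hwW (hsW c hc))
      have e3 : 4 / 3 * a * ‖L (w - c)‖ ≤ 4 / 3 * a * (1 / 4) := by gcongr
      have := hlb c hc
      linarith
    have h2 : ‖X v‖ = ‖L v‖ * ‖X w‖ := by
      rw [hw, map_smul, norm_smul, norm_inv, norm_norm, ← mul_assoc, mul_inv_cancel₀ h0, one_mul]
    rw [h2, mul_comm]
    gcongr

/-! ### Exponential moments of Gaussian vectors -/

open Real in
theorem one_le_one_sub_mul_exp {x : ℝ} (hx : |x| ≤ 1 / 2) : 1 ≤ (1 - x) * exp (x + x ^ 2) := by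
  obtain ⟨h1, h2⟩ := abs_le.1 hx
  rcases le_total 0 x with h0 | h0
  · have := quadratic_le_exp_of_nonneg (show 0 ≤ x + x ^ 2 by positivity)
    calc (1 : ℝ) ≤ (1 - x) * (1 + (x + x ^ 2) + (x + x ^ 2) ^ 2 / 2) := by
          have e : x ^ 2 ≤ x * (1 / 2) := by nlinarith
          have e3 : x ^ 3 ≤ x * (1 / 4) := by nlinarith
          have : (1 - x) * (1 + (x + x ^ 2) + (x + x ^ 2) ^ 2 / 2)
              = 1 + x ^ 2 / 2 * (1 - x - x ^ 2 - x ^ 3) := by ring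
          rw [this]
          have : 0 ≤ x ^ 2 / 2 * (1 - x - x ^ 2 - x ^ 3) := by
            apply mul_nonneg (by positivity); linarith
          linarith
      _ ≤ _ := by gcongr; linarith
  · have hy : |-(x + x ^ 2)| ≤ 1 := by rw [abs_le]; constructor <;> nlinarith
    have h3 := (abs_le.1 (abs_exp_sub_one_sub_id_le hy)).2
    have h4 : exp (-(x + x ^ 2)) ≤ 1 - x := by nlinarith [sq_nonneg x, sq_nonneg (x * x)]
    calc (1 : ℝ) = exp (-(x + x ^ 2)) * exp (x + x ^ 2) := by rw [← exp_add]; simp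
      _ ≤ _ := by gcongr

open Real in
/-- The Laplace transform `(1 - 2 s v)^{-1/2}` of the square of a centered Gaussian variable of
variance `v ≤ Λ`, bounded by its second-order expansion. -/
theorem lintegral_exp_sq_gaussianReal_le (v : NNReal) {s Λ : ℝ} (hv : v ≤ Λ) (hs : |s| * Λ ≤ 1 / 4) :
    ∫⁻ x, ENNReal.ofReal (exp (s * x ^ 2)) ∂gaussianReal 0 v
      ≤ ENNReal.ofReal (exp ((s + 2 * s ^ 2 * Λ) * v)) := by
  rcases eq_or_ne v 0 with rfl | hv0
  · simp
  have hvpos : (0 : ℝ) < v := lt_of_le_of_ne v.2 (by exact_mod_cast hv0.symm)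
  have hsv : |2 * s * v| ≤ 1 / 2 := by
    rw [abs_mul, abs_mul, abs_of_pos hvpos, abs_two]
    have : |s| * v ≤ |s| * Λ := by gcongr
    linarith
  have h1 : 0 < 1 - 2 * s * v := by have := (abs_le.1 hsv).2; linarith
  set b : ℝ := (1 - 2 * s * v) / (2 * v) with hb
  have hbpos : 0 < b := by positivity
  have key : ∫⁻ x, ENNReal.ofReal (exp (s * x ^ 2)) ∂gaussianReal 0 v
      = ENNReal.ofReal ((√(2 * π * v))⁻¹ * √(π / b)) := by
    rw [gaussianReal_of_var_ne_zero _ hv0,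
      lintegral_withDensity_eq_lintegral_mul _ (by fun_prop) (by fun_prop), ← integral_gaussian b,
      ← integral_const_mul, ofReal_integral_eq_lintegral_ofReal]
    · refine lintegral_congr fun x => ?_
      rw [Pi.mul_apply, gaussianPDF, ← ENNReal.ofReal_mul (gaussianPDFReal_nonneg _ _ _),
        gaussianPDFReal, mul_assoc, ← exp_add]
      congr 3
      rw [hb]
      field_simp
      ring
    · exact (integrable_exp_neg_mul_sq hbpos).const_mul _
    · exact Filter.Eventually.of_forall fun x => by positivity
  rw [key]
  apply ENNReal.ofReal_le_ofReal
  have e1 : (√(2 * π * v))⁻¹ * √(π / b) = √((1 - 2 * s * v)⁻¹) := by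
    rw [← sqrt_inv, ← sqrt_mul (by positivity)]
    congr 1
    rw [hb]
    field_simp
  rw [e1]
  apply sqrt_le_left (by positivity) |>.2
  have e2 := one_le_one_sub_mul_exp hsv
  calc (1 - 2 * s * v)⁻¹ ≤ exp (2 * s * v + (2 * s * v) ^ 2) := by
        rw [inv_le_iff_one_le_mul₀ h1, mul_comm]; exact e2
    _ ≤ exp (2 * ((s + 2 * s ^ 2 * Λ) * v)) := by
        apply exp_le_exp.2
        have : s ^ 2 * v * v ≤ s ^ 2 * v * Λ := by gcongr
        nlinarith
    _ = exp ((s + 2 * s ^ 2 * Λ) * v) ^ 2 := by rw [← exp_nat_mul]; norm_cast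

section Gaussian

variable {E : Type*} [NormedAddCommGroup E] [MeasurableSpace E] [BorelSpace E]

theorem lintegral_exp_dual_gaussian [NormedSpace ℝ E] (μ : Measure E) [IsGaussian μ]
    (L : StrongDual ℝ E) (h0 : ∫ y, L y ∂μ = 0) :
    ∫⁻ y, ENNReal.ofReal (Real.exp (L y)) ∂μ = ENNReal.ofReal (Real.exp (Var[L; μ] / 2)) := by
  have h1 := IsGaussian.map_eq_gaussianReal (μ := μ) L
  rw [h0] at h1
  have h2 : ∫⁻ y, ENNReal.ofReal (Real.exp (L y)) ∂μ
      = ∫⁻ x, ENNReal.ofReal (Real.exp x) ∂gaussianReal 0 Var[L; μ].toNNReal := by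
    rw [← h1, lintegral_map (by fun_prop) (by fun_prop)]
  rw [h2, ← ofReal_integral_eq_lintegral_ofReal]
  · congr 1
    have := congrFun (mgf_id_gaussianReal (μ := 0) (v := Var[L; μ].toNNReal)) 1
    simp only [mgf, id, one_mul] at this
    rw [this, Real.coe_toNNReal _ (variance_nonneg _ _)]
    norm_num
  · have := integrable_exp_mul_gaussianReal (μ := 0) (v := Var[L; μ].toNNReal) 1
    simpa using this
  · exact Filter.Eventually.of_forall fun x => by positivity

variable [InnerProductSpace ℝ E] [FiniteDimensional ℝ E]

/-- The exponential moment of the squared norm of a centered Gaussian vector whose covariance is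
bounded by `Λ`. In an orthonormal basis of eigenvectors of the covariance the coordinates are
independent, which reduces the claim to one dimension. -/
theorem lintegral_exp_norm_sq_gaussian_le (μ : Measure E) [IsGaussian μ] (h0 : ∫ y, y ∂μ = 0)
    {s Λ : ℝ} (hΛ : ∀ u : E, Var[fun y => inner ℝ u y; μ] ≤ Λ * ‖u‖ ^ 2) (hs : |s| * Λ ≤ 1 / 4) :
    ∫⁻ y, ENNReal.ofReal (Real.exp (s * ‖y‖ ^ 2)) ∂μ
      ≤ ENNReal.ofReal (Real.exp ((s + 2 * s ^ 2 * Λ) * ∫ y, ‖y‖ ^ 2 ∂μ)) := by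
  have hE : CompleteSpace E := FiniteDimensional.complete ℝ E
  have hid : MemLp id 2 μ := IsGaussian.memLp_two_id
  let A : E →L[ℝ] E := InnerProductSpace.continuousLinearMapOfBilin (covarianceBilin μ)
  have hA : ∀ u w, inner ℝ (A u) w = cov[fun y => inner ℝ u y, fun y => inner ℝ w y; μ] := by
    intro u w
    rw [InnerProductSpace.continuousLinearMapOfBilin_apply, covarianceBilin_apply_eq_cov hid]
  have hsymm : (A : E →ₗ[ℝ] E).IsSymmetric := by
    intro u w
    change inner ℝ (A u) w = inner ℝ u (A w)
    rw [real_inner_comm (A w) u, hA, hA, covariance_comm]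
  let b := hsymm.eigenvectorBasis rfl
  let X : Fin (Module.finrank ℝ E) → E → ℝ := fun j y => inner ℝ (b j) y
  have hXm : ∀ j, Measurable (X j) := fun j => by fun_prop
  have hXlp : ∀ j, MemLp (X j) 2 μ := fun j => hid.const_inner (b j)
  have hmean : ∀ j, ∫ y, X j y ∂μ = 0 := fun j => by
    have := (innerSL ℝ (b j)).integral_comp_comm (hid.integrable (by norm_num))
    simp only [id] at this
    rw [h0] at this
    simpa [X] using this
  have hgauss : HasGaussianLaw (fun y j => X j y) μ := by
    have := (IsGaussian.hasGaussianLaw_id (μ := μ)).map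
      (ContinuousLinearMap.pi fun j => innerSL ℝ (b j))
    exact this
  have hind : iIndepFun X μ := by
    refine hgauss.iIndepFun_of_covariance_eq_zero fun i j hij => ?_
    have h1 : cov[X i, X j; μ] = inner ℝ (A (b i)) (b j) := (hA _ _).symm
    have h2 : A (b i) = (hsymm.eigenvalues rfl i) • b i := hsymm.apply_eigenvectorBasis rfl i
    rw [h1, h2, real_inner_smul_left, b.orthonormal.2 hij, mul_zero]
  have hsum : ∀ y, ‖y‖ ^ 2 = ∑ j, X j y ^ 2 := fun y => (b.sum_sq_inner_right y).symm
  have hvar : ∀ j, Var[X j; μ] = ∫ y, X j y ^ 2 ∂μ := fun j => by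
    rw [variance_of_integral_eq_zero (hXm j).aemeasurable (hmean j)]
  have htr : ∫ y, ‖y‖ ^ 2 ∂μ = ∑ j, Var[X j; μ] := by
    simp_rw [hsum, hvar]
    exact integral_finsetSum _ fun j _ => (hXlp j).integrable_sq
  have hlaw : ∀ j, ∫⁻ y, ENNReal.ofReal (Real.exp (s * X j y ^ 2)) ∂μ
      ≤ ENNReal.ofReal (Real.exp ((s + 2 * s ^ 2 * Λ) * Var[X j; μ])) := by
    intro j
    have h1 := IsGaussian.map_eq_gaussianReal (μ := μ) (innerSL ℝ (b j))
    have h2 : ∫⁻ y, ENNReal.ofReal (Real.exp (s * X j y ^ 2)) ∂μ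
        = ∫⁻ x, ENNReal.ofReal (Real.exp (s * x ^ 2)) ∂(μ.map (innerSL ℝ (b j))) := by
      rw [lintegral_map (by fun_prop) (by fun_prop)]
      rfl
    have h3 : ∫ y, innerSL ℝ (b j) y ∂μ = 0 := hmean j
    rw [h2, h1, h3]
    have h4 : (Var[innerSL ℝ (b j); μ].toNNReal : ℝ) = Var[X j; μ] :=
      Real.coe_toNNReal _ (variance_nonneg _ _)
    rw [← h4]
    refine lintegral_exp_sq_gaussianReal_le _ ?_ hs
    rw [h4]
    have := hΛ (b j)
    rwa [b.norm_eq_one, one_pow, mul_one] at this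
  calc ∫⁻ y, ENNReal.ofReal (Real.exp (s * ‖y‖ ^ 2)) ∂μ
      = ∫⁻ y, ∏ j, ENNReal.ofReal (Real.exp (s * X j y ^ 2)) ∂μ := by
        refine lintegral_congr fun y => ?_
        rw [← ENNReal.ofReal_prod_of_nonneg fun j _ => (Real.exp_pos _).le, ← Real.exp_sum, hsum,
          Finset.mul_sum]
    _ = ∏ j, ∫⁻ y, ENNReal.ofReal (Real.exp (s * X j y ^ 2)) ∂μ := by
        have hm : Measurable fun x : ℝ => ENNReal.ofReal (Real.exp (s * x ^ 2)) := by fun_prop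
        exact lintegral_prod_eq_prod_lintegral_of_indepFun Finset.univ _
          (hind.comp (fun _ x => ENNReal.ofReal (Real.exp (s * x ^ 2))) fun _ => hm)
          fun j => hm.comp (hXm j)
    _ ≤ ∏ j, ENNReal.ofReal (Real.exp ((s + 2 * s ^ 2 * Λ) * Var[X j; μ])) :=
        Finset.prod_le_prod' fun j _ => hlaw j
    _ = _ := by
        rw [← ENNReal.ofReal_prod_of_nonneg fun j _ => (Real.exp_pos _).le, ← Real.exp_sum, htr,
          Finset.mul_sum]

end Gaussian

/-! ### Products of conditionally integrable factors -/

/-- If the `t`-th factor depends only on the coordinates before `t` and on the `t`-th one, and has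
integral at most one over the latter, then the integral of the product is at most one. -/
theorem lintegral_prod_predictable_le {E : Type*} [MeasurableSpace E] [Nonempty E] (ν : Measure E)
    [IsProbabilityMeasure ν] :
    ∀ {T : ℕ} (g : Fin T → (Fin T → E) → E → ENNReal)
      (_ : ∀ t, Measurable fun p : (Fin T → E) × E => g t p.1 p.2)
      (_ : ∀ t z z' y, (∀ s < t, z s = z' s) → g t z y = g t z' y)
      (_ : ∀ t z, ∫⁻ y, g t z y ∂ν ≤ 1),
      ∫⁻ z, ∏ t, g t z (z t) ∂(Measure.pi fun _ => ν) ≤ 1 := by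
  intro T
  induction T with
  | zero => intro g _ _ _; simp
  | succ n ih =>
    intro g hm hdep hint
    obtain ⟨e⟩ := ‹Nonempty E›
    let I : E × (Fin n → E) → (Fin (n + 1) → E) := fun p => (Fin.last n).insertNth p.1 p.2
    have hmp := (measurePreserving_piFinSuccAbove (fun _ : Fin (n + 1) => ν) (Fin.last n)).symm
    have hImeas : Measurable I := hmp.measurable
    have hI : ∀ p t, I p t.castSucc = p.2 t := fun p t => by
      have := (Fin.last n).insertNth_apply_succAbove (α := fun _ => E) p.1 p.2 t
      rwa [Fin.succAbove_last] at this
    have hIl : ∀ p, I p (Fin.last n) = p.1 := fun p => Fin.insertNth_apply_same _ _ _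
    have hdepI : ∀ t y y' z w, g t (I (y, z)) w = g t (I (y', z)) w := by
      intro t y y' z w
      refine hdep t _ _ _ fun s hs => ?_
      obtain ⟨r, rfl⟩ : ∃ r : Fin n, s = r.castSucc :=
        ⟨s.castPred (ne_of_lt (lt_of_lt_of_le hs (Fin.le_last t))), by simp⟩
      rw [hI, hI]
    have hIe : Measurable fun z : Fin n → E => I (e, z) := hImeas.comp (by fun_prop)
    have hm' : Measurable fun z : Fin (n + 1) → E => ∏ t, g t z (z t) :=
      Finset.measurable_prod _ fun t _ => (hm t).comp (measurable_id.prodMk (measurable_pi_apply t))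
    have h1 : ∫⁻ z, ∏ t, g t z (z t) ∂(Measure.pi fun _ => ν)
        = ∫⁻ p, ∏ t, g t (I p) (I p t) ∂(ν.prod (Measure.pi fun _ => ν)) :=
      (hmp.lintegral_comp hm').symm
    have h2 : ∀ p : E × (Fin n → E), ∏ t, g t (I p) (I p t)
        = (∏ t : Fin n, g t.castSucc (I (e, p.2)) (p.2 t)) * g (Fin.last n) (I (e, p.2)) p.1 := by
      rintro ⟨y, z⟩
      rw [Fin.prod_univ_castSucc, hIl, hdepI _ y e]
      congr 1
      exact Finset.prod_congr rfl fun t _ => by rw [hI, hdepI _ y e]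
    have hmA : Measurable fun z : Fin n → E => ∏ t : Fin n, g t.castSucc (I (e, z)) (z t) :=
      Finset.measurable_prod _ fun t _ => (hm _).comp (hIe.prodMk (measurable_pi_apply t))
    have hmB : Measurable fun p : E × (Fin n → E) => g (Fin.last n) (I (e, p.2)) p.1 :=
      (hm _).comp ((hIe.comp measurable_snd).prodMk measurable_fst)
    rw [h1]
    simp_rw [h2]
    have hAB : Measurable fun p : E × (Fin n → E) =>
        (∏ t : Fin n, g t.castSucc (I (e, p.2)) (p.2 t)) * g (Fin.last n) (I (e, p.2)) p.1 :=
      (hmA.comp measurable_snd).mul hmB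
    rw [lintegral_prod_symm _ hAB.aemeasurable]
    calc ∫⁻ z, ∫⁻ y, (∏ t : Fin n, g t.castSucc (I (e, z)) (z t)) * g (Fin.last n) (I (e, z)) y ∂ν
          ∂(Measure.pi fun _ => ν)
        ≤ ∫⁻ z, (∏ t : Fin n, g t.castSucc (I (e, z)) (z t)) ∂(Measure.pi fun _ => ν) := by
          refine lintegral_mono fun z => ?_
          have hmy : Measurable fun y => g (Fin.last n) (I (e, z)) y :=
            (hm _).comp (measurable_const.prodMk measurable_id)
          rw [lintegral_const_mul _ hmy]
          exact mul_le_of_le_one_right' (hint _ _)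
      _ ≤ 1 := by
          refine ih (fun t z y => g t.castSucc (I (e, z)) y) (fun t => ?_) (fun t z z' y h => ?_)
            fun t z => hint _ _
          · exact (hm _).comp ((hIe.comp measurable_fst).prodMk measurable_snd)
          · refine hdep _ _ _ _ fun s hs => ?_
            obtain ⟨r, rfl⟩ : ∃ r : Fin n, s = r.castSucc :=
              ⟨s.castPred (ne_of_lt (lt_of_lt_of_le hs (Fin.le_last _))), by simp⟩
            rw [hI, hI]
            exact h r (by simpa using hs)

/-! ### Quadratic forms and eigenvalue bounds -/

section Quad

variable {m n : Type*} [Fintype m] [Fintype n] [DecidableEq n]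

/-- The quadratic form `vᵀ S v`. -/
noncomputable def quad (S : Matrix n n ℝ) (v : EuclideanSpace ℝ n) : ℝ :=
  inner ℝ v (S.toEuclideanLin v)

theorem quad_eq_dotProduct (S : Matrix n n ℝ) (v : EuclideanSpace ℝ n) :
    quad S v = v.ofLp ⬝ᵥ S *ᵥ v.ofLp := by
  rw [quad, EuclideanSpace.inner_eq_star_dotProduct, dotProduct_comm]
  simp

theorem inner_toEuclideanLin_left [DecidableEq m] (M : Matrix m n ℝ) (v : EuclideanSpace ℝ n)
    (w : EuclideanSpace ℝ m) :
    inner ℝ (M.toEuclideanLin v) w = inner ℝ v (Mᵀ.toEuclideanLin w) := by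
  rw [← Matrix.conjTranspose_eq_transpose_of_trivial, Matrix.toEuclideanLin_conjTranspose_eq_adjoint,
    LinearMap.adjoint_inner_right]

theorem inner_toEuclideanLin_right [DecidableEq m] (M : Matrix m n ℝ) (v : EuclideanSpace ℝ n)
    (w : EuclideanSpace ℝ m) :
    inner ℝ w (M.toEuclideanLin v) = inner ℝ (Mᵀ.toEuclideanLin w) v := by
  rw [inner_toEuclideanLin_left, Matrix.transpose_transpose]

theorem norm_toEuclideanLin_le (M : Matrix m n ℝ) (v : EuclideanSpace ℝ n) :
    ‖M.toEuclideanLin v‖ ≤ ‖M‖ * ‖v‖ := Matrix.l2_opNorm_mulVec M v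

theorem posDef_iff_quad {S : Matrix n n ℝ} : S.PosDef ↔ Sᵀ = S ∧ ∀ v, v ≠ 0 → 0 < quad S v := by
  constructor
  · intro h
    refine ⟨by simpa [Matrix.IsHermitian, Matrix.conjTranspose_eq_transpose_of_trivial] using h.1,
      fun v hv => ?_⟩
    rw [quad_eq_dotProduct]
    have := h.dotProduct_mulVec_pos (x := v.ofLp) (by simpa using hv)
    simpa using this
  · rintro ⟨h1, h2⟩
    refine Matrix.PosDef.of_dotProduct_mulVec_pos ?_ fun x hx => ?_
    · rw [Matrix.IsHermitian, Matrix.conjTranspose_eq_transpose_of_trivial, h1]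
    · have := h2 (WithLp.toLp 2 x) (by simpa using hx)
      rw [quad_eq_dotProduct] at this
      simpa using this

theorem quad_nonneg {S : Matrix n n ℝ} (hS : S.PosSemidef) (v : EuclideanSpace ℝ n) :
    0 ≤ quad S v := by
  rw [quad_eq_dotProduct]
  simpa using hS.dotProduct_mulVec_nonneg v.ofLp

theorem transpose_sqrt (S : Matrix n n ℝ) : (CFC.sqrt S)ᵀ = CFC.sqrt S := by
  have h : IsSelfAdjoint (CFC.sqrt S) := (CFC.sqrt_nonneg S).isSelfAdjoint
  rwa [isSelfAdjoint_iff, Matrix.star_eq_conjTranspose,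
    Matrix.conjTranspose_eq_transpose_of_trivial] at h

theorem norm_sqrt_sq {S : Matrix n n ℝ} (hS : S.PosSemidef) (v : EuclideanSpace ℝ n) :
    ‖(CFC.sqrt S).toEuclideanLin v‖ ^ 2 = quad S v := by
  rw [← real_inner_self_eq_norm_sq, inner_toEuclideanLin_left, transpose_sqrt, quad]
  nth_rewrite 3 [← CFC.sqrt_mul_sqrt_self S hS.nonneg]
  simp

theorem quad_algebraMap (r : ℝ) (v : EuclideanSpace ℝ n) :
    quad (algebraMap ℝ (Matrix n n ℝ) r) v = r * ‖v‖ ^ 2 := by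
  rw [quad, Algebra.algebraMap_eq_smul_one]
  simp [real_inner_smul_right]

theorem quad_mono {S R : Matrix n n ℝ} (h : S ≤ R) (v : EuclideanSpace ℝ n) : quad S v ≤ quad R v := by
  have := quad_nonneg (Matrix.le_iff.1 h) v
  rw [quad] at this
  simp only [map_sub, LinearMap.sub_apply, inner_sub_right] at this
  unfold quad
  linarith

theorem isSelfAdjoint_of_posSemidef {ι : Type*} [Fintype ι] {S : Matrix ι ι ℝ} (hS : S.PosSemidef) :
    IsSelfAdjoint S :=
  hS.nonneg.isSelfAdjoint

theorem quad_le_lambdaMax {S : Matrix n n ℝ} (hS : S.PosSemidef) (v : EuclideanSpace ℝ n) :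
    quad S v ≤ lambdaMax S * ‖v‖ ^ 2 := by
  rw [← quad_algebraMap]
  refine quad_mono (le_algebraMap_of_spectrum_le (fun x hx => ?_) (isSelfAdjoint_of_posSemidef hS)) v
  exact le_csSup Matrix.finite_real_spectrum.bddAbove hx

theorem lambdaMin_le_quad {S : Matrix n n ℝ} (hS : S.PosSemidef) (v : EuclideanSpace ℝ n) :
    lambdaMin S * ‖v‖ ^ 2 ≤ quad S v := by
  rw [← quad_algebraMap]
  refine quad_mono (algebraMap_le_of_le_spectrum (fun x hx => ?_) (isSelfAdjoint_of_posSemidef hS)) v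
  exact csInf_le Matrix.finite_real_spectrum.bddBelow hx

theorem spectrum_nonempty_of_posSemidef [Nonempty n] {S : Matrix n n ℝ} (hS : S.PosSemidef) :
    (spectrum ℝ S).Nonempty :=
  ContinuousFunctionalCalculus.spectrum_nonempty S (isSelfAdjoint_of_posSemidef hS)

theorem lambdaMin_pos [Nonempty n] {S : Matrix n n ℝ} (hS : S.PosDef) : 0 < lambdaMin S := by
  have h1 : lambdaMin S ∈ spectrum ℝ S :=
    (spectrum_nonempty_of_posSemidef hS.posSemidef).csInf_mem Matrix.finite_real_spectrum
  rw [hS.1.spectrum_real_eq_range_eigenvalues] at h1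
  obtain ⟨i, hi⟩ := h1
  rw [← hi]
  exact hS.eigenvalues_pos i

theorem lambdaMin_le_lambdaMax [Nonempty n] {S : Matrix n n ℝ} (hS : S.PosSemidef) :
    lambdaMin S ≤ lambdaMax S := by
  obtain ⟨x, hx⟩ := spectrum_nonempty_of_posSemidef hS
  exact (csInf_le Matrix.finite_real_spectrum.bddBelow hx).trans
    (le_csSup Matrix.finite_real_spectrum.bddAbove hx)

theorem one_le_condNumber [Nonempty n] {S : Matrix n n ℝ} (hS : S.PosDef) : 1 ≤ condNumber S := by
  rw [condNumber, one_le_div (lambdaMin_pos hS)]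
  exact lambdaMin_le_lambdaMax hS.posSemidef

/-- `‖S v‖² ≤ λ_max(S) vᵀ S v`. -/
theorem norm_sq_le_lambdaMax_mul_quad {S : Matrix n n ℝ} (hS : S.PosSemidef)
    (v : EuclideanSpace ℝ n) : ‖S.toEuclideanLin v‖ ^ 2 ≤ lambdaMax S * quad S v := by
  have h : S.toEuclideanLin v
      = (CFC.sqrt S).toEuclideanLin ((CFC.sqrt S).toEuclideanLin v) := by
    nth_rewrite 1 [← CFC.sqrt_mul_sqrt_self S hS.nonneg]
    simp
  rw [h, norm_sqrt_sq hS, ← norm_sqrt_sq hS v]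
  exact quad_le_lambdaMax hS _

/-- The bilinear form `⟨Nᵀ w, S v⟩` is bounded through the condition number of `S`. -/
theorem inner_mul_le_condNumber {S : Matrix n n ℝ} (hS : S.PosDef) (N : Matrix n n ℝ)
    (v w : EuclideanSpace ℝ n) :
    inner ℝ v (S.toEuclideanLin (Nᵀ.toEuclideanLin w))
      ≤ ‖N‖ * √(condNumber S) * ((quad S v + quad S w) / 2) := by
  rcases isEmpty_or_nonempty n with hn | hn
  · have hv : v = 0 := Subsingleton.elim _ _
    have hw : w = 0 := Subsingleton.elim _ _
    subst hv; subst hw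
    simp [quad]
  have hl := lambdaMin_pos hS
  have hSt : Sᵀ = S := (posDef_iff_quad.1 hS).1
  have h1 : inner ℝ v (S.toEuclideanLin (Nᵀ.toEuclideanLin w))
      = inner ℝ (N.toEuclideanLin (S.toEuclideanLin v)) w := by
    rw [inner_toEuclideanLin_left, inner_toEuclideanLin_left, hSt]
  have hqv := quad_nonneg hS.posSemidef v
  have hqw := quad_nonneg hS.posSemidef w
  have hM : 0 ≤ lambdaMax S := (hl.le).trans (lambdaMin_le_lambdaMax hS.posSemidef)
  have h2 : ‖S.toEuclideanLin v‖ ≤ √(lambdaMax S) * √(quad S v) := by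
    rw [← Real.sqrt_mul hM]
    exact Real.le_sqrt_of_sq_le (norm_sq_le_lambdaMax_mul_quad hS.posSemidef v)
  have h3 : ‖w‖ ≤ √(quad S w) / √(lambdaMin S) := by
    rw [← Real.sqrt_div hqw]
    apply Real.le_sqrt_of_sq_le
    rw [le_div_iff₀ hl, mul_comm]
    exact lambdaMin_le_quad hS.posSemidef w
  rw [h1]
  calc inner ℝ (N.toEuclideanLin (S.toEuclideanLin v)) w
      ≤ ‖N.toEuclideanLin (S.toEuclideanLin v)‖ * ‖w‖ := real_inner_le_norm _ _
    _ ≤ (‖N‖ * (√(lambdaMax S) * √(quad S v))) * (√(quad S w) / √(lambdaMin S)) := by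
        gcongr
        exact (norm_toEuclideanLin_le _ _).trans (by gcongr)
    _ = ‖N‖ * √(condNumber S) * (√(quad S v) * √(quad S w)) := by
        rw [condNumber, Real.sqrt_div hM]; ring
    _ ≤ _ := by
        gcongr
        have := two_mul_le_add_sq (√(quad S v)) (√(quad S w))
        rw [Real.sq_sqrt hqv, Real.sq_sqrt hqw] at this
        linarith

theorem quad_add {S : Matrix n n ℝ} (hS : Sᵀ = S) (v w : EuclideanSpace ℝ n) :
    quad S (v + w) = quad S v + 2 * inner ℝ v (S.toEuclideanLin w) + quad S w := by
  have h : inner ℝ w (S.toEuclideanLin v) = inner ℝ v (S.toEuclideanLin w) := by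
    rw [inner_toEuclideanLin_right, hS, real_inner_comm]
  simp only [quad, map_add, inner_add_left, inner_add_right, h]
  ring

end Quad

/-! ### Stable closed loops -/

section Stable

variable {n : Type*} [Fintype n] [DecidableEq n]

/-- By Gelfand's formula the powers of a stable matrix decay geometrically. -/
theorem IsSchurStable.summable_norm_pow {M : Matrix n n ℝ} (hM : IsSchurStable M) :
    Summable fun t : ℕ => ‖M ^ t‖ := by
  let Mc : Matrix n n ℂ := M.map (algebraMap ℝ ℂ)
  let reL : Matrix n n ℂ →ₗ[ℝ] Matrix n n ℝ :=
    { toFun := fun A => A.map Complex.re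
      map_add' := fun A B => by ext; simp
      map_smul' := fun c A => by ext; simp }
  let f : Matrix n n ℂ →L[ℝ] Matrix n n ℝ := LinearMap.toContinuousLinearMap reL
  have hf : ∀ t : ℕ, f (Mc ^ t) = M ^ t := by
    intro t
    have h1 : Mc ^ t = (M ^ t).map (algebraMap ℝ ℂ) := (Matrix.map_pow M (algebraMap ℝ ℂ) t).symm
    rw [h1]
    ext i j
    simp [f, reL]
  have hlim := spectrum.pow_nnnorm_pow_one_div_tendsto_nhds_spectralRadius Mc
  obtain ⟨ρ, hρ1, hρ2⟩ := ENNReal.lt_iff_exists_nnreal_btwn.1 (show spectralRadius ℂ Mc < 1 from hM)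
  have hρ : (ρ : ℝ) < 1 := by exact_mod_cast hρ2
  have hev : ∀ᶠ t : ℕ in Filter.atTop, ‖Mc ^ t‖ ≤ (ρ : ℝ) ^ t := by
    filter_upwards [hlim.eventually_lt_const hρ1, Filter.eventually_gt_atTop 0] with t ht ht0
    have h2 : (‖Mc ^ t‖₊ : ENNReal) ≤ (ρ : ENNReal) ^ t := by
      have := ENNReal.rpow_le_rpow ht.le (Nat.cast_nonneg t : (0 : ℝ) ≤ t)
      rwa [← ENNReal.rpow_mul, one_div, inv_mul_cancel₀ (by positivity), ENNReal.rpow_one,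
        ENNReal.rpow_natCast] at this
    exact_mod_cast h2
  have hsum : Summable fun t : ℕ => ‖Mc ^ t‖ := by
    refine Summable.of_norm_bounded_eventually_nat (summable_geometric_of_lt_one ρ.2 hρ) ?_
    filter_upwards [hev] with t ht
    simpa using ht
  refine Summable.of_nonneg_of_le (fun t => norm_nonneg _) (fun t => ?_) (hsum.mul_left ‖f‖)
  rw [← hf]
  exact f.le_opNorm _

theorem one_le_stabilityConst [Nonempty n] {M : Matrix n n ℝ} (hM : IsSchurStable M) :
    1 ≤ stabilityConst M := by
  have h := hM.summable_norm_pow.le_tsum 0 fun _ _ => norm_nonneg _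
  simpa [stabilityConst] using h

/-- The solution of a Lyapunov equation with stable dynamics and positive definite forcing is the sum
of a series of positive semidefinite matrices whose first term is positive definite. -/
theorem posDef_of_lyapunov {M S Q : Matrix n n ℝ} (hM : IsSchurStable M) (hQ : Q.PosDef)
    (h : S = M * S * Mᵀ + Q) : S.PosDef := by
  have hiter : ∀ t : ℕ, S - M ^ t * S * (M ^ t)ᵀ
      = ∑ j ∈ Finset.range t, M ^ j * Q * (M ^ j)ᵀ := by
    intro t
    induction t with
    | zero => simp
    | succ t ih =>
      rw [Finset.sum_range_succ, ← ih]
      have e : M ^ t * S * (M ^ t)ᵀ = M ^ (t + 1) * S * (M ^ (t + 1))ᵀ + M ^ t * Q * (M ^ t)ᵀ := by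
        nth_rewrite 1 [h]
        rw [pow_succ, Matrix.transpose_mul]
        noncomm_ring
      rw [e]
      abel
  have h0 : Filter.Tendsto (fun t : ℕ => M ^ t) Filter.atTop (nhds 0) :=
    tendsto_zero_iff_norm_tendsto_zero.2 hM.summable_norm_pow.tendsto_atTop_zero
  have hlim : Filter.Tendsto (fun t : ℕ => ∑ j ∈ Finset.range t, M ^ j * Q * (M ^ j)ᵀ)
      Filter.atTop (nhds S) := by
    simp_rw [← hiter]
    have hT : Filter.Tendsto (fun t : ℕ => (M ^ t)ᵀ) Filter.atTop (nhds 0) := by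
      have := ((continuous_id (X := Matrix n n ℝ)).matrix_transpose.tendsto 0).comp h0
      simpa [Function.comp_def] using this
    have := (tendsto_const_nhds (x := S)).sub ((h0.mul_const S).mul hT)
    simpa using this
  have hQt := (posDef_iff_quad.1 hQ).1
  refine posDef_iff_quad.2 ⟨?_, fun v hv => ?_⟩
  · have h1 := ((continuous_id (X := Matrix n n ℝ)).matrix_transpose.tendsto S).comp hlim
    refine tendsto_nhds_unique (h1.congr fun t => ?_) hlim
    simp only [Function.comp, id, Matrix.transpose_sum, Matrix.transpose_mul,
      Matrix.transpose_transpose, hQt, Matrix.mul_assoc]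
  · refine ((posDef_iff_quad.1 hQ).2 v hv).trans_le ?_
    have hc : Continuous fun R : Matrix n n ℝ => quad R v := by
      simp_rw [quad_eq_dotProduct]
      fun_prop
    refine ge_of_tendsto ((hc.tendsto S).comp hlim) ?_
    filter_upwards [Filter.eventually_gt_atTop 0] with t ht
    have hq : quad (∑ j ∈ Finset.range t, M ^ j * Q * (M ^ j)ᵀ) v
        = ∑ j ∈ Finset.range t, quad Q (((M ^ j)ᵀ).toEuclideanLin v) := by
      simp only [quad, map_sum, LinearMap.sum_apply, inner_sum]
      refine Finset.sum_congr rfl fun j _ => ?_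
      rw [inner_toEuclideanLin_left, Matrix.transpose_transpose]
      simp
    simp only [Function.comp]
    rw [hq]
    have := Finset.single_le_sum (f := fun j => quad Q (((M ^ j)ᵀ).toEuclideanLin v))
      (fun j _ => quad_nonneg hQ.posSemidef _) (Finset.mem_range.2 ht)
    simpa using this

end Stable

namespace TaskFamily

variable {nx nu k H : ℕ} (S : TaskFamily nx nu k H)

theorem covX_posDef (h : Fin (H + 1)) : (S.covX h).PosDef := by
  have hQ : (S.sigmaZ ^ 2 • (S.B * S.Bᵀ) + S.covW h).PosDef := by
    have h1 : (S.sigmaZ ^ 2 • (S.B * S.Bᵀ)).PosSemidef := by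
      have := Matrix.posSemidef_self_mul_conjTranspose S.B
      rw [Matrix.conjTranspose_eq_transpose_of_trivial] at this
      exact this.smul (sq_nonneg _)
    exact Matrix.PosDef.posSemidef_add h1 (S.covW_posDef h)
  exact posDef_of_lyapunov (S.stable h) hQ (by rw [← add_assoc]; exact S.lyapunov h)

theorem lyapunov_quad (h : Fin (H + 1)) (p : EuclideanSpace ℝ (Fin nx)) :
    quad (S.covX h) p = quad (S.covX h) ((S.Acl h)ᵀ.toEuclideanLin p)
      + S.sigmaZ ^ 2 * ‖(S.Bᵀ).toEuclideanLin p‖ ^ 2 + quad (S.covW h) p := by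
  nth_rewrite 1 [S.lyapunov h]
  change quad (S.Acl h * S.covX h * (S.Acl h)ᵀ + _ + _) p = _
  have e1 : quad (S.Acl h * S.covX h * (S.Acl h)ᵀ + S.sigmaZ ^ 2 • (S.B * S.Bᵀ) + S.covW h) p
      = quad (S.Acl h * S.covX h * (S.Acl h)ᵀ) p + S.sigmaZ ^ 2 * quad (S.B * S.Bᵀ) p
        + quad (S.covW h) p := by
    simp only [quad, map_add, map_smul, LinearMap.add_apply, LinearMap.smul_apply, inner_add_right,
      real_inner_smul_right]
  have e2 : quad (S.B * S.Bᵀ) p = ‖(S.Bᵀ).toEuclideanLin p‖ ^ 2 := by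
    rw [← real_inner_self_eq_norm_sq, inner_toEuclideanLin_left, Matrix.transpose_transpose, quad]
    simp
  have e3 : quad (S.Acl h * S.covX h * (S.Acl h)ᵀ) p
      = quad (S.covX h) ((S.Acl h)ᵀ.toEuclideanLin p) := by
    rw [quad, quad, inner_toEuclideanLin_left, Matrix.transpose_transpose]
    simp
  rw [e1, e2, e3]

end TaskFamily

/-! ### Centered multivariate Gaussians -/

section Multivariate

variable {n : Type*} [Fintype n] [DecidableEq n]

theorem integral_inner_multivariateGaussian (S : Matrix n n ℝ) (p : EuclideanSpace ℝ n) :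
    ∫ y, inner ℝ p y ∂multivariateGaussian 0 S = 0 := by
  have := (innerSL ℝ p).integral_comp_comm
    (IsGaussian.integrable_id (μ := multivariateGaussian (0 : EuclideanSpace ℝ n) S))
  simp only [id, integral_id_multivariateGaussian, map_zero] at this
  exact this

theorem variance_inner_multivariateGaussian {S : Matrix n n ℝ} (hS : S.PosSemidef)
    (p : EuclideanSpace ℝ n) : Var[fun y => inner ℝ p y; multivariateGaussian 0 S] = quad S p := by
  rw [quad_eq_dotProduct, ← covarianceBilin_multivariateGaussian (μ := 0) hS,
    covarianceBilin_apply_eq_cov IsGaussian.memLp_two_id, covariance_self (by fun_prop)]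

theorem memLp_inner_gaussian {E : Type*} [NormedAddCommGroup E] [InnerProductSpace ℝ E]
    [FiniteDimensional ℝ E] [MeasurableSpace E] [BorelSpace E] (μ : Measure E) [IsGaussian μ] (p : E) :
    MemLp (fun y => inner ℝ p y) 2 μ :=
  have : CompleteSpace E := FiniteDimensional.complete ℝ E
  (IsGaussian.memLp_two_id (μ := μ)).const_inner p

theorem posSemidef_smul_one {ι : Type*} [DecidableEq ι] (c : ℝ) :
    (c ^ 2 • (1 : Matrix ι ι ℝ)).PosSemidef :=
  Matrix.PosSemidef.one.smul (sq_nonneg c)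

theorem quad_smul_one (c : ℝ) (p : EuclideanSpace ℝ n) :
    quad (c • (1 : Matrix n n ℝ)) p = c * ‖p‖ ^ 2 := by
  simp [quad, real_inner_smul_right]

theorem integral_norm_sq_gaussian_smul_one (c : ℝ) :
    ∫ y : EuclideanSpace ℝ n, ‖y‖ ^ 2 ∂multivariateGaussian 0 (c ^ 2 • (1 : Matrix n n ℝ))
      = c ^ 2 * Fintype.card n := by
  set μ := multivariateGaussian (0 : EuclideanSpace ℝ n) (c ^ 2 • (1 : Matrix n n ℝ)) with hμ
  let b := EuclideanSpace.basisFun n ℝ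
  have h1 : ∀ i, ∫ y, inner ℝ (b i) y ^ 2 ∂μ = c ^ 2 := by
    intro i
    rw [← variance_of_integral_eq_zero (by fun_prop) (integral_inner_multivariateGaussian _ _),
      variance_inner_multivariateGaussian (posSemidef_smul_one c), quad_smul_one, b.norm_eq_one]
    simp
  simp_rw [← b.sum_sq_inner_right]
  rw [integral_finsetSum _ fun i _ => (memLp_inner_gaussian μ (b i)).integrable_sq]
  simp [h1, mul_comm]

end Multivariate

theorem lintegral_pi_prod {ι : Type*} [Fintype ι] {X : ι → Type*} [∀ i, MeasurableSpace (X i)]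
    (μ : ∀ i, Measure (X i)) [∀ i, IsProbabilityMeasure (μ i)] {f : ∀ i, X i → ENNReal}
    (hf : ∀ i, Measurable (f i)) :
    ∫⁻ x, ∏ i, f i (x i) ∂(Measure.pi μ) = ∏ i, ∫⁻ y, f i y ∂μ i := by
  have hind : iIndepFun (fun i (x : ∀ i, X i) => f i (x i)) (Measure.pi μ) :=
    iIndepFun_pi fun i => (hf i).aemeasurable
  rw [lintegral_prod_eq_prod_lintegral_of_indepFun Finset.univ _ hind
    fun i => (hf i).comp (measurable_pi_apply i)]
  refine Finset.prod_congr rfl fun i _ => ?_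
  exact (measurePreserving_eval μ i).lintegral_comp (hf i)

instance isGaussian_pi_gaussian {ι E : Type*} [Fintype ι] [NormedAddCommGroup E] [NormedSpace ℝ E]
    [CompleteSpace E] [MeasurableSpace E] [BorelSpace E] [SecondCountableTopology E] (μ : Measure E)
    [IsGaussian μ] :
    IsGaussian (Measure.pi fun _ : ι => μ) := by
  have hind : iIndepFun (fun i (x : ι → E) => x i) (Measure.pi fun _ : ι => μ) :=
    iIndepFun_pi (X := fun _ => id) fun i => by fun_prop
  have hlaw : ∀ i, HasGaussianLaw (fun x : ι → E => x i) (Measure.pi fun _ : ι => μ) := fun i => by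
    constructor
    rw [(measurePreserving_eval (fun _ : ι => μ) i).map_eq]
    infer_instance
  have := (hind.hasGaussianLaw hlaw).isGaussian_map
  simpa using this

namespace TaskFamily

variable {nx nu k H : ℕ} (S : TaskFamily nx nu k H) (h : Fin (H + 1))

instance isGaussian_noiseLaw (T : ℕ) : IsGaussian (S.noiseLaw h T) := by
  unfold noiseLaw
  infer_instance

/-! ### States as linear functions of the noise -/

theorem state_succ {T t : ℕ} (ht : t < T) (ξ : TrajNoise nx nu T) :
    S.state h ξ (t + 1) = (S.Acl h).toEuclideanLin (S.state h ξ t)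
      + (S.B.toEuclideanLin (ξ.2.1 ⟨t, ht⟩) + ξ.2.2 ⟨t, ht⟩) := by
  simp only [state, ht, dite_true, Acl, map_add, LinearMap.add_apply]
  simp only [Matrix.toLpLin_mul_same, LinearMap.comp_apply]
  abel

theorem state_congr {T : ℕ} {ξ ξ' : TrajNoise nx nu T} (h0 : ξ.1 = ξ'.1) (hw : ξ.2.2 = ξ'.2.2) (t : ℕ)
    (hz : ∀ s : Fin T, s < t → ξ.2.1 s = ξ'.2.1 s) : S.state h ξ t = S.state h ξ' t := by
  induction t with
  | zero => exact h0
  | succ t ih =>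
    by_cases ht : t < T
    · rw [state_succ _ _ ht, state_succ _ _ ht, ih fun s hs => hz s (by omega), hw,
        hz ⟨t, ht⟩ (by simp)]
    · simp [state, ht]

theorem state_add {T : ℕ} (ξ ξ' : TrajNoise nx nu T) (t : ℕ) :
    S.state h (ξ + ξ') t = S.state h ξ t + S.state h ξ' t := by
  induction t with
  | zero => rfl
  | succ t ih =>
    by_cases ht : t < T
    · simp only [state_succ _ _ ht, ih, Prod.snd_add, Prod.fst_add, Pi.add_apply, map_add]
      abel
    · simp [state, ht]

theorem state_smul {T : ℕ} (c : ℝ) (ξ : TrajNoise nx nu T) (t : ℕ) :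
    S.state h (c • ξ) t = c • S.state h ξ t := by
  induction t with
  | zero => rfl
  | succ t ih =>
    by_cases ht : t < T
    · simp only [state_succ _ _ ht, ih, Prod.smul_snd, Prod.smul_fst, Pi.smul_apply, map_smul, smul_add]
    · simp [state, ht]

theorem continuous_state {T : ℕ} (t : ℕ) : Continuous fun ξ : TrajNoise nx nu T => S.state h ξ t := by
  induction t with
  | zero => exact continuous_fst
  | succ t ih =>
    by_cases ht : t < T
    · simp only [state_succ _ _ ht]
      have hc : ∀ {p q : ℕ} (M : Matrix (Fin p) (Fin q) ℝ), Continuous M.toEuclideanLin :=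
        fun M => LinearMap.continuous_of_finiteDimensional _
      exact ((hc _).comp ih).add (((hc _).comp (by fun_prop)).add (by fun_prop))
    · simpa [state, ht] using continuous_const

/-- The outputs `D x[t]`, `t < T`, stacked into one vector, as a linear function of the noise. -/
noncomputable def stackedOutput {p T : ℕ} (D : Matrix (Fin p) (Fin nx) ℝ) :
    TrajNoise nx nu T →L[ℝ] PiLp 2 (fun _ : Fin T => EuclideanSpace ℝ (Fin p)) where
  toFun ξ := WithLp.toLp 2 fun t : Fin T => D.toEuclideanLin (S.state h ξ t)
  map_add' ξ ξ' := by
    rw [← WithLp.toLp_add]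
    congr 1
    funext t
    rw [Pi.add_apply, state_add, map_add]
  map_smul' c ξ := by
    rw [RingHom.id_apply, ← WithLp.toLp_smul]
    congr 1
    funext t
    rw [Pi.smul_apply, state_smul, map_smul]
  cont := by
    have hc : Continuous D.toEuclideanLin := LinearMap.continuous_of_finiteDimensional _
    exact (PiLp.continuous_toLp 2 _).comp
      (continuous_pi fun t => hc.comp (S.continuous_state h t))

theorem norm_sq_stackedOutput {p T : ℕ} (D : Matrix (Fin p) (Fin nx) ℝ) (ξ : TrajNoise nx nu T) :
    ‖S.stackedOutput h D ξ‖ ^ 2 = ∑ t : Fin T, ‖D.toEuclideanLin (S.state h ξ t)‖ ^ 2 := by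
  rw [PiLp.norm_sq_eq_of_L2]
  rfl

/-! ### Second moments of the states -/

theorem measurePreserving_fst_noise (T : ℕ) :
    MeasurePreserving (fun ξ : TrajNoise nx nu T => ξ.1) (S.noiseLaw h T)
      (multivariateGaussian 0 (S.covX h)) :=
  measurePreserving_fst

theorem measurePreserving_actuator (T : ℕ) (t : Fin T) :
    MeasurePreserving (fun ξ : TrajNoise nx nu T => ξ.2.1 t) (S.noiseLaw h T)
      (multivariateGaussian 0 (S.sigmaZ ^ 2 • (1 : Matrix _ _ ℝ))) :=
  (measurePreserving_eval _ t).comp (measurePreserving_fst.comp measurePreserving_snd)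

theorem measurePreserving_process (T : ℕ) (t : Fin T) :
    MeasurePreserving (fun ξ : TrajNoise nx nu T => ξ.2.2 t) (S.noiseLaw h T)
      (multivariateGaussian 0 (S.covW h)) :=
  (measurePreserving_eval _ t).comp (measurePreserving_snd.comp measurePreserving_snd)

variable {S h} in
theorem integral_inner_comp_eq_zero {n T : ℕ} {Q : Matrix (Fin n) (Fin n) ℝ}
    {f : TrajNoise nx nu T → EuclideanSpace ℝ (Fin n)}
    (hf : MeasurePreserving f (S.noiseLaw h T) (multivariateGaussian 0 Q))
    (p : EuclideanSpace ℝ (Fin n)) : ∫ ξ, inner ℝ p (f ξ) ∂S.noiseLaw h T = 0 := by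
  rw [← integral_inner_multivariateGaussian Q p, ← hf.map_eq,
    integral_map hf.measurable.aemeasurable (by fun_prop)]

/-- A linear functional of the noise of one trajectory. -/
noncomputable def noiseFunctional {T : ℕ} (p : EuclideanSpace ℝ (Fin nx))
    (r : Fin T → EuclideanSpace ℝ (Fin nu)) (s : Fin T → EuclideanSpace ℝ (Fin nx))
    (ξ : TrajNoise nx nu T) : ℝ :=
  inner ℝ p ξ.1 + (∑ t, inner ℝ (r t) (ξ.2.1 t) + ∑ t, inner ℝ (s t) (ξ.2.2 t))

theorem integral_noiseFunctional {T : ℕ} (p : EuclideanSpace ℝ (Fin nx))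
    (r : Fin T → EuclideanSpace ℝ (Fin nu)) (s : Fin T → EuclideanSpace ℝ (Fin nx)) :
    ∫ ξ, noiseFunctional p r s ξ ∂S.noiseLaw h T = 0 := by
  have hi : ∀ {n : ℕ} {Q : Matrix (Fin n) (Fin n) ℝ} {f : TrajNoise nx nu T → EuclideanSpace ℝ (Fin n)}
      (hf : MeasurePreserving f (S.noiseLaw h T) (multivariateGaussian 0 Q))
      (p : EuclideanSpace ℝ (Fin n)), Integrable (fun ξ => inner ℝ p (f ξ)) (S.noiseLaw h T) := by
    intro n Q f hf p
    exact hf.integrable_comp_of_integrable ((memLp_inner_gaussian _ p).integrable (by norm_num))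
  unfold noiseFunctional
  rw [integral_add (hi (S.measurePreserving_fst_noise h T) p), integral_add, integral_finsetSum,
    integral_finsetSum, integral_inner_comp_eq_zero (S.measurePreserving_fst_noise h T),
    Finset.sum_eq_zero fun t _ => integral_inner_comp_eq_zero (S.measurePreserving_actuator h T t) _,
    Finset.sum_eq_zero fun t _ => integral_inner_comp_eq_zero (S.measurePreserving_process h T t) _]
  · simp
  · exact fun t _ => hi (S.measurePreserving_process h T t) _
  · exact fun t _ => hi (S.measurePreserving_actuator h T t) _
  · exact integrable_finsetSum _ fun t _ => hi (S.measurePreserving_actuator h T t) _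
  · exact integrable_finsetSum _ fun t _ => hi (S.measurePreserving_process h T t) _
  · exact (integrable_finsetSum _ fun t _ => hi (S.measurePreserving_actuator h T t) _).add
      (integrable_finsetSum _ fun t _ => hi (S.measurePreserving_process h T t) _)

theorem variance_noiseFunctional {T : ℕ} (p : EuclideanSpace ℝ (Fin nx))
    (r : Fin T → EuclideanSpace ℝ (Fin nu)) (s : Fin T → EuclideanSpace ℝ (Fin nx)) :
    Var[noiseFunctional p r s; S.noiseLaw h T]
      = quad (S.covX h) p + (∑ t, S.sigmaZ ^ 2 * ‖r t‖ ^ 2 + ∑ t, quad (S.covW h) (s t)) := by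
  have hpi : ∀ {n : ℕ} (Q : Matrix (Fin n) (Fin n) ℝ) (hQ : Q.PosSemidef)
      (r : Fin T → EuclideanSpace ℝ (Fin n)),
      MemLp (fun z : Fin T → EuclideanSpace ℝ (Fin n) => ∑ t, inner ℝ (r t) (z t)) 2
        (Measure.pi fun _ => multivariateGaussian 0 Q) ∧
      Var[fun z : Fin T → EuclideanSpace ℝ (Fin n) => ∑ t, inner ℝ (r t) (z t);
        Measure.pi fun _ => multivariateGaussian 0 Q] = ∑ t, quad Q (r t) := by
    intro n Q hQ r
    constructor
    · exact memLp_finsetSum _ fun t _ =>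
        (memLp_inner_gaussian _ (r t)).comp_measurePreserving (measurePreserving_eval _ t)
    · have := variance_sum_pi (μ := fun _ : Fin T => multivariateGaussian (0 : EuclideanSpace ℝ (Fin n)) Q)
        (X := fun t y => inner ℝ (r t) y) fun t => memLp_inner_gaussian _ _
      simp_rw [variance_inner_multivariateGaussian hQ] at this
      rw [← this]
      congr 1
      ext z
      simp
  have hz := hpi _ (posSemidef_smul_one (ι := Fin nu) S.sigmaZ) r
  have hw := hpi _ (S.covW_posDef h).posSemidef s
  have h2 := variance_add_prod hz.1 hw.1
  have h2m : MemLp (fun q : (Fin T → EuclideanSpace ℝ (Fin nu)) × (Fin T → EuclideanSpace ℝ (Fin nx)) =>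
      ∑ t, inner ℝ (r t) (q.1 t) + ∑ t, inner ℝ (s t) (q.2 t)) 2
      ((Measure.pi fun _ : Fin T => multivariateGaussian 0 (S.sigmaZ ^ 2 • (1 : Matrix _ _ ℝ))).prod
      (Measure.pi fun _ : Fin T => multivariateGaussian 0 (S.covW h))) :=
    (hz.1.comp_measurePreserving measurePreserving_fst).add
      (hw.1.comp_measurePreserving measurePreserving_snd)
  have h1 := variance_add_prod (memLp_inner_gaussian (multivariateGaussian 0 (S.covX h)) p) h2m
  rw [h2, hz.2, hw.2, variance_inner_multivariateGaussian (S.covX_posDef h).posSemidef] at h1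
  simp_rw [quad_smul_one] at h1
  exact h1

/-- The adjoint state `p[t] = ∑_{t ≤ j < T} (Mᵀ)^{j - t} v[j]`, which satisfies
`p[t] = v[t] + Mᵀ p[t + 1]`. -/
noncomputable def adjointState {n : ℕ} (M : Matrix (Fin n) (Fin n) ℝ)
    (v : ℕ → EuclideanSpace ℝ (Fin n)) (T t : ℕ) : EuclideanSpace ℝ (Fin n) :=
  ∑ j ∈ Finset.Ico t T, ((M ^ (j - t))ᵀ).toEuclideanLin (v j)

theorem adjointState_self {n : ℕ} (M : Matrix (Fin n) (Fin n) ℝ)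
    (v : ℕ → EuclideanSpace ℝ (Fin n)) (T : ℕ) : adjointState M v T T = 0 := by
  simp [adjointState]

theorem transpose_adjointState_succ {n : ℕ} (M : Matrix (Fin n) (Fin n) ℝ)
    (v : ℕ → EuclideanSpace ℝ (Fin n)) {T t : ℕ} :
    Mᵀ.toEuclideanLin (adjointState M v T (t + 1))
      = ∑ j ∈ Finset.Ico (t + 1) T, ((M ^ (j - t))ᵀ).toEuclideanLin (v j) := by
  rw [adjointState, map_sum]
  refine Finset.sum_congr rfl fun j hj => ?_
  have : j - t = (j - (t + 1)) + 1 := by have := (Finset.mem_Ico.1 hj).1; omega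
  rw [this, pow_succ, Matrix.transpose_mul, Matrix.toLpLin_mul_same, LinearMap.comp_apply]

theorem adjointState_eq {n : ℕ} (M : Matrix (Fin n) (Fin n) ℝ)
    (v : ℕ → EuclideanSpace ℝ (Fin n)) {T t : ℕ} (ht : t < T) :
    adjointState M v T t = v t + Mᵀ.toEuclideanLin (adjointState M v T (t + 1)) := by
  rw [transpose_adjointState_succ, adjointState, Finset.sum_eq_sum_Ico_succ_bot ht]
  simp

theorem sum_inner_state_eq {T : ℕ} (v : ℕ → EuclideanSpace ℝ (Fin nx)) (ξ : TrajNoise nx nu T) :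
    ∑ t : Fin T, inner ℝ (v t) (S.state h ξ t)
      = noiseFunctional (adjointState (S.Acl h) v T 0)
          (fun t => S.Bᵀ.toEuclideanLin (adjointState (S.Acl h) v T (t + 1)))
          (fun t => adjointState (S.Acl h) v T (t + 1)) ξ := by
  set p := adjointState (S.Acl h) v T with hp
  let ε : ℕ → EuclideanSpace ℝ (Fin nx) := fun t =>
    if ht : t < T then S.B.toEuclideanLin (ξ.2.1 ⟨t, ht⟩) + ξ.2.2 ⟨t, ht⟩ else 0
  have key : ∀ m ≤ T, ∑ t ∈ Finset.range m, inner ℝ (v t) (S.state h ξ t)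
      + inner ℝ (p m) (S.state h ξ m)
      = inner ℝ (p 0) ξ.1 + ∑ t ∈ Finset.range m, inner ℝ (p (t + 1)) (ε t) := by
    intro m
    induction m with
    | zero => intro _; simp [state]
    | succ m ih =>
      intro hm
      have hm' : m < T := hm
      rw [Finset.sum_range_succ, Finset.sum_range_succ, ← add_assoc, ← ih hm'.le,
        state_succ _ _ hm']
      have e1 : ε m = S.B.toEuclideanLin (ξ.2.1 ⟨m, hm'⟩) + ξ.2.2 ⟨m, hm'⟩ := by simp [ε, hm']
      rw [← e1, inner_add_right, inner_toEuclideanLin_right, hp, adjointState_eq _ _ hm',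
        inner_add_left]
      ring
  have hT := key T le_rfl
  rw [hp, adjointState_self, inner_zero_left, add_zero, ← hp] at hT
  rw [← Finset.sum_range (fun t => inner ℝ (v t) (S.state h ξ t)), hT, noiseFunctional,
    Finset.sum_range, ← Finset.sum_add_distrib]
  congr 1
  refine Finset.sum_congr rfl fun t _ => ?_
  simp only [ε, t.2, dite_true, Fin.eta, inner_add_right]
  rw [inner_toEuclideanLin_right]

theorem integral_sum_inner_state {T : ℕ} (v : ℕ → EuclideanSpace ℝ (Fin nx)) :
    ∫ ξ, ∑ t : Fin T, inner ℝ (v t) (S.state h ξ t) ∂S.noiseLaw h T = 0 := by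
  simp_rw [sum_inner_state_eq]
  exact S.integral_noiseFunctional h _ _ _

/-- By the Lyapunov equation the contributions of the noise to the variance telescope. -/
theorem variance_sum_inner_state {T : ℕ} (v : ℕ → EuclideanSpace ℝ (Fin nx)) :
    Var[fun ξ => ∑ t : Fin T, inner ℝ (v t) (S.state h ξ t); S.noiseLaw h T]
      = ∑ t ∈ Finset.range T, (quad (S.covX h) (v t) + 2 * inner ℝ (v t) ((S.covX h).toEuclideanLin
          ((S.Acl h)ᵀ.toEuclideanLin (adjointState (S.Acl h) v T (t + 1))))) := by
  set p := adjointState (S.Acl h) v T with hp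
  have e1 : (fun ξ : TrajNoise nx nu T => ∑ t : Fin T, inner ℝ (v t) (S.state h ξ t))
      = noiseFunctional (p 0) (fun t => S.Bᵀ.toEuclideanLin (p (t + 1))) (fun t => p (t + 1)) := by
    ext ξ; exact S.sum_inner_state_eq h v ξ
  rw [e1, variance_noiseFunctional, ← Finset.sum_add_distrib]
  have e2 : ∀ t : Fin T, S.sigmaZ ^ 2 * ‖S.Bᵀ.toEuclideanLin (p (t + 1))‖ ^ 2
      + quad (S.covW h) (p (t + 1))
      = quad (S.covX h) (p (t + 1)) - quad (S.covX h) ((S.Acl h)ᵀ.toEuclideanLin (p (t + 1))) := by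
    intro t
    have := S.lyapunov_quad h (p (t + 1))
    linarith
  rw [Finset.sum_congr rfl fun t _ => e2 t, ← Finset.sum_range (fun t => quad (S.covX h) (p (t + 1))
    - quad (S.covX h) ((S.Acl h)ᵀ.toEuclideanLin (p (t + 1))))]
  have e3 : ∀ t ∈ Finset.range T, quad (S.covX h) (v t) + 2 * inner ℝ (v t) ((S.covX h).toEuclideanLin
      ((S.Acl h)ᵀ.toEuclideanLin (p (t + 1))))
      = quad (S.covX h) (p t) - quad (S.covX h) ((S.Acl h)ᵀ.toEuclideanLin (p (t + 1))) := by
    intro t ht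
    have : p t = v t + (S.Acl h)ᵀ.toEuclideanLin (p (t + 1)) :=
      adjointState_eq _ _ (Finset.mem_range.1 ht)
    rw [this, quad_add (posDef_iff_quad.1 (S.covX_posDef h)).1]
    ring
  rw [Finset.sum_congr rfl e3, Finset.sum_sub_distrib, Finset.sum_sub_distrib]
  have e4 := Finset.sum_range_succ (fun t => quad (S.covX h) (p t)) T
  rw [Finset.sum_range_succ'] at e4
  have e5 : quad (S.covX h) (p T) = 0 := by rw [hp, adjointState_self]; simp [quad]
  linarith

end TaskFamily

/-! ### Energies of outputs and the excess risk -/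

section Energy

variable {m n : Type*} [Fintype m] [Fintype n] [DecidableEq n]

/-- `tr (D Q Dᵀ)`, written as the sum over the rows `d` of `D` of `dᵀ Q d`. -/
noncomputable def energy (Q : Matrix n n ℝ) (D : Matrix m n ℝ) : ℝ :=
  ∑ a, quad Q (WithLp.toLp 2 (D a))

theorem energy_nonneg {Q : Matrix n n ℝ} (hQ : Q.PosSemidef) (D : Matrix m n ℝ) : 0 ≤ energy Q D :=
  Finset.sum_nonneg fun _ _ => quad_nonneg hQ _

theorem norm_sq_toEuclideanLin (D : Matrix m n ℝ) (x : EuclideanSpace ℝ n) :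
    ‖D.toEuclideanLin x‖ ^ 2 = ∑ a, inner ℝ (WithLp.toLp 2 (D a)) x ^ 2 := by
  rw [EuclideanSpace.real_norm_sq_eq]
  refine Finset.sum_congr rfl fun a _ => ?_
  congr 1
  rw [EuclideanSpace.inner_eq_star_dotProduct, dotProduct_comm]
  simp [Matrix.mulVec]

theorem toEuclideanLin_transpose_eq_sum {ι : Type*} [DecidableEq m] (D : Matrix m ι ℝ)
    (u : EuclideanSpace ℝ m) :
    Dᵀ.toEuclideanLin u = ∑ a, u a • (WithLp.toLp 2 (D a) : EuclideanSpace ℝ ι) := by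
  ext j
  simp [Matrix.mulVec, dotProduct, mul_comm]

theorem quad_transpose_le [DecidableEq m] {Q : Matrix n n ℝ} (hQ : Q.PosSemidef) (D : Matrix m n ℝ)
    (u : EuclideanSpace ℝ m) : quad Q (Dᵀ.toEuclideanLin u) ≤ energy Q D * ‖u‖ ^ 2 := by
  rw [← norm_sqrt_sq hQ, toEuclideanLin_transpose_eq_sum, map_sum]
  have h1 : ‖∑ a, (CFC.sqrt Q).toEuclideanLin (u a • (WithLp.toLp 2 (D a) : EuclideanSpace ℝ n))‖
      ≤ ∑ a, |u a| * ‖(CFC.sqrt Q).toEuclideanLin (WithLp.toLp 2 (D a))‖ := by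
    refine (norm_sum_le _ _).trans (Finset.sum_le_sum fun a _ => ?_)
    rw [map_smul, norm_smul, Real.norm_eq_abs]
  calc _ ≤ (∑ a, |u a| * ‖(CFC.sqrt Q).toEuclideanLin (WithLp.toLp 2 (D a))‖) ^ 2 := by gcongr
    _ ≤ (∑ a, |u a| ^ 2) * ∑ a, ‖(CFC.sqrt Q).toEuclideanLin (WithLp.toLp 2 (D a))‖ ^ 2 :=
        Finset.sum_mul_sq_le_sq_mul_sq _ _ _
    _ = _ := by
        simp_rw [norm_sqrt_sq hQ, sq_abs]
        rw [← EuclideanSpace.real_norm_sq_eq, mul_comm]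
        rfl

end Energy

namespace TaskFamily

variable {nx nu k H : ℕ} (S : TaskFamily nx nu k H) (h : Fin (H + 1))

/-- A bound for the covariance operator of the whitened state trajectories, uniform in their
length. -/
noncomputable def corr : ℝ :=
  3 * (stabilityConst (S.Acl h) * √(condNumber (S.covX h)))

theorem sum_norm_pow_le (s : Finset ℕ) (f : ℕ → ℕ) (hf : Set.InjOn f s) :
    ∑ j ∈ s, ‖S.Acl h ^ f j‖ ≤ stabilityConst (S.Acl h) := by
  rw [← Finset.sum_image (g := f) (f := fun t => ‖S.Acl h ^ t‖) hf]
  exact (S.stable h).summable_norm_pow.sum_le_tsum _ fun _ _ => norm_nonneg _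

/-- The autocovariances `M^s covX` of the states decay like `‖M^s‖`, so the covariance of a whole
trajectory is bounded through their sum. -/
theorem variance_sum_inner_state_le [Nonempty (Fin nx)] {T : ℕ} (v : ℕ → EuclideanSpace ℝ (Fin nx)) :
    Var[fun ξ => ∑ t : Fin T, inner ℝ (v t) (S.state h ξ t); S.noiseLaw h T]
      ≤ S.corr h * ∑ t ∈ Finset.range T, quad (S.covX h) (v t) := by
  set q : ℕ → ℝ := fun t => quad (S.covX h) (v t) with hq
  have hq0 : ∀ t, 0 ≤ q t := fun t => quad_nonneg (S.covX_posDef h).posSemidef _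
  set κ := √(condNumber (S.covX h)) with hκ
  have hκ1 : 1 ≤ κ := Real.one_le_sqrt.2 (one_le_condNumber (S.covX_posDef h))
  have hJ1 : 1 ≤ stabilityConst (S.Acl h) := one_le_stabilityConst (S.stable h)
  set J := stabilityConst (S.Acl h) with hJ
  rw [variance_sum_inner_state]
  have h1 : ∀ t ∈ Finset.range T, q t + 2 * inner ℝ (v t) ((S.covX h).toEuclideanLin
      ((S.Acl h)ᵀ.toEuclideanLin (adjointState (S.Acl h) v T (t + 1))))
      ≤ q t + ∑ j ∈ Finset.Ico (t + 1) T, (‖S.Acl h ^ (j - t)‖ * κ * q t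
        + ‖S.Acl h ^ (j - t)‖ * κ * q j) := by
    intro t _
    rw [transpose_adjointState_succ, map_sum, inner_sum, Finset.mul_sum]
    gcongr with j hj
    have := inner_mul_le_condNumber (S.covX_posDef h) (S.Acl h ^ (j - t)) (v t) (v j)
    simp only [hq]
    linarith
  refine (Finset.sum_le_sum h1).trans ?_
  simp_rw [Finset.sum_add_distrib]
  have h2 : ∑ t ∈ Finset.range T, ∑ j ∈ Finset.Ico (t + 1) T, ‖S.Acl h ^ (j - t)‖ * κ * q t
      ≤ ∑ t ∈ Finset.range T, J * κ * q t := by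
    refine Finset.sum_le_sum fun t _ => ?_
    rw [← Finset.sum_mul, ← Finset.sum_mul]
    have := S.sum_norm_pow_le h (Finset.Ico (t + 1) T) (fun j => j - t) (by
      intro a ha b hb hab
      simp only [Finset.coe_Ico, Set.mem_Ico] at ha hb hab
      omega)
    have := hq0 t
    gcongr
  have h3 : ∑ t ∈ Finset.range T, ∑ j ∈ Finset.Ico (t + 1) T, ‖S.Acl h ^ (j - t)‖ * κ * q j
      ≤ ∑ j ∈ Finset.range T, J * κ * q j := by
    rw [Finset.sum_comm' (t' := Finset.range T) (s' := fun j => Finset.range j) (by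
      intro t j
      simp only [Finset.mem_range, Finset.mem_Ico]
      omega)]
    refine Finset.sum_le_sum fun j _ => ?_
    rw [← Finset.sum_mul, ← Finset.sum_mul]
    have := S.sum_norm_pow_le h (Finset.range j) (fun t => j - t) (by
      intro a ha b hb hab
      simp only [Finset.coe_range, Set.mem_Iio] at ha hb hab
      omega)
    have := hq0 j
    gcongr
  rw [← Finset.mul_sum] at h2 h3
  have h4 : ∑ t ∈ Finset.range T, q t ≤ J * κ * ∑ t ∈ Finset.range T, q t :=
    le_mul_of_one_le_left (Finset.sum_nonneg fun t _ => hq0 t) (by nlinarith)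
  have h5 : S.corr h = 3 * (J * κ) := rfl
  rw [h5]
  linarith

theorem integral_inner_state_sq {T : ℕ} (t : Fin T) (a : EuclideanSpace ℝ (Fin nx)) :
    ∫ ξ, inner ℝ a (S.state h ξ t) ^ 2 ∂S.noiseLaw h T = quad (S.covX h) a := by
  let v : ℕ → EuclideanSpace ℝ (Fin nx) := fun s => if s = t then a else 0
  have h1 : ∀ ξ : TrajNoise nx nu T,
      ∑ s : Fin T, inner ℝ (v s) (S.state h ξ s) = inner ℝ a (S.state h ξ t) := by
    intro ξ
    rw [Finset.sum_eq_single t]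
    · simp [v]
    · intro s _ hs
      have : (s : ℕ) ≠ t := fun e => hs (Fin.ext e)
      simp [v, this]
    · simp
  have h2 := S.integral_sum_inner_state h (T := T) v
  have h3 := S.variance_sum_inner_state h (T := T) v
  simp_rw [h1] at h2 h3
  have hm : Measurable fun ξ : TrajNoise nx nu T => inner ℝ a (S.state h ξ t) :=
    (continuous_const.inner (S.continuous_state h t)).measurable
  rw [variance_of_integral_eq_zero hm.aemeasurable h2] at h3
  rw [h3, Finset.sum_eq_single (t : ℕ)]
  · have : adjointState (S.Acl h) v T (t + 1) = 0 := by
      refine Finset.sum_eq_zero fun j hj => ?_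
      have : j ≠ t := by have := (Finset.mem_Ico.1 hj).1; omega
      simp [v, this]
    rw [this]
    simp [v]
  · intro s _ hs
    simp [v, hs, quad]
  · intro ht
    exact absurd (Finset.mem_range.2 t.2) ht

theorem memLp_inner_state {T : ℕ} (t : ℕ) (a : EuclideanSpace ℝ (Fin nx)) :
    MemLp (fun ξ : TrajNoise nx nu T => inner ℝ a (S.state h ξ t)) 2 (S.noiseLaw h T) := by
  let L : TrajNoise nx nu T →L[ℝ] ℝ :=
    { toFun := fun ξ => inner ℝ a (S.state h ξ t)
      map_add' := fun ξ ξ' => by rw [state_add, inner_add_right]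
      map_smul' := fun c ξ => by rw [state_smul, real_inner_smul_right]; rfl
      cont := continuous_const.inner (S.continuous_state h t) }
  exact L.comp_memLp' (IsGaussian.memLp_two_id (μ := S.noiseLaw h T))

theorem integral_norm_sq_state {p T : ℕ} (t : Fin T) (D : Matrix (Fin p) (Fin nx) ℝ) :
    ∫ ξ, ‖D.toEuclideanLin (S.state h ξ t)‖ ^ 2 ∂S.noiseLaw h T = energy (S.covX h) D := by
  simp_rw [norm_sq_toEuclideanLin]
  rw [integral_finsetSum _ fun a _ => (S.memLp_inner_state h t _).integrable_sq]
  exact Finset.sum_congr rfl fun a _ => S.integral_inner_state_sq h t _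

theorem integral_sum_norm_sq_state {p T : ℕ} (D : Matrix (Fin p) (Fin nx) ℝ) :
    ∫ ξ, ∑ t : Fin T, ‖D.toEuclideanLin (S.state h ξ t)‖ ^ 2 ∂S.noiseLaw h T
      = T * energy (S.covX h) D := by
  rw [integral_finsetSum]
  · simp_rw [integral_norm_sq_state]
    simp
  · intro t _
    simp_rw [norm_sq_toEuclideanLin]
    exact integrable_finsetSum _ fun a _ => (S.memLp_inner_state h t _).integrable_sq

theorem excessRisk_eq {T : ℕ} (hT : T ≠ 0) (Φ : Matrix (Fin k) (Fin nx) ℝ)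
    (F : Matrix (Fin nu) (Fin k) ℝ) : S.excessRisk T Φ F
      = 1 / 2 * energy (S.covX (Fin.last H)) (S.K (Fin.last H) - F * Φ) := by
  have hT' : (T : ℝ) ≠ 0 := by exact_mod_cast hT
  have hm : Measurable fun (ξ : TrajNoise nx nu T) (t : Fin T) => S.state (Fin.last H) ξ t :=
    measurable_pi_lambda _ fun t => S.measurable_state _ _ _
  have hc : ∀ {p q : ℕ} (M : Matrix (Fin p) (Fin q) ℝ), Continuous M.toEuclideanLin :=
    fun M => LinearMap.continuous_of_finiteDimensional _
  rw [excessRisk, targetStateLaw, integral_map hm.aemeasurable]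
  · rw [S.integral_sum_norm_sq_state (Fin.last H)
      (S.Fstar (Fin.last H) * S.Φstar - F * Φ)]
    rw [K]
    field_simp
  · refine Continuous.aestronglyMeasurable ?_
    exact continuous_finsetSum _ fun t _ => ((hc _).comp (continuous_apply t)).norm.pow 2

/-! ### Exponential moments along one trajectory -/

/-- The exponential moment of the energy `∑_t ‖D x[t]‖²` of an output. -/
theorem lintegral_exp_output_le [Nonempty (Fin nx)] {p T : ℕ} (D : Matrix (Fin p) (Fin nx) ℝ) {s : ℝ}
    (hs : |s| * (S.corr h * energy (S.covX h) D) ≤ 1 / 4) :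
    ∫⁻ ξ, ENNReal.ofReal (Real.exp (s * ∑ t : Fin T, ‖D.toEuclideanLin (S.state h ξ t)‖ ^ 2))
        ∂S.noiseLaw h T
      ≤ ENNReal.ofReal (Real.exp ((s + 2 * s ^ 2 * (S.corr h * energy (S.covX h) D))
          * (T * energy (S.covX h) D))) := by
  let L := S.stackedOutput h (T := T) D
  let μ := (S.noiseLaw h T).map L
  have hLm : Measurable L := L.continuous.measurable
  have hG : IsGaussian μ := isGaussian_map_of_measurable hLm
  have hex : ∀ u : PiLp 2 (fun _ : Fin T => EuclideanSpace ℝ (Fin p)),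
      ∃ v : ℕ → EuclideanSpace ℝ (Fin nx), ∀ t : Fin T, v t = Dᵀ.toEuclideanLin (u t) := fun u =>
    ⟨fun t => if ht : t < T then Dᵀ.toEuclideanLin (u ⟨t, ht⟩) else 0, fun t => by simp⟩
  choose v hv using hex
  have hin : ∀ u, (fun ξ : TrajNoise nx nu T => inner ℝ u (L ξ))
      = fun ξ => ∑ t : Fin T, inner ℝ (v u t) (S.state h ξ t) := by
    intro u
    funext ξ
    rw [PiLp.inner_apply]
    refine Finset.sum_congr rfl fun t _ => ?_
    rw [hv, ← inner_toEuclideanLin_right]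
    rfl
  have hum : ∀ u : PiLp 2 (fun _ : Fin T => EuclideanSpace ℝ (Fin p)),
      Measurable fun y => (inner ℝ u y : ℝ) :=
    fun u => (continuous_const.inner continuous_id).measurable
  have hmean : ∫ y, y ∂μ = 0 := by
    refine ext_inner_left ℝ fun u => ?_
    have h1 := (innerSL ℝ u).integral_comp_comm (IsGaussian.integrable_id (μ := μ))
    simp only [id, innerSL_apply_apply] at h1
    rw [← h1, integral_map hLm.aemeasurable (hum u).aestronglyMeasurable, inner_zero_right, hin u]
    exact S.integral_sum_inner_state h (v u)
  have hc : 0 ≤ S.corr h := by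
    have := zero_le_one.trans (one_le_stabilityConst (S.stable h))
    unfold corr
    exact mul_nonneg (by norm_num) (mul_nonneg this (Real.sqrt_nonneg _))
  have hvar : ∀ u, Var[fun y => inner ℝ u y; μ] ≤ S.corr h * energy (S.covX h) D * ‖u‖ ^ 2 := by
    intro u
    rw [variance_map (hum u).aemeasurable hLm.aemeasurable]
    have e : (fun y => inner ℝ u y) ∘ L
        = fun ξ => ∑ t : Fin T, inner ℝ (v u t) (S.state h ξ t) := hin u
    rw [e]
    refine (S.variance_sum_inner_state_le h (v u)).trans ?_
    rw [mul_assoc]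
    refine mul_le_mul_of_nonneg_left ?_ hc
    rw [PiLp.norm_sq_eq_of_L2, Finset.mul_sum, Finset.sum_range]
    refine Finset.sum_le_sum fun t _ => ?_
    rw [hv]
    exact quad_transpose_le (S.covX_posDef h).posSemidef D (u t)
  have key := lintegral_exp_norm_sq_gaussian_le μ hmean hvar hs
  have e1 : ∫ y, ‖y‖ ^ 2 ∂μ = T * energy (S.covX h) D := by
    rw [integral_map hLm.aemeasurable (by fun_prop)]
    simp_rw [L, norm_sq_stackedOutput]
    exact S.integral_sum_norm_sq_state h D
  rw [e1, lintegral_map (by fun_prop) hLm] at key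
  simp_rw [L, norm_sq_stackedOutput] at key
  exact key

/-- The factor at time `t` sees the actuator noise only through the values before `t`, besides `z[t]`
itself, so it can be integrated out first. -/
theorem lintegral_prod_actuator_le {T : ℕ}
    (g : TrajNoise nx nu T → Fin T → EuclideanSpace ℝ (Fin nu) → ENNReal)
    (hgm : ∀ t, Measurable fun p : TrajNoise nx nu T × EuclideanSpace ℝ (Fin nu) => g p.1 t p.2)
    (hdep : ∀ x0 w t z z' y, (∀ s < t, z s = z' s) → g (x0, z, w) t y = g (x0, z', w) t y)
    (hint : ∀ ξ t, ∫⁻ y, g ξ t y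
      ∂multivariateGaussian 0 (S.sigmaZ ^ 2 • (1 : Matrix (Fin nu) (Fin nu) ℝ)) ≤ 1) :
    ∫⁻ ξ, ∏ t, g ξ t (ξ.2.1 t) ∂S.noiseLaw h T ≤ 1 := by
  have hm : Measurable fun ξ : TrajNoise nx nu T => ∏ t, g ξ t (ξ.2.1 t) :=
    Finset.measurable_prod _ fun t _ => (hgm t).comp
      (measurable_id.prodMk ((measurable_pi_apply t).comp (measurable_fst.comp measurable_snd)))
  rw [noiseLaw, lintegral_prod _ hm.aemeasurable]
  refine (lintegral_mono (g := fun _ => 1) fun x0 => ?_).trans (by simp)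
  have hm2 : Measurable fun q : (Fin T → EuclideanSpace ℝ (Fin nu)) × (Fin T → EuclideanSpace ℝ (Fin nx)) =>
      ∏ t, g (x0, q) t (q.1 t) := hm.comp (measurable_const.prodMk measurable_id)
  rw [lintegral_prod_symm _ hm2.aemeasurable]
  refine (lintegral_mono (g := fun _ => 1) fun w => ?_).trans (by simp)
  refine lintegral_prod_predictable_le _ (fun t z y => g (x0, z, w) t y) (fun t => ?_)
    (fun t z z' y hz => hdep x0 w t z z' y hz) fun t z => hint _ t
  have h1 : Measurable fun p : (Fin T → EuclideanSpace ℝ (Fin nu)) × EuclideanSpace ℝ (Fin nu) =>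
      (((x0, p.1, w) : TrajNoise nx nu T), p.2) :=
    (measurable_const.prodMk (measurable_fst.prodMk measurable_const)).prodMk measurable_snd
  exact (hgm t).comp h1

/-- The actuator noise `z[t]` is independent of the state `x[t]`, so the exponential process of the
martingale `∑_t ⟨z[t], D x[t]⟩` has expectation at most one. -/
theorem lintegral_exp_martingale_le {T : ℕ} (D : Matrix (Fin nu) (Fin nx) ℝ) :
    ∫⁻ ξ, ENNReal.ofReal (Real.exp (∑ t : Fin T, (inner ℝ (ξ.2.1 t) (D.toEuclideanLin (S.state h ξ t))
        - S.sigmaZ ^ 2 / 2 * ‖D.toEuclideanLin (S.state h ξ t)‖ ^ 2))) ∂S.noiseLaw h T ≤ 1 := by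
  have hc : Continuous D.toEuclideanLin := LinearMap.continuous_of_finiteDimensional _
  have hst : ∀ t : ℕ, Continuous fun ξ : TrajNoise nx nu T => D.toEuclideanLin (S.state h ξ t) :=
    fun t => hc.comp (S.continuous_state h t)
  have hvar : ∀ a : EuclideanSpace ℝ (Fin nu), ∫⁻ y, ENNReal.ofReal (Real.exp
      (inner ℝ y a - S.sigmaZ ^ 2 / 2 * ‖a‖ ^ 2))
      ∂multivariateGaussian 0 (S.sigmaZ ^ 2 • (1 : Matrix (Fin nu) (Fin nu) ℝ)) ≤ 1 := by
    intro a
    have h1 := lintegral_exp_dual_gaussian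
      (multivariateGaussian 0 (S.sigmaZ ^ 2 • (1 : Matrix (Fin nu) (Fin nu) ℝ))) (innerSL ℝ a)
      (integral_inner_multivariateGaussian _ a)
    have h2 : Var[innerSL ℝ a; multivariateGaussian 0 (S.sigmaZ ^ 2 • (1 : Matrix (Fin nu) (Fin nu) ℝ))]
        = S.sigmaZ ^ 2 * ‖a‖ ^ 2 := by
      rw [← quad_smul_one, ← variance_inner_multivariateGaussian (posSemidef_smul_one _)]
      rfl
    have h3 : ∀ y, ENNReal.ofReal (Real.exp (inner ℝ y a - S.sigmaZ ^ 2 / 2 * ‖a‖ ^ 2))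
        = ENNReal.ofReal (Real.exp (-(S.sigmaZ ^ 2 / 2 * ‖a‖ ^ 2)))
        * ENNReal.ofReal (Real.exp (innerSL ℝ a y)) := by
      intro y
      rw [← ENNReal.ofReal_mul (Real.exp_pos _).le, ← Real.exp_add, innerSL_apply_apply,
        real_inner_comm]
      congr 2
      ring
    simp_rw [h3]
    rw [lintegral_const_mul _ (by fun_prop), h1, h2, ← ENNReal.ofReal_mul (Real.exp_pos _).le,
      ← Real.exp_add]
    refine le_of_eq ?_
    rw [← ENNReal.ofReal_one]
    congr 1
    rw [Real.exp_eq_one_iff]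
    ring
  simp_rw [Real.exp_sum, ENNReal.ofReal_prod_of_nonneg fun _ _ => (Real.exp_pos _).le]
  refine S.lintegral_prod_actuator_le h (fun ξ t y => ENNReal.ofReal (Real.exp
    (inner ℝ y (D.toEuclideanLin (S.state h ξ t))
      - S.sigmaZ ^ 2 / 2 * ‖D.toEuclideanLin (S.state h ξ t)‖ ^ 2))) (fun t => ?_)
    (fun x0 w t z z' y hz => ?_) fun ξ t => hvar _
  · have h1 : Continuous fun p : TrajNoise nx nu T × EuclideanSpace ℝ (Fin nu) =>
        D.toEuclideanLin (S.state h p.1 t) := (hst t).comp continuous_fst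
    refine Continuous.measurable ?_
    exact ENNReal.continuous_ofReal.comp (Real.continuous_exp.comp
      ((continuous_snd.inner h1).sub (continuous_const.mul (h1.norm.pow 2))))
  · have : S.state h ((x0, z, w) : TrajNoise nx nu T) t = S.state h ((x0, z', w) : TrajNoise nx nu T) t :=
      S.state_congr h (ξ := (x0, z, w)) (ξ' := (x0, z', w)) rfl rfl t fun s hs => hz s hs
    simp only [this]

/-- The exponential moment of the energy of the actuator noise. -/
theorem lintegral_exp_actuator_le (T : ℕ) :
    ∫⁻ ξ, ENNReal.ofReal (Real.exp (∑ t : Fin T, 1 / (4 * S.sigmaZ ^ 2) * ‖ξ.2.1 t‖ ^ 2))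
      ∂S.noiseLaw h T ≤ ENNReal.ofReal (Real.exp (T * nu)) := by
  set μ := multivariateGaussian 0 (S.sigmaZ ^ 2 • (1 : Matrix (Fin nu) (Fin nu) ℝ)) with hμ
  have hσ := S.sigmaZ_pos
  have h1 : ∫⁻ y, ENNReal.ofReal (Real.exp (1 / (4 * S.sigmaZ ^ 2) * ‖y‖ ^ 2)) ∂μ
      ≤ ENNReal.ofReal (Real.exp nu) := by
    have h0 : ∫ y, y ∂μ = 0 := integral_id_multivariateGaussian
    refine (lintegral_exp_norm_sq_gaussian_le μ h0 (Λ := S.sigmaZ ^ 2) (fun u => ?_) ?_).trans ?_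
    · rw [variance_inner_multivariateGaussian (posSemidef_smul_one _), quad_smul_one]
    · rw [abs_of_pos (by positivity)]
      apply le_of_eq
      field_simp
    · apply ENNReal.ofReal_le_ofReal
      apply Real.exp_le_exp.2
      rw [integral_norm_sq_gaussian_smul_one, Fintype.card_fin]
      have : (1 / (4 * S.sigmaZ ^ 2) + 2 * (1 / (4 * S.sigmaZ ^ 2)) ^ 2 * S.sigmaZ ^ 2)
          * (S.sigmaZ ^ 2 * nu) = 3 / 8 * nu := by
        field_simp
        ring
      rw [this]
      have : (0 : ℝ) ≤ nu := Nat.cast_nonneg _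
      linarith
  have h2 : MeasurePreserving (fun ξ : TrajNoise nx nu T => ξ.2.1) (S.noiseLaw h T)
      (Measure.pi fun _ => μ) := measurePreserving_fst.comp measurePreserving_snd
  have hm : Measurable fun z : EuclideanSpace ℝ (Fin nu) =>
      ENNReal.ofReal (Real.exp (1 / (4 * S.sigmaZ ^ 2) * ‖z‖ ^ 2)) := by fun_prop
  have h3 : ∀ z : Fin T → EuclideanSpace ℝ (Fin nu),
      ENNReal.ofReal (Real.exp (∑ t : Fin T, 1 / (4 * S.sigmaZ ^ 2) * ‖z t‖ ^ 2))
        = ∏ t, ENNReal.ofReal (Real.exp (1 / (4 * S.sigmaZ ^ 2) * ‖z t‖ ^ 2)) := by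
    intro z
    rw [Real.exp_sum, ENNReal.ofReal_prod_of_nonneg fun _ _ => (Real.exp_pos _).le]
  rw [h2.lintegral_comp (f := fun z : Fin T → EuclideanSpace ℝ (Fin nu) =>
    ENNReal.ofReal (Real.exp (∑ t : Fin T, 1 / (4 * S.sigmaZ ^ 2) * ‖z t‖ ^ 2))) (by fun_prop)]
  simp_rw [h3]
  rw [lintegral_pi_prod (fun _ : Fin T => μ) (f := fun _ z => ENNReal.ofReal
    (Real.exp (1 / (4 * S.sigmaZ ^ 2) * ‖z‖ ^ 2))) fun _ => hm]
  refine (Finset.prod_le_prod' fun t _ => h1).trans (le_of_eq ?_)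
  rw [Finset.prod_const, ← ENNReal.ofReal_pow (Real.exp_pos _).le, ← Real.exp_nat_mul]
  simp

end TaskFamily

/-! ### Batches of independent trajectories -/

theorem measure_ge_le_of_lintegral_exp_le {Ω : Type*} [MeasurableSpace Ω] {μ : Measure Ω} {f : Ω → ℝ}
    (hf : Measurable f) {a b : ℝ}
    (h : ∫⁻ ω, ENNReal.ofReal (Real.exp (f ω)) ∂μ ≤ ENNReal.ofReal (Real.exp b)) :
    μ {ω | a ≤ f ω} ≤ ENNReal.ofReal (Real.exp (b - a)) := by
  have hset : {ω | a ≤ f ω}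
      = {ω | ENNReal.ofReal (Real.exp a) ≤ ENNReal.ofReal (Real.exp (f ω))} := by
    ext ω
    simp [ENNReal.ofReal_le_ofReal_iff (Real.exp_pos _).le]
  rw [hset]
  refine (meas_ge_le_lintegral_div (by fun_prop) (by simp [Real.exp_pos]) (by simp)).trans ?_
  rw [Real.exp_sub, ENNReal.ofReal_div_of_pos (Real.exp_pos _)]
  gcongr

theorem exists_bound_of_injective {V E F : Type*} [AddCommGroup V] [Module ℝ V]
    [NormedAddCommGroup E] [NormedSpace ℝ E] [FiniteDimensional ℝ E] [NormedAddCommGroup F]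
    [NormedSpace ℝ F] {L : V →ₗ[ℝ] E} (hL : Function.Injective L) (X : V →ₗ[ℝ] F) :
    ∃ C, ∀ v, ‖X v‖ ≤ C * ‖L v‖ := by
  obtain ⟨g, hg⟩ := L.exists_leftInverse_of_injective (LinearMap.ker_eq_bot.2 hL)
  let f : E →L[ℝ] F := LinearMap.toContinuousLinearMap (X ∘ₗ g)
  refine ⟨‖f‖, fun v => ?_⟩
  have : X v = f (L v) := by
    have := LinearMap.congr_fun hg v
    simp only [LinearMap.comp_apply, LinearMap.id_apply] at this
    simp [f, this]
  rw [this]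
  exact f.le_opNorm _

namespace TaskFamily

variable {nx nu k H : ℕ} (S : TaskFamily nx nu k H) {ι : Type*} [Fintype ι]
  (τ : ι → Fin (H + 1)) {N T : ℕ}

/-- The law of the noise of `N` independent trajectories of each of the tasks `τ g`, `g : ι`. -/
noncomputable def batchLaw (N T : ℕ) : Measure (ι × Fin N → TrajNoise nx nu T) :=
  Measure.pi fun j => S.noiseLaw (τ j.1) T

instance isProbabilityMeasure_batchLaw : IsProbabilityMeasure (S.batchLaw τ N T) := by
  unfold batchLaw
  infer_instance

/-- The linear map that sends one matrix `D g` for each task to the vector of all `D g x[t]`, with `x`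
ranging over the trajectories of the `g`-th task. -/
noncomputable def design (p : ℕ) (ξ : ι × Fin N → TrajNoise nx nu T) :
    (ι → Matrix (Fin p) (Fin nx) ℝ) →ₗ[ℝ]
      PiLp 2 (fun _ : (ι × Fin N) × Fin T => EuclideanSpace ℝ (Fin p)) where
  toFun D := WithLp.toLp 2 fun q => (D q.1.1).toEuclideanLin (S.state (τ q.1.1) (ξ q.1) q.2)
  map_add' D D' := by
    rw [← WithLp.toLp_add]
    congr 1
    funext q
    simp only [Pi.add_apply, map_add, LinearMap.add_apply]
  map_smul' c D := by
    rw [RingHom.id_apply, ← WithLp.toLp_smul]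
    congr 1
    funext q
    simp only [Pi.smul_apply, map_smul, LinearMap.smul_apply]

/-- All actuator noises of a batch. -/
noncomputable def actuator (ξ : ι × Fin N → TrajNoise nx nu T) :
    PiLp 2 (fun _ : (ι × Fin N) × Fin T => EuclideanSpace ℝ (Fin nu)) :=
  WithLp.toLp 2 fun q => (ξ q.1).2.1 q.2

/-- The rows of the matrices `D g`, multiplied by the square roots of the stationary covariances. The
norm of this vector is the population counterpart of the norm of `design`. -/
noncomputable def weight (p : ℕ) : (ι → Matrix (Fin p) (Fin nx) ℝ) →ₗ[ℝ]
      PiLp 2 (fun _ : ι × Fin p => EuclideanSpace ℝ (Fin nx)) where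
  toFun D := WithLp.toLp 2 fun q =>
    (CFC.sqrt (S.covX (τ q.1))).toEuclideanLin (WithLp.toLp 2 (D q.1 q.2))
  map_add' D D' := by
    rw [← WithLp.toLp_add]
    congr 1
    funext q
    rw [Pi.add_apply, Pi.add_apply, ← map_add]
    rfl
  map_smul' c D := by
    rw [RingHom.id_apply, ← WithLp.toLp_smul]
    congr 1
    funext q
    rw [Pi.smul_apply, Pi.smul_apply, ← map_smul]
    rfl

theorem norm_sq_design (p : ℕ) (ξ : ι × Fin N → TrajNoise nx nu T)
    (D : ι → Matrix (Fin p) (Fin nx) ℝ) : ‖S.design τ p ξ D‖ ^ 2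
      = ∑ j : ι × Fin N, ∑ t : Fin T, ‖(D j.1).toEuclideanLin (S.state (τ j.1) (ξ j) t)‖ ^ 2 := by
  rw [PiLp.norm_sq_eq_of_L2, Fintype.sum_prod_type]
  rfl

theorem norm_sq_actuator (ξ : ι × Fin N → TrajNoise nx nu T) : ‖actuator ξ‖ ^ 2
      = ∑ j : ι × Fin N, ∑ t : Fin T, ‖(ξ j).2.1 t‖ ^ 2 := by
  rw [PiLp.norm_sq_eq_of_L2, Fintype.sum_prod_type]
  rfl

theorem inner_actuator_design (ξ : ι × Fin N → TrajNoise nx nu T)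
    (D : ι → Matrix (Fin nu) (Fin nx) ℝ) : inner ℝ (actuator ξ) (S.design τ nu ξ D)
      = ∑ j : ι × Fin N, ∑ t : Fin T,
        inner ℝ ((ξ j).2.1 t) ((D j.1).toEuclideanLin (S.state (τ j.1) (ξ j) t)) := by
  rw [PiLp.inner_apply, Fintype.sum_prod_type]
  rfl

theorem norm_sq_weight (p : ℕ) (D : ι → Matrix (Fin p) (Fin nx) ℝ) :
    ‖S.weight τ p D‖ ^ 2 = ∑ g, energy (S.covX (τ g)) (D g) := by
  rw [PiLp.norm_sq_eq_of_L2, Fintype.sum_prod_type]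
  refine Finset.sum_congr rfl fun g _ => Finset.sum_congr rfl fun a _ => ?_
  exact norm_sqrt_sq (S.covX_posDef _).posSemidef _

theorem eq_zero_of_quad_eq_zero {h : Fin (H + 1)} {v : EuclideanSpace ℝ (Fin nx)}
    (hv : quad (S.covX h) v = 0) : v = 0 := by
  by_contra hne
  exact ((posDef_iff_quad.1 (S.covX_posDef h)).2 v hne).ne' hv

theorem injective_weight (p : ℕ) : Function.Injective (S.weight τ p) := by
  rw [← LinearMap.ker_eq_bot, LinearMap.ker_eq_bot']
  intro D hD
  have h1 := S.norm_sq_weight τ p D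
  rw [hD, norm_zero, zero_pow two_ne_zero, eq_comm,
    Finset.sum_eq_zero_iff_of_nonneg fun g _ => energy_nonneg (S.covX_posDef _).posSemidef _] at h1
  funext g
  have h2 := h1 g (Finset.mem_univ _)
  rw [energy, Finset.sum_eq_zero_iff_of_nonneg fun a _ => quad_nonneg (S.covX_posDef _).posSemidef _]
    at h2
  funext a
  have h3 := S.eq_zero_of_quad_eq_zero (h2 a (Finset.mem_univ _))
  exact (WithLp.toLp_eq_zero 2).1 h3

theorem continuous_design {ι : Type*} (τ : ι → Fin (H + 1)) {N T p : ℕ}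
    (D : ι → Matrix (Fin p) (Fin nx) ℝ) :
    Continuous fun ξ : ι × Fin N → TrajNoise nx nu T => S.design τ p ξ D := by
  have hc : ∀ g, Continuous (D g).toEuclideanLin :=
    fun g => LinearMap.continuous_of_finiteDimensional _
  exact (PiLp.continuous_toLp 2 _).comp (continuous_pi fun q =>
    (hc _).comp ((S.continuous_state _ _).comp (continuous_apply q.1)))

theorem continuous_actuator {ι : Type*} {N T : ℕ} :
    Continuous (actuator : (ι × Fin N → TrajNoise nx nu T) → _) := by
  refine (PiLp.continuous_toLp 2 _).comp (continuous_pi fun q => ?_)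
  exact (continuous_apply q.2).comp
    (continuous_fst.comp (continuous_snd.comp (continuous_apply q.1)))

theorem sum_batch_energy {p : ℕ} (D : ι → Matrix (Fin p) (Fin nx) ℝ) :
    ∑ j : ι × Fin N, energy (S.covX (τ j.1)) (D j.1) = N * ‖S.weight τ p D‖ ^ 2 := by
  rw [norm_sq_weight, Fintype.sum_prod_type, Finset.mul_sum]
  simp

section Concentration

variable [Nonempty (Fin nx)]

theorem lintegral_exp_design_le {p : ℕ} (D : ι → Matrix (Fin p) (Fin nx) ℝ) {s Λ e : ℝ}
    (hΛ : ∀ g, S.corr (τ g) ≤ Λ) (hΛ0 : 0 ≤ Λ) (he : ‖S.weight τ p D‖ ^ 2 ≤ e)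
    (hs : |s| * (Λ * e) ≤ 1 / 4) :
    ∫⁻ ξ, ENNReal.ofReal (Real.exp (s * ‖S.design τ p ξ D‖ ^ 2)) ∂S.batchLaw τ N T
      ≤ ENNReal.ofReal (Real.exp ((s + 2 * s ^ 2 * (Λ * e)) * (N * T * ‖S.weight τ p D‖ ^ 2))) := by
  set q : ι × Fin N → ℝ := fun j => energy (S.covX (τ j.1)) (D j.1) with hq
  have hq0 : ∀ j, 0 ≤ q j := fun j => energy_nonneg (S.covX_posDef _).posSemidef _
  have hqe : ∀ j, S.corr (τ j.1) * q j ≤ Λ * e := by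
    intro j
    have h1 : q j ≤ e := by
      refine le_trans ?_ he
      rw [norm_sq_weight]
      exact Finset.single_le_sum (f := fun g => energy (S.covX (τ g)) (D g))
        (fun g _ => energy_nonneg (S.covX_posDef _).posSemidef _) (Finset.mem_univ j.1)
    have := hq0 j
    calc S.corr (τ j.1) * q j ≤ Λ * q j := by gcongr; exact hΛ _
      _ ≤ Λ * e := by gcongr
  have hc : ∀ j : ι × Fin N, Measurable fun ξ : TrajNoise nx nu T => ENNReal.ofReal (Real.exp
      (s * ∑ t : Fin T, ‖(D j.1).toEuclideanLin (S.state (τ j.1) ξ t)‖ ^ 2)) := by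
    intro j
    have h1 : Continuous (D j.1).toEuclideanLin := LinearMap.continuous_of_finiteDimensional _
    refine Continuous.measurable (ENNReal.continuous_ofReal.comp (Real.continuous_exp.comp
      (continuous_const.mul (continuous_finsetSum _ fun t _ => ?_))))
    exact (h1.comp (S.continuous_state _ _)).norm.pow 2
  have e1 : ∀ ξ : ι × Fin N → TrajNoise nx nu T,
      ENNReal.ofReal (Real.exp (s * ‖S.design τ p ξ D‖ ^ 2)) = ∏ j, ENNReal.ofReal (Real.exp
      (s * ∑ t : Fin T, ‖(D j.1).toEuclideanLin (S.state (τ j.1) (ξ j) t)‖ ^ 2)) := by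
    intro ξ
    rw [norm_sq_design, Finset.mul_sum, Real.exp_sum,
      ENNReal.ofReal_prod_of_nonneg fun _ _ => (Real.exp_pos _).le]
  simp_rw [e1]
  rw [batchLaw, lintegral_pi_prod (fun j : ι × Fin N => S.noiseLaw (τ j.1) T) (f := fun j ξ =>
    ENNReal.ofReal (Real.exp
      (s * ∑ t : Fin T, ‖(D j.1).toEuclideanLin (S.state (τ j.1) ξ t)‖ ^ 2))) hc]
  have h2 : ∀ j : ι × Fin N, ∫⁻ ξ, ENNReal.ofReal (Real.exp
      (s * ∑ t : Fin T, ‖(D j.1).toEuclideanLin (S.state (τ j.1) ξ t)‖ ^ 2)) ∂S.noiseLaw (τ j.1) T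
      ≤ ENNReal.ofReal (Real.exp ((s + 2 * s ^ 2 * (Λ * e)) * (T * q j))) := by
    intro j
    refine (S.lintegral_exp_output_le (τ j.1) (D j.1) ?_).trans ?_
    · exact (mul_le_mul_of_nonneg_left (hqe j) (abs_nonneg s)).trans hs
    · apply ENNReal.ofReal_le_ofReal
      apply Real.exp_le_exp.2
      refine mul_le_mul_of_nonneg_right ?_ (mul_nonneg (Nat.cast_nonneg T) (hq0 j))
      exact add_le_add le_rfl (mul_le_mul_of_nonneg_left (hqe j) (by positivity))
  refine (Finset.prod_le_prod' fun j _ => h2 j).trans (le_of_eq ?_)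
  rw [← ENNReal.ofReal_prod_of_nonneg fun _ _ => (Real.exp_pos _).le, ← Real.exp_sum,
    ← Finset.mul_sum, ← Finset.mul_sum, S.sum_batch_energy τ D]
  ring_nf

theorem measure_design_ge_le {p : ℕ} (D : ι → Matrix (Fin p) (Fin nx) ℝ) {Λ ρ : ℝ}
    (hΛ : ∀ g, S.corr (τ g) ≤ Λ) (hΛ0 : 0 < Λ) (hρ : 0 < ρ) (he : ‖S.weight τ p D‖ ^ 2 ≤ ρ) :
    S.batchLaw τ N T {ξ | 5 / 4 * (N * T * ρ) ≤ ‖S.design τ p ξ D‖ ^ 2}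
      ≤ ENNReal.ofReal (Real.exp (-(N * T / (128 * Λ)))) := by
  have hm : Measurable fun ξ : ι × Fin N → TrajNoise nx nu T => ‖S.design τ p ξ D‖ ^ 2 :=
    ((S.continuous_design τ D).norm.pow 2).measurable
  have h1 := S.lintegral_exp_design_le τ (N := N) (T := T) D (s := 1 / (16 * (Λ * ρ))) hΛ hΛ0.le he (by
    rw [abs_of_pos (by positivity)]
    have : 1 / (16 * (Λ * ρ)) * (Λ * ρ) = 1 / 16 := by field_simp
    rw [this]; norm_num)
  have h2 := measure_ge_le_of_lintegral_exp_le (a := 1 / (16 * (Λ * ρ)) * (5 / 4 * (N * T * ρ)))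
    (hm.const_mul (1 / (16 * (Λ * ρ)))) h1
  have hset : {ξ : ι × Fin N → TrajNoise nx nu T | 5 / 4 * (N * T * ρ) ≤ ‖S.design τ p ξ D‖ ^ 2}
      = {ξ | 1 / (16 * (Λ * ρ)) * (5 / 4 * (N * T * ρ))
        ≤ 1 / (16 * (Λ * ρ)) * ‖S.design τ p ξ D‖ ^ 2} := by
    ext ξ
    exact (mul_le_mul_iff_of_pos_left (show (0 : ℝ) < 1 / (16 * (Λ * ρ)) by positivity)).symm
  rw [hset]
  refine h2.trans (ENNReal.ofReal_le_ofReal (Real.exp_le_exp.2 ?_))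
  have h3 : (1 / (16 * (Λ * ρ)) + 2 * (1 / (16 * (Λ * ρ))) ^ 2 * (Λ * ρ))
      * (N * T * ‖S.weight τ p D‖ ^ 2)
      ≤ (1 / (16 * (Λ * ρ)) + 2 * (1 / (16 * (Λ * ρ))) ^ 2 * (Λ * ρ)) * (N * T * ρ) := by
    gcongr
  have h4 : (1 / (16 * (Λ * ρ)) + 2 * (1 / (16 * (Λ * ρ))) ^ 2 * (Λ * ρ)) * (N * T * ρ)
      - 1 / (16 * (Λ * ρ)) * (5 / 4 * (N * T * ρ)) = -(N * T / (128 * Λ)) := by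
    field_simp
    ring
  linarith

theorem measure_design_le_le {p : ℕ} (D : ι → Matrix (Fin p) (Fin nx) ℝ) {Λ : ℝ}
    (hΛ : ∀ g, S.corr (τ g) ≤ Λ) (hΛ0 : 0 < Λ) (he : ‖S.weight τ p D‖ ^ 2 = 1) :
    S.batchLaw τ N T {ξ | ‖S.design τ p ξ D‖ ^ 2 ≤ 3 / 4 * (N * T)}
      ≤ ENNReal.ofReal (Real.exp (-(N * T / (128 * Λ)))) := by
  have hm : Measurable fun ξ : ι × Fin N → TrajNoise nx nu T => ‖S.design τ p ξ D‖ ^ 2 :=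
    ((S.continuous_design τ D).norm.pow 2).measurable
  have h1 := S.lintegral_exp_design_le τ (N := N) (T := T) D (s := -(1 / (16 * Λ))) hΛ hΛ0.le he.le (by
    rw [abs_neg, abs_of_pos (by positivity)]
    have : 1 / (16 * Λ) * (Λ * 1) = 1 / 16 := by field_simp
    rw [this]; norm_num)
  have h2 := measure_ge_le_of_lintegral_exp_le (a := -(1 / (16 * Λ)) * (3 / 4 * (N * T)))
    (hm.const_mul (-(1 / (16 * Λ)))) h1
  have hset : {ξ : ι × Fin N → TrajNoise nx nu T | ‖S.design τ p ξ D‖ ^ 2 ≤ 3 / 4 * (N * T)}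
      = {ξ | -(1 / (16 * Λ)) * (3 / 4 * (N * T))
        ≤ -(1 / (16 * Λ)) * ‖S.design τ p ξ D‖ ^ 2} := by
    ext ξ
    simp only [Set.mem_ofPred_eq, neg_mul, neg_le_neg_iff]
    exact (mul_le_mul_iff_of_pos_left (show (0 : ℝ) < 1 / (16 * Λ) by positivity)).symm
  rw [hset]
  refine h2.trans (ENNReal.ofReal_le_ofReal (Real.exp_le_exp.2 (le_of_eq ?_)))
  rw [he]
  field_simp
  ring

/-- On a `d`-dimensional space of matrices the empirical norm is comparable to the population norm. -/
theorem measure_not_design_bounds_le {p : ℕ} (W : Submodule ℝ (ι → Matrix (Fin p) (Fin nx) ℝ)) {Λ : ℝ}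
    (hΛ : ∀ g, S.corr (τ g) ≤ Λ) (hΛ0 : 0 < Λ) :
    S.batchLaw τ N T {ξ | ¬ ∀ D ∈ W, 2 / 5 * √(N * T) * ‖S.weight τ p D‖ ≤ ‖S.design τ p ξ D‖ ∧
        ‖S.design τ p ξ D‖ ≤ 3 / 2 * √(N * T) * ‖S.weight τ p D‖}
      ≤ ENNReal.ofReal (2 * 9 ^ Module.finrank ℝ W * Real.exp (-(N * T / (128 * Λ)))) := by
  obtain ⟨s, hcard, hs1, hnet⟩ := exists_net_submodule (S.weight τ p) W
  set ε := Real.exp (-((N : ℝ) * T / (128 * Λ))) with hε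
  have hε0 : 0 < ε := Real.exp_pos _
  set B : (ι → Matrix (Fin p) (Fin nx) ℝ) → Set (ι × Fin N → TrajNoise nx nu T) := fun D =>
    {ξ | 5 / 4 * (N * T * 1) ≤ ‖S.design τ p ξ D‖ ^ 2} ∪ {ξ | ‖S.design τ p ξ D‖ ^ 2 ≤ 3 / 4 * (N * T)}
    with hB
  have hBm : ∀ D ∈ s, S.batchLaw τ N T (B D) ≤ ENNReal.ofReal (2 * ε) := by
    intro D hD
    have h1 := (hs1 D hD).2
    refine (measure_union_le _ _).trans ?_
    refine (add_le_add (S.measure_design_ge_le τ D hΛ hΛ0 one_pos (by rw [h1]; norm_num))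
      (S.measure_design_le_le τ D hΛ hΛ0 (by rw [h1]; norm_num))).trans (le_of_eq ?_)
    rw [← ENNReal.ofReal_add hε0.le hε0.le, two_mul]
  have hsub : {ξ | ¬ ∀ D ∈ W, 2 / 5 * √(N * T) * ‖S.weight τ p D‖ ≤ ‖S.design τ p ξ D‖ ∧
        ‖S.design τ p ξ D‖ ≤ 3 / 2 * √(N * T) * ‖S.weight τ p D‖} ⊆ ⋃ D ∈ s, B D := by
    intro ξ hξ
    by_contra hcon
    simp only [hB, Set.mem_iUnion, Set.mem_union, Set.mem_ofPred_eq, not_exists, not_or, not_le,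
      mul_one] at hcon
    refine hξ fun D hD => ?_
    have hNT : (0 : ℝ) ≤ N * T := by positivity
    have hsq : √((N : ℝ) * T) ^ 2 = N * T := Real.sq_sqrt hNT
    obtain ⟨C, hC⟩ := exists_bound_of_injective (S.injective_weight τ p) (S.design τ p ξ)
    have hb := norm_bounds_of_net (fun c hc => (hs1 c hc).1) hnet (S.design τ p ξ)
      (fun v _ => hC v) (a := 9 / 8 * √(N * T)) (b := 17 / 20 * √(N * T)) (by positivity)
      (fun c hc => by
        refine abs_le_of_sq_le_sq' ?_ (by positivity) |>.2
        have := (hcon c hc).1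
        rw [mul_pow, hsq]
        linarith)
      (fun c hc => by
        refine abs_le_of_sq_le_sq' ?_ (norm_nonneg _) |>.2
        have := (hcon c hc).2
        rw [mul_pow, hsq]
        linarith) D hD
    have h0 : 0 ≤ √((N : ℝ) * T) * ‖S.weight τ p D‖ := by positivity
    constructor
    · refine le_trans ?_ hb.2
      nlinarith
    · refine hb.1.trans (le_of_eq (by ring))
  refine (measure_mono hsub).trans ((measure_biUnion_finset_le _ _).trans ?_)
  refine (Finset.sum_le_sum hBm).trans ?_
  rw [Finset.sum_const, nsmul_eq_mul, ← ENNReal.ofReal_natCast, ← ENNReal.ofReal_mul (by positivity)]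
  apply ENNReal.ofReal_le_ofReal
  have : (s.card : ℝ) ≤ 9 ^ Module.finrank ℝ W := by exact_mod_cast hcard
  nlinarith

end Concentration

theorem lintegral_exp_batch_martingale_le (D : ι → Matrix (Fin nu) (Fin nx) ℝ) :
    ∫⁻ ξ, ENNReal.ofReal (Real.exp (inner ℝ (actuator ξ) (S.design τ nu ξ D)
      - S.sigmaZ ^ 2 / 2 * ‖S.design τ nu ξ D‖ ^ 2)) ∂S.batchLaw τ N T ≤ 1 := by
  have hc : ∀ j : ι × Fin N, Measurable fun ξ : TrajNoise nx nu T => ENNReal.ofReal (Real.exp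
      (∑ t : Fin T, (inner ℝ (ξ.2.1 t) ((D j.1).toEuclideanLin (S.state (τ j.1) ξ t))
        - S.sigmaZ ^ 2 / 2 * ‖(D j.1).toEuclideanLin (S.state (τ j.1) ξ t)‖ ^ 2))) := by
    intro j
    have h1 : Continuous (D j.1).toEuclideanLin := LinearMap.continuous_of_finiteDimensional _
    refine Continuous.measurable (ENNReal.continuous_ofReal.comp (Real.continuous_exp.comp
      (continuous_finsetSum _ fun t _ => ?_)))
    have h2 : Continuous fun ξ : TrajNoise nx nu T => (D j.1).toEuclideanLin (S.state (τ j.1) ξ t) :=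
      h1.comp (S.continuous_state _ _)
    exact (((continuous_apply t).comp (continuous_fst.comp continuous_snd)).inner h2).sub
      (continuous_const.mul (h2.norm.pow 2))
  have e1 : ∀ ξ : ι × Fin N → TrajNoise nx nu T,
      ENNReal.ofReal (Real.exp (inner ℝ (actuator ξ) (S.design τ nu ξ D)
      - S.sigmaZ ^ 2 / 2 * ‖S.design τ nu ξ D‖ ^ 2)) = ∏ j, ENNReal.ofReal (Real.exp
      (∑ t : Fin T, (inner ℝ ((ξ j).2.1 t) ((D j.1).toEuclideanLin (S.state (τ j.1) (ξ j) t))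
        - S.sigmaZ ^ 2 / 2 * ‖(D j.1).toEuclideanLin (S.state (τ j.1) (ξ j) t)‖ ^ 2))) := by
    intro ξ
    rw [← ENNReal.ofReal_prod_of_nonneg fun _ _ => (Real.exp_pos _).le, ← Real.exp_sum,
      inner_actuator_design, norm_sq_design, Finset.mul_sum, ← Finset.sum_sub_distrib]
    congr 2
    refine Finset.sum_congr rfl fun j _ => ?_
    rw [Finset.mul_sum, ← Finset.sum_sub_distrib]
  simp_rw [e1]
  rw [batchLaw, lintegral_pi_prod (fun j : ι × Fin N => S.noiseLaw (τ j.1) T) (f := fun j ξ =>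
    ENNReal.ofReal (Real.exp
      (∑ t : Fin T, (inner ℝ (ξ.2.1 t) ((D j.1).toEuclideanLin (S.state (τ j.1) ξ t))
        - S.sigmaZ ^ 2 / 2 * ‖(D j.1).toEuclideanLin (S.state (τ j.1) ξ t)‖ ^ 2)))) hc]
  exact Finset.prod_le_one' fun j _ => S.lintegral_exp_martingale_le (τ j.1) (D j.1)

/-- The correlation of the actuator noise with the elements of a `d`-dimensional space of predictors,
relative to their population norm, is of order `σ √(N T (d + log (1 / δ)))`. -/
theorem measure_inner_actuator_gt_le (W : Submodule ℝ (ι → Matrix (Fin nu) (Fin nx) ℝ)) {l : ℝ}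
    (hl : 0 < l) (hNT : (0 : ℝ) < N * T) :
    S.batchLaw τ N T {ξ | (∀ D ∈ W, ‖S.design τ nu ξ D‖ ≤ 3 / 2 * √(N * T) * ‖S.weight τ nu D‖) ∧
        ¬ ∀ D ∈ W, inner ℝ (actuator ξ) (S.design τ nu ξ D)
          ≤ 3 * (S.sigmaZ * √l) * √(N * T) * ‖S.weight τ nu D‖}
      ≤ ENNReal.ofReal (9 ^ Module.finrank ℝ W * Real.exp (-l)) := by
  obtain ⟨s, hcard, hs1, hnet⟩ := exists_net_submodule (S.weight τ nu) W
  have hσ := S.sigmaZ_pos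
  set r := √((N : ℝ) * T) with hr
  have hr0 : 0 < r := Real.sqrt_pos.2 hNT
  set m := √l with hm
  have hm0 : 0 < m := Real.sqrt_pos.2 hl
  have hml : m ^ 2 = l := Real.sq_sqrt hl.le
  -- the multiplier that balances the two terms of the exponential process
  set θ := m / (S.sigmaZ * r) with hθ
  have hθ0 : 0 < θ := by positivity
  set f : (ι → Matrix (Fin nu) (Fin nx) ℝ) → (ι × Fin N → TrajNoise nx nu T) → ℝ := fun D ξ =>
    inner ℝ (actuator ξ) (S.design τ nu ξ (θ • D))
      - S.sigmaZ ^ 2 / 2 * ‖S.design τ nu ξ (θ • D)‖ ^ 2 with hf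
  have hBm : ∀ D ∈ s, S.batchLaw τ N T {ξ | l ≤ f D ξ} ≤ ENNReal.ofReal (Real.exp (-l)) := by
    intro D _
    have hfm : Measurable (f D) := by
      refine Continuous.measurable ?_
      exact (continuous_actuator.inner (S.continuous_design τ _)).sub
        (continuous_const.mul ((S.continuous_design τ _).norm.pow 2))
    have := measure_ge_le_of_lintegral_exp_le (a := l) (b := 0) hfm (by
      rw [Real.exp_zero, ENNReal.ofReal_one]
      exact S.lintegral_exp_batch_martingale_le τ (N := N) (T := T) (θ • D))
    simpa using this
  have hsub : {ξ | (∀ D ∈ W, ‖S.design τ nu ξ D‖ ≤ 3 / 2 * r * ‖S.weight τ nu D‖) ∧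
        ¬ ∀ D ∈ W, inner ℝ (actuator ξ) (S.design τ nu ξ D)
          ≤ 3 * (S.sigmaZ * m) * r * ‖S.weight τ nu D‖} ⊆ ⋃ D ∈ s, {ξ | l ≤ f D ξ} := by
    rintro ξ ⟨hU, hξ⟩
    by_contra hcon
    simp only [Set.mem_iUnion, Set.mem_ofPred_eq, not_exists, not_le] at hcon
    refine hξ fun D hD => ?_
    have hpt : ∀ c ∈ s, inner ℝ (actuator ξ) (S.design τ nu ξ c) ≤ 17 / 8 * (S.sigmaZ * m * r) := by
      intro c hc
      have h1 := hcon c hc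
      have h2 := hU c (hs1 c hc).1
      rw [(hs1 c hc).2, mul_one] at h2
      have h3 : ‖S.design τ nu ξ c‖ ^ 2 ≤ 9 / 4 * r ^ 2 := by
        calc ‖S.design τ nu ξ c‖ ^ 2 ≤ (3 / 2 * r) ^ 2 := by gcongr
          _ = 9 / 4 * r ^ 2 := by ring
      simp only [hf, map_smul, real_inner_smul_right, norm_smul, mul_pow, Real.norm_eq_abs, sq_abs]
        at h1
      set x := inner ℝ (actuator ξ) (S.design τ nu ξ c) with hx
      have h4 : S.sigmaZ ^ 2 / 2 * (θ ^ 2 * ‖S.design τ nu ξ c‖ ^ 2)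
          ≤ S.sigmaZ ^ 2 / 2 * (θ ^ 2 * (9 / 4 * r ^ 2)) := by gcongr
      have h5 : S.sigmaZ ^ 2 / 2 * (θ ^ 2 * (9 / 4 * r ^ 2)) = 9 / 8 * m ^ 2 := by
        rw [hθ]; field_simp; ring
      have h6 : θ * x ≤ 17 / 8 * m ^ 2 := by rw [← hml] at h1; linarith
      have h7 : θ * (17 / 8 * (S.sigmaZ * m * r)) = 17 / 8 * m ^ 2 := by
        rw [hθ]; field_simp
      rw [← h7] at h6
      exact le_of_mul_le_mul_left h6 hθ0
    have hb := sublinear_le_of_net (fun c hc => (hs1 c hc).1) hnet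
      (g := fun D => inner ℝ (actuator ξ) (S.design τ nu ξ D))
      (fun u v => by rw [map_add, inner_add_right])
      (fun c v _ => by rw [map_smul, real_inner_smul_right])
      (C := ‖actuator ξ‖ * (3 / 2 * r))
      (fun v hv => by
        refine (real_inner_le_norm _ _).trans ?_
        rw [mul_assoc]
        gcongr
        exact hU v hv) (by positivity) hpt D hD
    refine hb.trans ?_
    have : 0 ≤ S.sigmaZ * m * r * ‖S.weight τ nu D‖ := by positivity
    nlinarith
  refine (measure_mono hsub).trans ((measure_biUnion_finset_le _ _).trans ?_)
  refine (Finset.sum_le_sum hBm).trans ?_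
  rw [Finset.sum_const, nsmul_eq_mul, ← ENNReal.ofReal_natCast, ← ENNReal.ofReal_mul (by positivity)]
  apply ENNReal.ofReal_le_ofReal
  have : (s.card : ℝ) ≤ 9 ^ Module.finrank ℝ W := by exact_mod_cast hcard
  gcongr

theorem measure_actuator_ge_le (l : ℝ) :
    S.batchLaw τ N T {ξ | 4 * S.sigmaZ ^ 2 * (Fintype.card ι * N * T * nu + l) ≤ ‖actuator ξ‖ ^ 2}
      ≤ ENNReal.ofReal (Real.exp (-l)) := by
  have hσ := S.sigmaZ_pos
  have hm : Measurable fun ξ : ι × Fin N → TrajNoise nx nu T =>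
      1 / (4 * S.sigmaZ ^ 2) * ‖actuator ξ‖ ^ 2 :=
    (continuous_const.mul (continuous_actuator.norm.pow 2)).measurable
  have h1 : ∫⁻ ξ, ENNReal.ofReal (Real.exp (1 / (4 * S.sigmaZ ^ 2) * ‖actuator ξ‖ ^ 2))
      ∂S.batchLaw τ N T ≤ ENNReal.ofReal (Real.exp (Fintype.card ι * N * T * nu)) := by
    have e1 : ∀ ξ : ι × Fin N → TrajNoise nx nu T,
        ENNReal.ofReal (Real.exp (1 / (4 * S.sigmaZ ^ 2) * ‖actuator ξ‖ ^ 2))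
        = ∏ j, ENNReal.ofReal (Real.exp (∑ t : Fin T, 1 / (4 * S.sigmaZ ^ 2) * ‖(ξ j).2.1 t‖ ^ 2)) := by
      intro ξ
      rw [← ENNReal.ofReal_prod_of_nonneg fun _ _ => (Real.exp_pos _).le, ← Real.exp_sum,
        norm_sq_actuator, Finset.mul_sum]
      simp_rw [Finset.mul_sum]
    simp_rw [e1]
    have hc : Measurable fun ξ : TrajNoise nx nu T => ENNReal.ofReal (Real.exp
        (∑ t : Fin T, 1 / (4 * S.sigmaZ ^ 2) * ‖ξ.2.1 t‖ ^ 2)) := by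
      refine Continuous.measurable (ENNReal.continuous_ofReal.comp (Real.continuous_exp.comp
        (continuous_finsetSum _ fun t _ => continuous_const.mul ?_)))
      exact (((continuous_apply t).comp (continuous_fst.comp continuous_snd))).norm.pow 2
    rw [batchLaw, lintegral_pi_prod (fun j : ι × Fin N => S.noiseLaw (τ j.1) T) (f := fun j ξ =>
      ENNReal.ofReal (Real.exp (∑ t : Fin T, 1 / (4 * S.sigmaZ ^ 2) * ‖ξ.2.1 t‖ ^ 2))) fun _ => hc]
    refine (Finset.prod_le_prod' fun j _ => S.lintegral_exp_actuator_le (τ j.1) T).trans (le_of_eq ?_)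
    rw [Finset.prod_const, ← ENNReal.ofReal_pow (Real.exp_pos _).le, ← Real.exp_nat_mul]
    simp [mul_assoc]
  have h2 := measure_ge_le_of_lintegral_exp_le (a := Fintype.card ι * N * T * nu + l) hm h1
  have hset : {ξ : ι × Fin N → TrajNoise nx nu T |
      4 * S.sigmaZ ^ 2 * (Fintype.card ι * N * T * nu + l) ≤ ‖actuator ξ‖ ^ 2}
      = {ξ | Fintype.card ι * N * T * nu + l ≤ 1 / (4 * S.sigmaZ ^ 2) * ‖actuator ξ‖ ^ 2} := by
    ext ξ
    simp only [Set.mem_ofPred_eq]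
    rw [one_div, le_inv_mul_iff₀ (by positivity)]
  rw [hset]
  refine h2.trans (le_of_eq ?_)
  congr 2
  ring

end TaskFamily

/-! ### Energies of matrix products -/

section EnergyMul

variable {l m n : Type*} [Fintype l] [Fintype m] [Fintype n] [DecidableEq n]

theorem row_mul {ι κ : Type*} [DecidableEq m] (G : Matrix ι m ℝ) (E : Matrix m κ ℝ) (a : ι) :
    (WithLp.toLp 2 ((G * E) a) : EuclideanSpace ℝ κ) = Eᵀ.toEuclideanLin (WithLp.toLp 2 (G a)) := by
  ext j
  simp [Matrix.mulVec, dotProduct, Matrix.mul_apply, mul_comm]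

theorem quad_one (v : EuclideanSpace ℝ n) : quad 1 v = ‖v‖ ^ 2 := by
  simp [quad]

theorem energy_one (M : Matrix m n ℝ) : energy 1 M = ∑ a, ∑ j, M a j ^ 2 := by
  simp only [energy, quad_one, EuclideanSpace.real_norm_sq_eq]

theorem energy_le_lambdaMax {Q : Matrix n n ℝ} (hQ : Q.PosSemidef) (M : Matrix m n ℝ) :
    energy Q M ≤ lambdaMax Q * energy 1 M := by
  rw [energy, energy, Finset.mul_sum]
  exact Finset.sum_le_sum fun a _ => by rw [quad_one]; exact quad_le_lambdaMax hQ _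

theorem lambdaMin_le_energy {Q : Matrix n n ℝ} (hQ : Q.PosSemidef) (M : Matrix m n ℝ) :
    lambdaMin Q * energy 1 M ≤ energy Q M := by
  rw [energy, energy, Finset.mul_sum]
  exact Finset.sum_le_sum fun a _ => by rw [quad_one]; exact lambdaMin_le_quad hQ _

theorem energy_one_mul_le [DecidableEq m] (G : Matrix l m ℝ) (E : Matrix m n ℝ) :
    energy 1 (G * E) ≤ energy 1 E * energy 1 G := by
  calc energy 1 (G * E) = ∑ a, quad 1 (Eᵀ.toEuclideanLin (WithLp.toLp 2 (G a))) :=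
        Finset.sum_congr rfl fun a _ => by rw [row_mul]
    _ ≤ ∑ a, energy 1 E * quad 1 (WithLp.toLp 2 (G a)) :=
        Finset.sum_le_sum fun a _ => by
          rw [quad_one (WithLp.toLp 2 (G a))]
          exact quad_transpose_le Matrix.PosSemidef.one E _
    _ = energy 1 E * energy 1 G := (Finset.mul_sum _ _ _).symm

theorem energy_one_mul_of_orthonormal [DecidableEq m] (G : Matrix l m ℝ) {Ψ : Matrix m n ℝ} (hΨ : Ψ * Ψᵀ = 1) :
    energy 1 (G * Ψ) = energy 1 G := by
  refine Finset.sum_congr rfl fun a _ => ?_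
  rw [row_mul, quad_one, quad_one, ← real_inner_self_eq_norm_sq, inner_toEuclideanLin_left,
    Matrix.transpose_transpose, ← LinearMap.comp_apply, ← Matrix.toLpLin_mul_same, hΨ]
  simp

theorem energy_eq_energy_one {Q : Matrix n n ℝ} (hQ : Q.PosSemidef) (M : Matrix m n ℝ) :
    energy Q M = energy 1 (M * CFC.sqrt Q) := by
  refine Finset.sum_congr rfl fun a _ => ?_
  rw [row_mul, quad_one, transpose_sqrt, norm_sqrt_sq hQ]

/-- `‖P X‖_F ≤ ‖P‖ ‖X‖_F`, column by column. -/
theorem energy_mul_le_opNorm [DecidableEq l] [DecidableEq m] {Q : Matrix n n ℝ} (hQ : Q.PosSemidef) (P : Matrix l m ℝ)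
    (M : Matrix m n ℝ) : energy Q (P * M) ≤ ‖P‖ ^ 2 * energy Q M := by
  rw [energy_eq_energy_one hQ, energy_eq_energy_one hQ, Matrix.mul_assoc, energy_one, energy_one,
    Finset.sum_comm, Finset.sum_comm (s := (Finset.univ : Finset m)), Finset.mul_sum]
  refine Finset.sum_le_sum fun j _ => ?_
  set X := M * CFC.sqrt Q
  have h := norm_toEuclideanLin_le P (WithLp.toLp 2 fun b => X b j)
  have h2 : ‖P.toEuclideanLin (WithLp.toLp 2 fun b => X b j)‖ ^ 2
      ≤ (‖P‖ * ‖(WithLp.toLp 2 fun b => X b j : EuclideanSpace ℝ m)‖) ^ 2 := by gcongr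
  rw [mul_pow, EuclideanSpace.real_norm_sq_eq, EuclideanSpace.real_norm_sq_eq] at h2
  exact h2

theorem energy_add_le {Q : Matrix n n ℝ} (hQ : Q.PosSemidef) (M M' : Matrix m n ℝ) :
    energy Q (M + M') ≤ 2 * energy Q M + 2 * energy Q M' := by
  rw [energy_eq_energy_one hQ, energy_eq_energy_one hQ M, energy_eq_energy_one hQ M', Matrix.add_mul,
    energy_one, energy_one, energy_one, Finset.mul_sum, Finset.mul_sum, ← Finset.sum_add_distrib]
  refine Finset.sum_le_sum fun a _ => ?_
  rw [Finset.mul_sum, Finset.mul_sum, ← Finset.sum_add_distrib]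
  refine Finset.sum_le_sum fun j _ => ?_
  rw [Matrix.add_apply]
  nlinarith [sq_nonneg ((M * CFC.sqrt Q) a j - (M' * CFC.sqrt Q) a j)]

theorem energy_neg (Q : Matrix n n ℝ) (M : Matrix m n ℝ) : energy Q (-M) = energy Q M := by
  refine Finset.sum_congr rfl fun a _ => ?_
  have : (WithLp.toLp 2 ((-M) a) : EuclideanSpace ℝ n) = -WithLp.toLp 2 (M a) := rfl
  rw [this, quad, quad, map_neg, inner_neg_neg]

end EnergyMul

/-- Vectors as one-row matrices in the `g`-th component of a family of matrices. -/
noncomputable def singleRow {ι : Type*} [DecidableEq ι] (n : ℕ) (g : ι) :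
    EuclideanSpace ℝ (Fin n) →ₗ[ℝ] (ι → Matrix (Fin 1) (Fin n) ℝ) :=
  (LinearMap.single ℝ (fun _ : ι => Matrix (Fin 1) (Fin n) ℝ) g) ∘ₗ
    { toFun := fun v => Matrix.of fun _ => v.ofLp
      map_add' := fun _ _ => rfl
      map_smul' := fun _ _ => rfl }

theorem singleRow_same {ι : Type*} [DecidableEq ι] (n : ℕ) (g : ι) (v : EuclideanSpace ℝ (Fin n)) :
    singleRow n g v g = Matrix.of fun _ => v.ofLp := by
  simp only [singleRow, LinearMap.comp_apply, LinearMap.single_apply, Pi.single_eq_same]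
  rfl

theorem singleRow_ne {ι : Type*} [DecidableEq ι] (n : ℕ) {g g' : ι} (hg : g' ≠ g) (v : EuclideanSpace ℝ (Fin n)) :
    singleRow n g v g' = 0 := by
  simp [singleRow, Pi.single_eq_of_ne hg]

namespace TaskFamily

variable {nx nu k H : ℕ} (S : TaskFamily nx nu k H) {ι : Type*} [Fintype ι]
  (τ : ι → Fin (H + 1)) {N T : ℕ}

/-! ### Empirical covariances -/

/-- The empirical second moments of the states of the `g`-th task are comparable to the stationary
ones in all directions of `V`. -/
def CovarianceBounds (ξ : ι × Fin N → TrajNoise nx nu T) (g : ι)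
    (V : Submodule ℝ (EuclideanSpace ℝ (Fin nx))) : Prop :=
  ∀ v ∈ V, 4 / 25 * (N * T * quad (S.covX (τ g)) v)
      ≤ ∑ i : Fin N, ∑ t : Fin T, inner ℝ v (S.state (τ g) (ξ (g, i)) t) ^ 2 ∧
    ∑ i : Fin N, ∑ t : Fin T, inner ℝ v (S.state (τ g) (ξ (g, i)) t) ^ 2
      ≤ 9 / 4 * (N * T * quad (S.covX (τ g)) v)

theorem norm_sq_weight_singleRow [DecidableEq ι] (g : ι) (v : EuclideanSpace ℝ (Fin nx)) :
    ‖S.weight τ 1 (singleRow nx g v)‖ ^ 2 = quad (S.covX (τ g)) v := by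
  rw [norm_sq_weight, Finset.sum_eq_single g]
  · rw [singleRow_same, energy, Fin.sum_univ_one]
    rfl
  · intro g' _ hg
    rw [singleRow_ne _ hg, energy]
    refine Finset.sum_eq_zero fun a _ => ?_
    have : (WithLp.toLp 2 ((0 : Matrix (Fin 1) (Fin nx) ℝ) a) : EuclideanSpace ℝ (Fin nx)) = 0 := rfl
    rw [this, quad, inner_zero_left]
  · simp

theorem norm_sq_design_singleRow [DecidableEq ι] (ξ : ι × Fin N → TrajNoise nx nu T) (g : ι)
    (v : EuclideanSpace ℝ (Fin nx)) : ‖S.design τ 1 ξ (singleRow nx g v)‖ ^ 2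
      = ∑ i : Fin N, ∑ t : Fin T, inner ℝ v (S.state (τ g) (ξ (g, i)) t) ^ 2 := by
  rw [norm_sq_design, Fintype.sum_prod_type, Finset.sum_eq_single g]
  · refine Finset.sum_congr rfl fun i _ => Finset.sum_congr rfl fun t _ => ?_
    rw [singleRow_same, norm_sq_toEuclideanLin, Fin.sum_univ_one]
    rfl
  · intro g' _ hg
    simp [singleRow_ne _ hg]
  · simp

/-- The state covariance of one task concentrates on a subspace `V`: the design of one-row matrices
supported on that task is the list of the numbers `⟪v, x[t]⟫`. -/
theorem measure_not_covarianceBounds_le [Nonempty (Fin nx)] (g : ι)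
    (V : Submodule ℝ (EuclideanSpace ℝ (Fin nx))) {Λ : ℝ}
    (hΛ : ∀ g, S.corr (τ g) ≤ Λ) (hΛ0 : 0 < Λ) :
    S.batchLaw τ N T {ξ | ¬ S.CovarianceBounds τ ξ g V}
      ≤ ENNReal.ofReal (2 * 9 ^ Module.finrank ℝ V * Real.exp (-(N * T / (128 * Λ)))) := by
  classical
  refine (measure_mono ?_).trans
    ((S.measure_not_design_bounds_le τ (N := N) (T := T) (V.map (singleRow nx g)) hΛ hΛ0).trans ?_)
  · intro ξ hξ hcon
    refine hξ fun v hv => ?_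
    obtain ⟨h1, h2⟩ := hcon _ (Submodule.mem_map_of_mem hv)
    rw [← norm_sq_design_singleRow, ← norm_sq_weight_singleRow]
    have hsq : √((N : ℝ) * T) ^ 2 = N * T := Real.sq_sqrt (by positivity)
    constructor
    · calc 4 / 25 * (N * T * ‖S.weight τ 1 (singleRow nx g v)‖ ^ 2)
          = (2 / 5 * √(N * T) * ‖S.weight τ 1 (singleRow nx g v)‖) ^ 2 := by
            rw [mul_pow, mul_pow, hsq]; ring
        _ ≤ _ := by gcongr
    · calc ‖S.design τ 1 ξ (singleRow nx g v)‖ ^ 2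
          ≤ (3 / 2 * √(N * T) * ‖S.weight τ 1 (singleRow nx g v)‖) ^ 2 := by gcongr
        _ = _ := by rw [mul_pow, mul_pow, hsq]; ring
  · apply ENNReal.ofReal_le_ofReal
    gcongr
    · norm_num
    · exact Submodule.finrank_map_le _ _

theorem design_bounds_of_covarianceBounds {p : ℕ} {ξ : ι × Fin N → TrajNoise nx nu T}
    {V : ι → Submodule ℝ (EuclideanSpace ℝ (Fin nx))} (hV : ∀ g, S.CovarianceBounds τ ξ g (V g))
    {D : ι → Matrix (Fin p) (Fin nx) ℝ} (hD : ∀ g a, WithLp.toLp 2 (D g a) ∈ V g) :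
    2 / 5 * √(N * T) * ‖S.weight τ p D‖ ≤ ‖S.design τ p ξ D‖ ∧
      ‖S.design τ p ξ D‖ ≤ 3 / 2 * √(N * T) * ‖S.weight τ p D‖ := by
  have hsq : √((N : ℝ) * T) ^ 2 = N * T := Real.sq_sqrt (by positivity)
  have h1 : ‖S.design τ p ξ D‖ ^ 2 = ∑ g, ∑ a, ∑ i : Fin N, ∑ t : Fin T,
      inner ℝ (WithLp.toLp 2 (D g a)) (S.state (τ g) (ξ (g, i)) t) ^ 2 := by
    rw [norm_sq_design, Fintype.sum_prod_type]
    refine Finset.sum_congr rfl fun g _ => ?_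
    rw [Finset.sum_comm (s := (Finset.univ : Finset (Fin p)))]
    refine Finset.sum_congr rfl fun i _ => ?_
    rw [Finset.sum_comm (s := (Finset.univ : Finset (Fin p)))]
    exact Finset.sum_congr rfl fun t _ => norm_sq_toEuclideanLin _ _
  have h2 : ‖S.weight τ p D‖ ^ 2 = ∑ g, ∑ a, quad (S.covX (τ g)) (WithLp.toLp 2 (D g a)) :=
    S.norm_sq_weight τ p D
  constructor
  · refine abs_le_of_sq_le_sq' ?_ (norm_nonneg _) |>.2
    calc (2 / 5 * √(N * T) * ‖S.weight τ p D‖) ^ 2 = 4 / 25 * (N * T * ‖S.weight τ p D‖ ^ 2) := by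
          rw [mul_pow, mul_pow, hsq]; ring
      _ ≤ _ := by
        rw [h1, h2]
        simp_rw [Finset.mul_sum]
        exact Finset.sum_le_sum fun g _ => Finset.sum_le_sum fun a _ => (hV g _ (hD g a)).1
  · refine abs_le_of_sq_le_sq' ?_ (by positivity) |>.2
    calc ‖S.design τ p ξ D‖ ^ 2 ≤ 9 / 4 * (N * T * ‖S.weight τ p D‖ ^ 2) := by
          rw [h1, h2]
          simp_rw [Finset.mul_sum]
          exact Finset.sum_le_sum fun g _ => Finset.sum_le_sum fun a _ => (hV g _ (hD g a)).2
      _ = _ := by rw [mul_pow, mul_pow, hsq]; ring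

/-! ### Squared losses -/

/-- The total squared loss as a distance: the true weights leave the actuator noise as residual. -/
theorem sum_sqLoss_eq (ξ : ι × Fin N → TrajNoise nx nu T) (Φ : Matrix (Fin k) (Fin nx) ℝ)
    (F : ι → Matrix (Fin nu) (Fin k) ℝ) :
    ∑ g, sqLoss (fun i => S.trajectory (τ g) (ξ (g, i))) Φ (F g)
      = ‖S.design τ nu ξ (fun g => F g * Φ - S.K (τ g)) - actuator ξ‖ ^ 2 := by
  rw [PiLp.norm_sq_eq_of_L2, Fintype.sum_prod_type, Fintype.sum_prod_type]
  refine Finset.sum_congr rfl fun g _ => Finset.sum_congr rfl fun i _ =>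
    Finset.sum_congr rfl fun t _ => ?_
  congr 2
  change (F g).toEuclideanLin (Φ.toEuclideanLin (S.state (τ g) (ξ (g, i)) t))
      - ((S.K (τ g)).toEuclideanLin (S.state (τ g) (ξ (g, i)) t) + (ξ (g, i)).2.1 t)
    = (F g * Φ - S.K (τ g)).toEuclideanLin (S.state (τ g) (ξ (g, i)) t) - (ξ (g, i)).2.1 t
  rw [map_sub, LinearMap.sub_apply, Matrix.toLpLin_mul_same, LinearMap.comp_apply]
  abel

end TaskFamily

/-! ### Orthonormal frames and their discretization -/

/-- The rows of two `k × n` matrices lie in the row space of a `2k × n` matrix with orthonormal rows;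
`Ψᵀ Ψ` is the orthogonal projection onto that row space. -/
theorem exists_orthonormal_rows {k n : ℕ} (hkn : 2 * k ≤ n) (Φ Φ' : Matrix (Fin k) (Fin n) ℝ) :
    ∃ Ψ : Matrix (Fin (2 * k)) (Fin n) ℝ, Ψ * Ψᵀ = 1 ∧ Φ * (Ψᵀ * Ψ) = Φ ∧ Φ' * (Ψᵀ * Ψ) = Φ' := by
  classical
  let E := EuclideanSpace ℝ (Fin n)
  let r : Fin k ⊕ Fin k → E := Sum.elim (fun a => WithLp.toLp 2 (Φ a)) (fun a => WithLp.toLp 2 (Φ' a))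
  let U : Submodule ℝ E := Submodule.span ℝ (Set.range r)
  have hU : Module.finrank ℝ U ≤ 2 * k := by
    refine (finrank_range_le_card r).trans ?_
    simp [two_mul]
  let d := Module.finrank ℝ U
  let u := stdOrthonormalBasis ℝ U
  let v : Fin n → E := fun i => if h : (i : ℕ) < d then (u ⟨i, h⟩ : E) else 0
  have hv : Orthonormal ℝ (({i : Fin n | (i : ℕ) < d} : Set (Fin n)).domRestrict v) := by
    have h1 : Orthonormal ℝ fun j : Fin d => (u j : E) := u.orthonormal.comp_linearIsometry U.subtypeₗᵢ
    have h2 := h1.comp (fun i : ({i : Fin n | (i : ℕ) < d} : Set (Fin n)) => (⟨i.1, i.2⟩ : Fin d))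
      (fun i j hij => Subtype.ext (Fin.ext (by simpa using hij)))
    convert h2 using 1
    funext i
    exact dif_pos i.2
  obtain ⟨b, hb⟩ := hv.exists_orthonormalBasis_extension_of_card_eq (by
    rw [Fintype.card_fin]
    exact finrank_euclideanSpace_fin)
  let Ψ : Matrix (Fin (2 * k)) (Fin n) ℝ := fun a => (b (Fin.castLE hkn a)).ofLp
  have hproj : ∀ x : E, (Ψᵀ * Ψ).toEuclideanLin x
      = ∑ a, inner ℝ (b (Fin.castLE hkn a)) x • b (Fin.castLE hkn a) := by
    intro x
    rw [Matrix.toLpLin_mul_same, LinearMap.comp_apply, toEuclideanLin_transpose_eq_sum]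
    refine Finset.sum_congr rfl fun a _ => ?_
    congr 1
    rw [EuclideanSpace.inner_eq_star_dotProduct, dotProduct_comm]
    rfl
  have hfix : ∀ x ∈ U, (Ψᵀ * Ψ).toEuclideanLin x = x := by
    intro x hx
    have h1 : ∀ j : Fin d, (Ψᵀ * Ψ).toEuclideanLin (u j : E) = u j := by
      intro j
      have hj : (j : ℕ) < n := j.2.trans_le (hU.trans hkn)
      have h2 : b ⟨j, hj⟩ = (u j : E) := by
        rw [hb ⟨j, hj⟩ j.2]
        exact dif_pos j.2
      have h3 : Fin.castLE hkn ⟨j, j.2.trans_le hU⟩ = (⟨j, hj⟩ : Fin n) := rfl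
      rw [hproj, Finset.sum_eq_single ⟨j, j.2.trans_le hU⟩, h3, h2, real_inner_self_eq_norm_sq, ← h2,
        b.orthonormal.1, one_pow, one_smul]
      · intro a _ ha
        rw [← h2, b.orthonormal.2, zero_smul]
        intro h
        exact ha (Fin.ext (by simpa using congrArg Fin.val h))
      · simp
    have h4 := congrArg (Subtype.val) (u.sum_repr ⟨x, hx⟩)
    simp only [Submodule.coe_sum, Submodule.coe_smul] at h4
    rw [← h4, map_sum]
    exact Finset.sum_congr rfl fun j _ => by rw [map_smul, h1]
  have hrow : ∀ M : Matrix (Fin k) (Fin n) ℝ, (∀ a, WithLp.toLp 2 (M a) ∈ U) →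
      M * (Ψᵀ * Ψ) = M := by
    intro M hM
    funext a
    have h := row_mul M (Ψᵀ * Ψ) a
    rw [Matrix.transpose_mul, Matrix.transpose_transpose, hfix _ (hM a)] at h
    exact congrArg WithLp.ofLp h
  refine ⟨Ψ, ?_, hrow Φ fun a => Submodule.subset_span ⟨Sum.inl a, rfl⟩,
    hrow Φ' fun a => Submodule.subset_span ⟨Sum.inr a, rfl⟩⟩
  ext a a'
  have h := orthonormal_iff_ite.1 b.orthonormal (Fin.castLE hkn a) (Fin.castLE hkn a')
  rw [EuclideanSpace.inner_eq_star_dotProduct, dotProduct_comm] at h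
  simp only [star_trivial, (Fin.castLE_injective hkn).eq_iff] at h
  rw [Matrix.one_apply, ← h]
  rfl

/-- The point of the uniform grid of mesh `1 / m` in `[-1, 1]` with index `c`, entrywise. -/
noncomputable def gridMatrix {r n m : ℕ} (c : Fin r → Fin n → Fin (2 * m + 1)) : Matrix (Fin r) (Fin n) ℝ :=
  fun i j => ((c i j : ℕ) : ℝ) / m - 1

theorem exists_gridMatrix_near {r n m : ℕ} (hm : 0 < m) {Ψ : Matrix (Fin r) (Fin n) ℝ}
    (hΨ : Ψ * Ψᵀ = 1) : ∃ c : Fin r → Fin n → Fin (2 * m + 1),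
      energy 1 (Ψ - gridMatrix c) ≤ r * n / (m : ℝ) ^ 2 := by
  have hm' : (0 : ℝ) < m := by exact_mod_cast hm
  have habs : ∀ i j, |Ψ i j| ≤ 1 := by
    intro i j
    have h1 : ∑ j', Ψ i j' ^ 2 = 1 := by
      have := congrFun (congrFun hΨ i) i
      simpa [Matrix.mul_apply, sq] using this
    have h2 : Ψ i j ^ 2 ≤ 1 :=
      h1 ▸ Finset.single_le_sum (f := fun j' => Ψ i j' ^ 2) (fun _ _ => sq_nonneg _) (Finset.mem_univ j)
    exact (sq_le_one_iff_abs_le_one _).1 h2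
  have hfl : ∀ i j, ⌊(m : ℝ) * (Ψ i j + 1)⌋₊ < 2 * m + 1 := by
    intro i j
    refine Nat.lt_succ_of_le (Nat.floor_le_of_le ?_)
    have := (abs_le.1 (habs i j)).2
    push_cast
    nlinarith
  refine ⟨fun i j => ⟨_, hfl i j⟩, ?_⟩
  rw [energy_one]
  calc ∑ i, ∑ j, (Ψ - gridMatrix fun i j => ⟨_, hfl i j⟩) i j ^ 2
      ≤ ∑ _i : Fin r, ∑ _j : Fin n, (1 / (m : ℝ)) ^ 2 := by
        refine Finset.sum_le_sum fun i _ => Finset.sum_le_sum fun j _ => ?_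
        have h0 : 0 ≤ (m : ℝ) * (Ψ i j + 1) :=
          mul_nonneg hm'.le (by linarith [(abs_le.1 (habs i j)).1])
        have h1 := Nat.floor_le h0
        have h2 := Nat.lt_floor_add_one ((m : ℝ) * (Ψ i j + 1))
        have h3 : (Ψ - gridMatrix fun i j => ⟨_, hfl i j⟩) i j
            = ((m : ℝ) * (Ψ i j + 1) - ⌊(m : ℝ) * (Ψ i j + 1)⌋₊) / m := by
          simp only [Matrix.sub_apply, gridMatrix]
          field_simp
          ring
        rw [h3, div_pow, div_pow]
        gcongr
        linarith
    _ = r * n / (m : ℝ) ^ 2 := by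
        simp
        ring

/-! ### Least squares and sample sizes -/

/-- Right multiplication of every member of a family of matrices by `Ψ`. -/
noncomputable def mulRight (ι : Type*) (p : ℕ) {r n : ℕ} (Ψ : Matrix (Fin r) (Fin n) ℝ) :
    (ι → Matrix (Fin p) (Fin r) ℝ) →ₗ[ℝ] (ι → Matrix (Fin p) (Fin n) ℝ) where
  toFun G g := G g * Ψ
  map_add' G G' := funext fun g => Matrix.add_mul (G g) (G' g) Ψ
  map_smul' c G := funext fun g => Matrix.smul_mul c (G g) Ψ

theorem finrank_range_mulRight_le (ι : Type*) [Fintype ι] (p : ℕ) {r n : ℕ}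
    (Ψ : Matrix (Fin r) (Fin n) ℝ) :
    Module.finrank ℝ (LinearMap.range (mulRight ι p Ψ)) ≤ Fintype.card ι * (p * r) := by
  refine (LinearMap.finrank_range_le _).trans (le_of_eq ?_)
  rw [Module.finrank_pi_fintype]
  simp [Module.finrank_matrix]

/-- The confidence reached by nets of cardinality `9 ^ d`, since `2 · 9 / exp 5 ≤ 1 / 8`. -/
theorem two_mul_nine_pow_mul_exp_le {d : ℕ} (hd : 1 ≤ d) {x : ℝ} (hx : 1 ≤ x) :
    2 * 9 ^ d * Real.exp (-(5 * (d + Real.log x))) ≤ 1 / 8 * x⁻¹ := by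
  have hx0 : 0 < x := by linarith
  have he : (144 : ℝ) ≤ Real.exp 5 := by
    have h1 : Real.exp 5 = Real.exp 1 ^ 5 := by rw [← Real.exp_nat_mul]; norm_num
    have h2 := Real.exp_one_gt_d9
    rw [h1]
    calc (144 : ℝ) ≤ 2.71 ^ 5 := by norm_num
      _ ≤ Real.exp 1 ^ 5 := by gcongr; linarith
  have h3 : Real.exp (-(5 * (d + Real.log x))) = (Real.exp 5)⁻¹ ^ d * (x ^ 5)⁻¹ := by
    have h5 : (5 : ℝ) * Real.log x = Real.log (x ^ 5) := by
      rw [Real.log_pow]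
      norm_num
    rw [mul_add, neg_add, Real.exp_add, ← Real.exp_neg, ← Real.exp_nat_mul, h5,
      Real.exp_neg (Real.log _), Real.exp_log (by positivity)]
    congr 2
    ring
  have h4 : 9 ^ d * (Real.exp 5)⁻¹ ^ d ≤ 1 / 16 := by
    rw [← mul_pow]
    have h5 : 9 * (Real.exp 5)⁻¹ ≤ 1 / 16 := by
      rw [← div_eq_mul_inv, div_le_iff₀ (Real.exp_pos _)]
      linarith
    calc (9 * (Real.exp 5)⁻¹) ^ d ≤ (9 * (Real.exp 5)⁻¹) ^ 1 :=
          pow_le_pow_of_le_one (by positivity) (by linarith) hd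
      _ ≤ 1 / 16 := by simpa using h5
  have h6 : (x ^ 5)⁻¹ ≤ x⁻¹ := by
    apply inv_anti₀ hx0
    calc x = x ^ 1 := (pow_one x).symm
      _ ≤ x ^ 5 := pow_le_pow_right₀ hx (by norm_num)
  calc 2 * 9 ^ d * Real.exp (-(5 * (d + Real.log x)))
      = 2 * (9 ^ d * (Real.exp 5)⁻¹ ^ d) * (x ^ 5)⁻¹ := by rw [h3]; ring
    _ ≤ 2 * (1 / 16) * x⁻¹ := by gcongr
    _ = 1 / 8 * x⁻¹ := by ring

/-- The basic inequality of least squares: `x` is the deviation of the fitted from the true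
predictions, `z` the noise in the observations, and `x'` a
nearby element of the index set over which the process `⟪z, ·⟫` is controlled. -/
theorem basic_inequality {E : Type*} [NormedAddCommGroup E] [InnerProductSpace ℝ E] {x x' z : E}
    {a w w' e s : ℝ} (ha : 1 ≤ a) (hw : 0 ≤ w) (he : 0 ≤ e) (hs : 0 ≤ s) (hopt : ‖x - z‖ ^ 2 ≤ ‖z‖ ^ 2)
    (hx : 2 / 5 * a * w ≤ ‖x‖) (hx' : ‖x - x'‖ ≤ 3 / 2 * a * e) (hae : a * e ≤ w)
    (hww : w' ≤ w + e) (hz : ‖z‖ ≤ 3 * s * a) (hinner : inner ℝ z x' ≤ 3 * s * a * w') :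
    a * w ≤ 150 * s := by
  have h1 : ‖x‖ ^ 2 ≤ 2 * inner ℝ z x := by
    rw [norm_sub_sq_real, real_inner_comm] at hopt
    linarith
  have h2 : inner ℝ z x = inner ℝ z x' + inner ℝ z (x - x') := by rw [inner_sub_right]; ring
  have h3 : inner ℝ z (x - x') ≤ 3 * s * a * (3 / 2 * w) := by
    calc inner ℝ z (x - x') ≤ ‖z‖ * ‖x - x'‖ := real_inner_le_norm _ _
      _ ≤ 3 * s * a * (3 / 2 * a * e) := by gcongr
      _ = 3 * s * a * (3 / 2 * (a * e)) := by ring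
      _ ≤ _ := by gcongr
  have h4 : inner ℝ z x' ≤ 3 * s * a * (2 * w) := by
    refine hinner.trans ?_
    gcongr
    nlinarith
  have h5 : (2 / 5 * a * w) ^ 2 ≤ ‖x‖ ^ 2 := by gcongr
  have h6 : 0 ≤ a * w := by positivity
  by_contra hcon
  push Not at hcon
  nlinarith [mul_nonneg hs h6]

namespace TaskFamily

variable {nx nu k H : ℕ} (S : TaskFamily nx nu k H)

/-- A sample size `y` satisfying the burn-in condition with the constant `2000 ≥ 3 · 640` makes the
covariance concentrate at the rate `exp (-5 d)`, as `y / (128 · (y / (640 d))) = 5 d`. -/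
theorem corr_le_of_le [Nonempty (Fin nx)] {h : Fin (H + 1)} {d y : ℝ} (hd : 0 < d)
    (hy : 2000 * (stabilityConst (S.Acl h) ^ 2 * condNumber (S.covX h) * d) ≤ y) :
    S.corr h ≤ y / (640 * d) := by
  have hJ := one_le_stabilityConst (S.stable h)
  have hκ := one_le_condNumber (S.covX_posDef h)
  change 1 ≤ stabilityConst (S.Acl h) at hJ
  set J := stabilityConst (S.Acl h)
  set κ := condNumber (S.covX h)
  have h1 : S.corr h = 3 * (J * √κ) := rfl
  have h2 : √κ ≤ κ := Real.sqrt_le_iff.2 ⟨by linarith, by nlinarith⟩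
  have h3 : J * √κ ≤ J ^ 2 * κ := by
    have : J ≤ J ^ 2 := by nlinarith
    gcongr
  rw [le_div_iff₀ (by positivity), h1]
  have h4 : 0 ≤ J ^ 2 * κ * d := by positivity
  nlinarith [mul_le_mul_of_nonneg_right h3 hd.le]

theorem mul_le_sample_size [Nonempty (Fin nx)] {h : Fin (H + 1)} {d y : ℝ} (hd : 0 ≤ d)
    (hy : 2000 * (stabilityConst (S.Acl h) ^ 2 * condNumber (S.covX h) * d) ≤ y) : 2000 * d ≤ y := by
  have hJ : 1 ≤ stabilityConst (S.Acl h) := one_le_stabilityConst (S.stable h)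
  have h1 : 1 ≤ stabilityConst (S.Acl h) ^ 2 * condNumber (S.covX h) :=
    one_le_mul_of_one_le_of_one_le (one_le_pow₀ hJ) (one_le_condNumber (S.covX_posDef h))
  linarith [le_mul_of_one_le_left hd h1]

theorem lambdaUnderbar_pos [Nonempty (Fin nx)] [Nonempty (Fin H)] : 0 < S.lambdaUnderbar := by
  obtain ⟨h, hh⟩ := Finite.exists_min fun h : Fin H => lambdaMin (S.covX h.castSucc)
  exact (lambdaMin_pos (S.covX_posDef h.castSucc)).trans_le (le_ciInf hh)

theorem lambdaUnderbar_mul_le {p : ℕ} (h : Fin H) (M : Matrix (Fin p) (Fin nx) ℝ) :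
    S.lambdaUnderbar * energy 1 M ≤ energy (S.covX h.castSucc) M :=
  (mul_le_mul_of_nonneg_right (ciInf_le (Set.finite_range _).bddBelow h)
    (energy_nonneg Matrix.PosSemidef.one M)).trans
    (lambdaMin_le_energy (S.covX_posDef _).posSemidef M)

theorem energy_le_lambdaBar {p : ℕ} (h : Fin H) (M : Matrix (Fin p) (Fin nx) ℝ) :
    energy (S.covX h.castSucc) M ≤ S.lambdaBar * energy 1 M :=
  (energy_le_lambdaMax (S.covX_posDef _).posSemidef M).trans
    (mul_le_mul_of_nonneg_right (le_ciSup (f := fun h : Fin H => lambdaMax (S.covX h.castSucc)) (Set.finite_range _).bddAbove h)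
      (energy_nonneg Matrix.PosSemidef.one M))

theorem lambdaUnderbar_le_lambdaBar [Nonempty (Fin nx)] [Nonempty (Fin H)] :
    S.lambdaUnderbar ≤ S.lambdaBar := by
  obtain ⟨h⟩ := ‹Nonempty (Fin H)›
  exact (ciInf_le (Set.finite_range _).bddBelow h).trans
    ((lambdaMin_le_lambdaMax (S.covX_posDef h.castSucc).posSemidef).trans
      (le_ciSup (f := fun h : Fin H => lambdaMax (S.covX h.castSucc)) (Set.finite_range _).bddAbove h))

/-- Replacing an orthonormal frame by a matrix close to it changes the source predictions little. -/
theorem norm_weight_mul_sub_le [Nonempty (Fin nx)] [Nonempty (Fin H)] {p r : ℕ} {a ε : ℝ}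
    {Ψ Ψ' : Matrix (Fin r) (Fin nx) ℝ} (hΨ : Ψ * Ψᵀ = 1) (hε : energy 1 (Ψ - Ψ') ≤ ε)
    (ha : a ^ 2 * (S.lambdaBar / S.lambdaUnderbar * ε) ≤ 1) (G : Fin H → Matrix (Fin p) (Fin r) ℝ) :
    (a * ‖S.weight Fin.castSucc p (fun h => G h * (Ψ - Ψ'))‖) ^ 2
      ≤ ‖S.weight Fin.castSucc p (fun h => G h * Ψ)‖ ^ 2 := by
  have hl := S.lambdaUnderbar_pos
  have hlb : 0 < S.lambdaBar := hl.trans_le S.lambdaUnderbar_le_lambdaBar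
  have hG : ∀ h, 0 ≤ energy 1 (G h) := fun h => energy_nonneg Matrix.PosSemidef.one _
  rw [mul_pow, norm_sq_weight, norm_sq_weight]
  have h1 : ∀ h, energy (S.covX h.castSucc) (G h * (Ψ - Ψ')) ≤ S.lambdaBar * (ε * energy 1 (G h)) :=
    fun h => (S.energy_le_lambdaBar h _).trans
      (mul_le_mul_of_nonneg_left ((energy_one_mul_le _ _).trans
        (mul_le_mul_of_nonneg_right hε (hG h))) hlb.le)
  have h2 : ∀ h, S.lambdaUnderbar * energy 1 (G h) ≤ energy (S.covX h.castSucc) (G h * Ψ) :=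
    fun h => (energy_one_mul_of_orthonormal (G h) hΨ).symm ▸ S.lambdaUnderbar_mul_le h (G h * Ψ)
  calc a ^ 2 * ∑ h : Fin H, energy (S.covX h.castSucc) (G h * (Ψ - Ψ'))
      ≤ a ^ 2 * ∑ h : Fin H, S.lambdaBar * (ε * energy 1 (G h)) := by
        gcongr with h; exact h1 h
    _ = ∑ h, (a ^ 2 * (S.lambdaBar / S.lambdaUnderbar * ε)) * (S.lambdaUnderbar * energy 1 (G h)) := by
        rw [Finset.mul_sum]
        refine Finset.sum_congr rfl fun h _ => ?_
        field_simp
    _ ≤ ∑ h, 1 * (S.lambdaUnderbar * energy 1 (G h)) :=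
        Finset.sum_le_sum fun h _ =>
          mul_le_mul_of_nonneg_right ha (mul_nonneg hl.le (hG h))
    _ ≤ _ := by
        simp only [one_mul]
        exact Finset.sum_le_sum fun h _ => h2 h

/-- The noise process is controlled on the union, over all matrices `Ψ` of the grid, of the spaces of
families `(G g * Ψ)`. -/
theorem measure_inner_actuator_grid_gt_le {ι : Type*} [Fintype ι] (τ : ι → Fin (H + 1)) {N T : ℕ}
    (r m : ℕ) {l : ℝ} (hl : 0 < l) (hNT : (0 : ℝ) < N * T) :
    S.batchLaw τ N T {ξ | (∀ D, ‖S.design τ nu ξ D‖ ≤ 3 / 2 * √(N * T) * ‖S.weight τ nu D‖) ∧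
        ¬ ∀ (c : Fin r → Fin nx → Fin (2 * m + 1)) (G : ι → Matrix (Fin nu) (Fin r) ℝ),
          inner ℝ (actuator ξ) (S.design τ nu ξ fun g => G g * gridMatrix c)
            ≤ 3 * (S.sigmaZ * √l) * √(N * T) * ‖S.weight τ nu fun g => G g * gridMatrix c‖}
      ≤ ENNReal.ofReal (((2 * m + 1) ^ nx) ^ r * (9 ^ (Fintype.card ι * (nu * r)) * Real.exp (-l))) := by
  calc _ ≤ S.batchLaw τ N T (⋃ c : Fin r → Fin nx → Fin (2 * m + 1),
        {ξ | (∀ D ∈ LinearMap.range (mulRight ι nu (gridMatrix c)), ‖S.design τ nu ξ D‖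
            ≤ 3 / 2 * √(N * T) * ‖S.weight τ nu D‖) ∧
          ¬ ∀ D ∈ LinearMap.range (mulRight ι nu (gridMatrix c)),
            inner ℝ (actuator ξ) (S.design τ nu ξ D)
              ≤ 3 * (S.sigmaZ * √l) * √(N * T) * ‖S.weight τ nu D‖}) := by
        refine measure_mono fun ξ hξ => ?_
        obtain ⟨h1, h2⟩ := hξ
        push Not at h2
        obtain ⟨c, G, hG⟩ := h2
        refine Set.mem_iUnion.2 ⟨c, fun D _ => h1 D, fun hcon => ?_⟩
        exact (hcon _ ⟨G, rfl⟩).not_gt hG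
    _ ≤ ∑ _c : Fin r → Fin nx → Fin (2 * m + 1),
        ENNReal.ofReal (9 ^ (Fintype.card ι * (nu * r)) * Real.exp (-l)) := by
        refine (measure_iUnion_fintype_le _ _).trans (Finset.sum_le_sum fun c _ => ?_)
        refine (S.measure_inner_actuator_gt_le τ _ hl hNT).trans (ENNReal.ofReal_le_ofReal ?_)
        gcongr
        · norm_num
        · exact finrank_range_mulRight_le ι nu _
    _ = _ := by
        rw [Finset.sum_const, nsmul_eq_mul, ← ENNReal.ofReal_natCast,
          ← ENNReal.ofReal_mul (by positivity)]
        congr 2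
        simp

end TaskFamily

/-! ### The pretraining error -/

namespace TaskFamily

variable {nx nu k H : ℕ} (S : TaskFamily nx nu k H)

/-- On the event of the concentration bounds, a pretrained representation admits source heads of small
total population error. -/
theorem exists_source_heads_of_isPretrained [Nonempty (Fin nx)] [Nonempty (Fin H)] {N T m : ℕ}
    (hkn : 2 * k ≤ nx) {l : ℝ} (hl : 0 ≤ l) (hm : 0 < m) (hNT : (1 : ℝ) ≤ N * T)
    (hml : N * T * (S.lambdaBar / S.lambdaUnderbar) * nx ^ 2 ≤ m ^ 2) (hHl : (H : ℝ) * nu ≤ l)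
    {ξ : Fin H × Fin N → TrajNoise nx nu T}
    (hcov : ∀ D, 2 / 5 * √(N * T) * ‖S.weight Fin.castSucc nu D‖ ≤ ‖S.design Fin.castSucc nu ξ D‖ ∧
      ‖S.design Fin.castSucc nu ξ D‖ ≤ 3 / 2 * √(N * T) * ‖S.weight Fin.castSucc nu D‖)
    (hgrid : ∀ (c : Fin (2 * k) → Fin nx → Fin (2 * m + 1))
      (G : Fin H → Matrix (Fin nu) (Fin (2 * k)) ℝ),
        inner ℝ (actuator ξ) (S.design Fin.castSucc nu ξ fun h => G h * gridMatrix c)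
          ≤ 3 * (S.sigmaZ * √l) * √(N * T) * ‖S.weight Fin.castSucc nu fun h => G h * gridMatrix c‖)
    (hact : ‖actuator ξ‖ ^ 2 ≤ 4 * S.sigmaZ ^ 2 * (H * N * T * nu + l))
    {Φ : Matrix (Fin k) (Fin nx) ℝ}
    (hΦ : IsPretrained (fun (h : Fin H) (i : Fin N) => S.trajectory h.castSucc (ξ (h, i))) Φ) :
    ∃ F : Fin H → Matrix (Fin nu) (Fin k) ℝ,
      N * T * ∑ h, energy (S.covX h.castSucc) (F h * Φ - S.K h.castSucc)
        ≤ 22500 * (S.sigmaZ ^ 2 * l) := by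
  obtain ⟨F, hF⟩ := hΦ
  refine ⟨F, ?_⟩
  have hσ := S.sigmaZ_pos
  have hm' : (0 : ℝ) < m := by exact_mod_cast hm
  set a := √((N : ℝ) * T) with ha
  have ha2 : a ^ 2 = N * T := Real.sq_sqrt (by linarith)
  have ha1 : 1 ≤ a := Real.one_le_sqrt.2 hNT
  obtain ⟨Ψ, hΨ, hΦΨ, hΦs⟩ := exists_orthonormal_rows hkn Φ S.Φstar
  obtain ⟨c, hc⟩ := exists_gridMatrix_near hm hΨ
  let D : Fin H → Matrix (Fin nu) (Fin nx) ℝ := fun h => F h * Φ - S.K h.castSucc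
  let G : Fin H → Matrix (Fin nu) (Fin (2 * k)) ℝ := fun h => D h * Ψᵀ
  have hD : D = fun h => G h * Ψ := by
    funext h
    change F h * Φ - S.Fstar h.castSucc * S.Φstar
      = (F h * Φ - S.Fstar h.castSucc * S.Φstar) * Ψᵀ * Ψ
    rw [Matrix.mul_assoc, Matrix.sub_mul, Matrix.mul_assoc, Matrix.mul_assoc, hΦΨ, hΦs]
  let D' : Fin H → Matrix (Fin nu) (Fin nx) ℝ := fun h => G h * gridMatrix c
  have hDD' : D - D' = fun h => G h * (Ψ - gridMatrix c) := by
    funext h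
    rw [Pi.sub_apply, hD, Matrix.mul_sub]
  -- the comparison with the true weights, whose residual is the actuator noise
  have hopt : ‖S.design Fin.castSucc nu ξ D - actuator ξ‖ ^ 2 ≤ ‖actuator ξ‖ ^ 2 := by
    have h1 := hF S.Φstar fun h => S.Fstar h.castSucc
    rw [S.sum_sqLoss_eq Fin.castSucc ξ Φ F, S.sum_sqLoss_eq Fin.castSucc ξ S.Φstar] at h1
    have h2 : (fun h : Fin H => S.Fstar h.castSucc * S.Φstar - S.K h.castSucc) = 0 :=
      funext fun h => sub_self _
    rwa [h2, map_zero, zero_sub, norm_neg] at h1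
  -- in population norm, `D` is within a factor `1 / a` of a member of the grid family
  have hgap : a * ‖S.weight Fin.castSucc nu (D - D')‖ ≤ ‖S.weight Fin.castSucc nu D‖ := by
    refine abs_le_of_sq_le_sq' ?_ (norm_nonneg _) |>.2
    rw [hDD', hD]
    refine S.norm_weight_mul_sub_le hΨ hc ?_ G
    have hr : ((2 * k : ℕ) : ℝ) ≤ nx := by exact_mod_cast hkn
    rw [ha2, ← mul_assoc, ← mul_div_assoc, div_le_one (by positivity)]
    refine le_trans ?_ hml
    have hl0 := S.lambdaUnderbar_pos
    have hlb : 0 < S.lambdaBar := hl0.trans_le S.lambdaUnderbar_le_lambdaBar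
    rw [sq (nx : ℝ)]
    gcongr
  have hz : ‖actuator ξ‖ ≤ 3 * (S.sigmaZ * √l) * a := by
    refine abs_le_of_sq_le_sq' (hact.trans ?_) (by positivity) |>.2
    have h1 : (3 * (S.sigmaZ * √l) * a) ^ 2 = 9 * S.sigmaZ ^ 2 * (l * (N * T)) := by
      rw [mul_pow, mul_pow, mul_pow, Real.sq_sqrt hl, ha2]; ring
    have h2 : (H : ℝ) * N * T * nu ≤ l * (N * T) := by
      calc (H : ℝ) * N * T * nu = H * nu * (N * T) := by ring
        _ ≤ _ := by gcongr
    have h3 : l ≤ l * (N * T) := le_mul_of_one_le_right hl hNT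
    have h4 : 0 ≤ l * (N * T) := by positivity
    rw [h1]
    calc 4 * S.sigmaZ ^ 2 * (H * N * T * nu + l) ≤ 4 * S.sigmaZ ^ 2 * (l * (N * T) + l * (N * T)) := by
          gcongr
      _ ≤ _ := by nlinarith [mul_nonneg (sq_nonneg S.sigmaZ) h4]
  have hmain : a * ‖S.weight Fin.castSucc nu D‖ ≤ 150 * (S.sigmaZ * √l) := by
    refine basic_inequality (x := S.design Fin.castSucc nu ξ D) (x' := S.design Fin.castSucc nu ξ D')
      (z := actuator ξ) (e := ‖S.weight Fin.castSucc nu (D - D')‖) ha1 (norm_nonneg _) (norm_nonneg _)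
      (by positivity) hopt (hcov D).1 ?_ hgap ?_ hz (hgrid c G)
    · rw [← map_sub]
      exact (hcov _).2
    · have h : S.weight Fin.castSucc nu D'
          = S.weight Fin.castSucc nu D - S.weight Fin.castSucc nu (D - D') := by
        rw [map_sub]
        abel
      rw [h]
      exact norm_sub_le (S.weight Fin.castSucc nu D) (S.weight Fin.castSucc nu (D - D'))
  have h5 : (a * ‖S.weight Fin.castSucc nu D‖) ^ 2 ≤ (150 * (S.sigmaZ * √l)) ^ 2 := by gcongr
  rw [mul_pow, ha2, norm_sq_weight, mul_pow, mul_pow, Real.sq_sqrt hl] at h5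
  refine h5.trans (le_of_eq ?_)
  norm_num

/-- The logarithmic cardinalities entering the pretraining error: confidence level, nets of the source
heads, grid of representations. -/
noncomputable def sourceComplexity (N T : ℕ) (δ : ℝ) : ℝ :=
  Real.log (8 / δ) + 2 * (k * nu * H) * Real.log 9
    + 3 * (k * nx) * Real.log (N * T * (S.lambdaBar / S.lambdaUnderbar))

/-- With high probability every pretrained representation predicts all source tasks up to a total
population error of order `σ² · sourceComplexity / (N T)`. -/
theorem measure_source_error_gt_le [Nonempty (Fin nx)] [Nonempty (Fin H)] {N T : ℕ} (hk : 1 ≤ k)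
    (hkn : 2 * k ≤ nx) {δ : ℝ} (hδ : 0 < δ) (hδ1 : δ < 1)
    (hN : 2000 * (⨆ h : Fin H, stabilityConst (S.Acl h.castSucc) ^ 2 * condNumber (S.covX h.castSucc)
      * (nx + Real.log (H / δ))) ≤ (N : ℝ) * T) :
    S.batchLaw Fin.castSucc N T {ξ | ¬ ∀ Φ : Matrix (Fin k) (Fin nx) ℝ,
      IsPretrained (fun (h : Fin H) (i : Fin N) => S.trajectory h.castSucc (ξ (h, i))) Φ →
        ∃ F : Fin H → Matrix (Fin nu) (Fin k) ℝ,
          N * T * ∑ h, energy (S.covX h.castSucc) (F h * Φ - S.K h.castSucc)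
            ≤ 22500 * (S.sigmaZ ^ 2 * S.sourceComplexity N T δ)} ≤ ENNReal.ofReal (3 / 8 * δ) := by
  have hH1 : 1 ≤ H := Fin.pos_iff_nonempty.2 inferInstance
  have hH1' : (1 : ℝ) ≤ H := by exact_mod_cast hH1
  have hk' : (1 : ℝ) ≤ k := by exact_mod_cast hk
  have hnx : 1 ≤ nx := by omega
  have hnx' : (1 : ℝ) ≤ nx := by exact_mod_cast hnx
  have hHδ : 1 ≤ H / δ := by
    rw [le_div_iff₀ hδ]
    linarith
  have hlog : 0 ≤ Real.log (H / δ) := Real.log_nonneg hHδ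
  set d : ℝ := nx + Real.log (H / δ) with hd
  have hd0 : 0 < d := by linarith
  have hN' : ∀ h : Fin H, 2000 * (stabilityConst (S.Acl h.castSucc) ^ 2
      * condNumber (S.covX h.castSucc) * d) ≤ (N : ℝ) * T := fun h => by
    refine le_trans ?_ hN
    gcongr
    exact le_ciSup (f := fun h : Fin H => stabilityConst (S.Acl h.castSucc) ^ 2
      * condNumber (S.covX h.castSucc) * d) (Set.finite_range _).bddAbove h
  have hdN : 2000 * d ≤ (N : ℝ) * T := by
    obtain ⟨h⟩ := ‹Nonempty (Fin H)›
    exact S.mul_le_sample_size hd0.le (hN' h)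
  have hNT : (0 : ℝ) < N * T := by linarith
  set Λ : ℝ := N * T / (640 * d) with hΛ
  have hΛ0 : 0 < Λ := by positivity
  have hcorr : ∀ h : Fin H, S.corr h.castSucc ≤ Λ := fun h => S.corr_le_of_le hd0 (hN' h)
  -- a grid of mesh `1 / m` makes the discretization error negligible against the noise level
  set y : ℝ := N * T * (S.lambdaBar / S.lambdaUnderbar) with hy
  have hratio : 1 ≤ S.lambdaBar / S.lambdaUnderbar :=
    (one_le_div S.lambdaUnderbar_pos).2 S.lambdaUnderbar_le_lambdaBar
  have hyN : (N : ℝ) * T ≤ y := le_mul_of_one_le_right hNT.le hratio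
  have hynx : 2000 * (nx : ℝ) ≤ y := by linarith
  have hy0 : 0 < y := by linarith
  set m : ℕ := ⌈(nx : ℝ) * √y⌉₊ with hm
  have hsy : √y ^ 2 = y := Real.sq_sqrt hy0.le
  have hsy1 : 1 ≤ √y := Real.one_le_sqrt.2 (by linarith)
  have hmp : 0 < m := Nat.ceil_pos.2 (by positivity)
  have hm1 : (nx : ℝ) * √y ≤ m := Nat.le_ceil _
  have hm2 : (2 * m + 1 : ℝ) ^ 2 ≤ y ^ 3 := by
    have h1 : (m : ℝ) < nx * √y + 1 := Nat.ceil_lt_add_one (by positivity)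
    have h2 : 1 ≤ (nx : ℝ) * √y := one_le_mul_of_one_le_of_one_le hnx' hsy1
    calc (2 * m + 1 : ℝ) ^ 2 ≤ (5 * (nx * √y)) ^ 2 := by gcongr; linarith
      _ = 25 * nx ^ 2 * y := by rw [mul_pow, mul_pow, hsy]; ring
      _ ≤ y ^ 2 * y := by
        gcongr
        nlinarith
      _ = y ^ 3 := by ring
  have hmlog : 2 * Real.log (2 * m + 1) ≤ 3 * Real.log y := by
    have := Real.log_le_log (by positivity) hm2
    rwa [Real.log_pow, Real.log_pow] at this
  have hlogy : 0 ≤ Real.log y := Real.log_nonneg (by linarith)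
  set l := S.sourceComplexity N T δ with hl
  have hlog9 : 1 ≤ Real.log 9 := by
    rw [Real.le_log_iff_exp_le (by norm_num)]
    exact Real.exp_one_lt_d9.le.trans (by norm_num)
  have hlog8 : 0 < Real.log (8 / δ) := Real.log_pos (by rw [lt_div_iff₀ hδ]; linarith)
  have hl1 : Real.log (8 / δ) ≤ l := by
    have : 0 ≤ 2 * (k * nu * H) * Real.log 9 + 3 * (k * nx) * Real.log y := by positivity
    change _ ≤ Real.log (8 / δ) + _ + _
    linarith
  have hl0 : 0 < l := hlog8.trans_le hl1
  have hHl : (H : ℝ) * nu ≤ l := by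
    have h1 : (H : ℝ) * nu ≤ 2 * (k * nu * H) * Real.log 9 := by
      have h2 : (H : ℝ) * nu ≤ k * (nu * H) := by
        rw [mul_comm (H : ℝ)]
        exact le_mul_of_one_le_left (by positivity) hk'
      have h3 : (k : ℝ) * nu * H ≤ k * nu * H * Real.log 9 :=
        le_mul_of_one_le_right (by positivity) hlog9
      have h4 : 0 ≤ (k : ℝ) * nu * H := by positivity
      linarith
    have h5 : 0 ≤ 3 * (k * nx) * Real.log y := by positivity
    change _ ≤ Real.log (8 / δ) + _ + _
    linarith
  have hexp : Real.exp (-l) ≤ 1 / 8 * δ := by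
    calc Real.exp (-l) ≤ Real.exp (-Real.log (8 / δ)) := Real.exp_le_exp.2 (by linarith)
      _ = 1 / 8 * δ := by
        rw [Real.exp_neg, Real.exp_log (by positivity), inv_div]
        ring
  -- the three exceptional events
  have hcovE : S.batchLaw Fin.castSucc N T
      (⋃ h : Fin H, {ξ | ¬ S.CovarianceBounds Fin.castSucc ξ h ⊤}) ≤ ENNReal.ofReal (1 / 8 * δ) := by
    have hfr : Module.finrank ℝ (⊤ : Submodule ℝ (EuclideanSpace ℝ (Fin nx))) = nx := by
      rw [finrank_top, finrank_euclideanSpace_fin]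
    have harg : (N : ℝ) * T / (128 * Λ) = 5 * d := by
      rw [div_eq_iff (by positivity), hΛ]
      field_simp
      ring
    calc _ ≤ ∑ _h : Fin H, ENNReal.ofReal (1 / 8 * (H / δ)⁻¹) := by
          refine (measure_iUnion_fintype_le _ _).trans (Finset.sum_le_sum fun h _ => ?_)
          refine (S.measure_not_covarianceBounds_le Fin.castSucc h ⊤ hcorr hΛ0).trans
            (ENNReal.ofReal_le_ofReal ?_)
          rw [hfr, harg]
          exact two_mul_nine_pow_mul_exp_le hnx hHδ
      _ = ENNReal.ofReal (1 / 8 * δ) := by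
          rw [Finset.sum_const, nsmul_eq_mul, ← ENNReal.ofReal_natCast,
            ← ENNReal.ofReal_mul (by positivity)]
          congr 1
          simp only [Finset.card_univ, Fintype.card_fin]
          field_simp
  have hgridE := (S.measure_inner_actuator_grid_gt_le Fin.castSucc (N := N) (T := T) (2 * k) m hl0
    hNT).trans (ENNReal.ofReal_le_ofReal (q := 1 / 8 * δ) (by
      have h1 : ((2 * m + 1 : ℝ) ^ nx) ^ (2 * k) = Real.exp (k * nx * (2 * Real.log (2 * m + 1))) := by
        rw [← pow_mul, ← Real.exp_log (show (0 : ℝ) < 2 * m + 1 by positivity), ← Real.exp_nat_mul,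
          Real.exp_log (by positivity)]
        congr 1
        push_cast
        ring
      have h2 : (9 : ℝ) ^ (Fintype.card (Fin H) * (nu * (2 * k)))
          = Real.exp (2 * (k * nu * H) * Real.log 9) := by
        rw [Fintype.card_fin, mul_comm _ (Real.log 9), Real.exp_mul, Real.exp_log (by norm_num),
          ← Real.rpow_natCast]
        congr 1
        push_cast
        ring
      rw [h1, h2, ← Real.exp_add, ← Real.exp_add]
      calc _ ≤ Real.exp (-Real.log (8 / δ)) := Real.exp_le_exp.2 (by
            have h3 : (k : ℝ) * nx * (2 * Real.log (2 * m + 1)) ≤ k * nx * (3 * Real.log y) := by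
              gcongr
            have h4 : l = Real.log (8 / δ) + 2 * (k * nu * H) * Real.log 9
              + 3 * (k * nx) * Real.log y := rfl
            rw [h4]
            linarith)
        _ = 1 / 8 * δ := by
          rw [Real.exp_neg, Real.exp_log (by positivity), inv_div]
          ring))
  have hactE := (S.measure_actuator_ge_le (Fin.castSucc : Fin H → Fin (H + 1)) (N := N) (T := T)
    l).trans (ENNReal.ofReal_le_ofReal hexp)
  rw [Fintype.card_fin] at hactE
  refine (measure_mono ?_).trans ((measure_union_le _ _).trans ((add_le_add
    ((measure_union_le _ _).trans (add_le_add hcovE hgridE)) hactE).trans (le_of_eq ?_)))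
  · intro ξ hξ
    by_contra hcon
    simp only [Set.mem_union, Set.mem_iUnion, Set.mem_ofPred_eq, not_or, not_exists, not_not,
      not_le] at hcon
    obtain ⟨⟨h1, h2⟩, h3⟩ := hcon
    have hcov := fun D => S.design_bounds_of_covarianceBounds Fin.castSucc (p := nu) (D := D) h1
      fun _ _ => Submodule.mem_top
    refine hξ fun Φ hΦ => S.exists_source_heads_of_isPretrained hkn hl0.le hmp (by linarith) ?_ hHl hcov
      (by_contra fun h => h2 ⟨fun D => (hcov D).2, h⟩) h3.le hΦ
    calc N * T * (S.lambdaBar / S.lambdaUnderbar) * nx ^ 2 = (nx * √y) ^ 2 := by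
          rw [mul_pow, hsy, hy]; ring
      _ ≤ _ := by gcongr
  · rw [← ENNReal.ofReal_add (by positivity) (by positivity),
      ← ENNReal.ofReal_add (by positivity) (by positivity)]
    congr 1
    ring

end TaskFamily

/-- The basic inequality of least squares under misspecification: `x` is the deviation of the fit from a
comparator, whose predictions are off by `y`, and `z` is the noise in the observations. -/
theorem basic_inequality_misspecified {E : Type*} [NormedAddCommGroup E] [InnerProductSpace ℝ E]
    {x y z : E} {b w s ρ : ℝ} (hbw : 0 ≤ b * w) (hρ : 0 ≤ b ^ 2 * ρ)
    (hopt : ‖x + y - z‖ ^ 2 ≤ ‖y - z‖ ^ 2) (hx : 2 / 5 * b * w ≤ ‖x‖) (hx' : ‖x‖ ≤ 3 / 2 * b * w)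
    (hy : ‖y‖ ^ 2 ≤ 5 / 4 * (b ^ 2 * ρ)) (hinner : inner ℝ z x ≤ 3 * s * b * w) :
    (b * w) ^ 2 ≤ 2813 * s ^ 2 + 879 * (b ^ 2 * ρ) := by
  have h1 : ‖x‖ ^ 2 ≤ 2 * inner ℝ z x - 2 * inner ℝ x y := by
    have h : x + y - z = x + (y - z) := by abel
    rw [h, norm_add_sq_real, inner_sub_right, real_inner_comm z x] at hopt
    linarith
  have h2 : -inner ℝ x y ≤ ‖x‖ * ‖y‖ := (neg_le_abs _).trans (abs_real_inner_le_norm x y)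
  have h3 : ‖x‖ * ‖y‖ ≤ 3 / 2 * b * w * ‖y‖ := by gcongr
  have h4 : (2 / 5 * b * w) ^ 2 ≤ ‖x‖ ^ 2 := by
    have : 0 ≤ 2 / 5 * b * w := by linarith
    gcongr
  rcases hbw.eq_or_lt with h0 | h0
  · rw [← h0]
    nlinarith [sq_nonneg s]
  have h5 : b * w ≤ 75 / 2 * s + 75 / 4 * ‖y‖ := by
    by_contra hcon
    push Not at hcon
    nlinarith
  have h6 : (b * w) ^ 2 ≤ (75 / 2 * s + 75 / 4 * ‖y‖) ^ 2 := by gcongr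
  nlinarith [sq_nonneg (75 / 2 * s - 75 / 4 * ‖y‖), sq_nonneg s]

namespace TaskFamily

variable {nx nu k H : ℕ} (S : TaskFamily nx nu k H)

/-! ### Transfer from the sources to the target -/

/-- The relative covariance of a source task with respect to the target task. -/
noncomputable def relativeCov (h : Fin H) : Matrix (Fin nx) (Fin nx) ℝ :=
  (CFC.sqrt (S.covX (Fin.last H)))⁻¹ * S.covX h.castSucc * (CFC.sqrt (S.covX (Fin.last H)))⁻¹

theorem isUnit_sqrt_covX (h : Fin (H + 1)) : IsUnit (CFC.sqrt (S.covX h)).det := by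
  have h1 : (S.covX h).det ≠ 0 := (S.covX_posDef h).det_pos.ne'
  rw [← CFC.sqrt_mul_sqrt_self (S.covX h) (S.covX_posDef h).posSemidef.nonneg, Matrix.det_mul] at h1
  exact (left_ne_zero_of_mul h1).isUnit

theorem quad_relativeCov (h : Fin H) (v : EuclideanSpace ℝ (Fin nx)) :
    quad (S.relativeCov h) v
      = quad (S.covX h.castSucc) ((CFC.sqrt (S.covX (Fin.last H)))⁻¹.toEuclideanLin v) := by
  rw [quad, relativeCov, Matrix.toLpLin_mul_same, Matrix.toLpLin_mul_same, LinearMap.comp_apply,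
    LinearMap.comp_apply, inner_toEuclideanLin_right, Matrix.transpose_nonsing_inv, transpose_sqrt,
    quad]

theorem toEuclideanLin_inv_sqrt_sqrt (h : Fin (H + 1)) (v : EuclideanSpace ℝ (Fin nx)) :
    (CFC.sqrt (S.covX h))⁻¹.toEuclideanLin ((CFC.sqrt (S.covX h)).toEuclideanLin v) = v ∧
    (CFC.sqrt (S.covX h)).toEuclideanLin ((CFC.sqrt (S.covX h))⁻¹.toEuclideanLin v) = v := by
  simp only [← LinearMap.comp_apply, ← Matrix.toLpLin_mul_same]
  rw [Matrix.nonsing_inv_mul _ (S.isUnit_sqrt_covX h), Matrix.mul_nonsing_inv _ (S.isUnit_sqrt_covX h)]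
  simp

theorem relativeCov_posDef (h : Fin H) : (S.relativeCov h).PosDef := by
  refine posDef_iff_quad.2 ⟨?_, fun v hv => ?_⟩
  · rw [relativeCov, Matrix.transpose_mul, Matrix.transpose_mul, Matrix.transpose_nonsing_inv,
      transpose_sqrt, (posDef_iff_quad.1 (S.covX_posDef h.castSucc)).1, Matrix.mul_assoc]
  · rw [quad_relativeCov]
    refine (posDef_iff_quad.1 (S.covX_posDef _)).2 _ fun h0 => hv ?_
    rw [← (S.toEuclideanLin_inv_sqrt_sqrt (Fin.last H) v).2, h0, map_zero]

theorem coverage_pos [Nonempty (Fin nx)] [Nonempty (Fin H)] : 0 < S.coverage := by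
  obtain ⟨h, hh⟩ := Finite.exists_min fun h : Fin H => lambdaMin (S.relativeCov h)
  exact (lambdaMin_pos (S.relativeCov_posDef h)).trans_le (le_ciInf hh)

/-- The coverage constant compares the target with the source covariances. -/
theorem coverage_mul_quad_le (h : Fin H) (v : EuclideanSpace ℝ (Fin nx)) :
    S.coverage * quad (S.covX (Fin.last H)) v ≤ quad (S.covX h.castSucc) v := by
  have h1 := lambdaMin_le_quad (S.relativeCov_posDef h).posSemidef
    ((CFC.sqrt (S.covX (Fin.last H))).toEuclideanLin v)
  rw [quad_relativeCov, (S.toEuclideanLin_inv_sqrt_sqrt (Fin.last H) v).1,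
    norm_sqrt_sq (S.covX_posDef _).posSemidef] at h1
  exact (mul_le_mul_of_nonneg_right (ciInf_le (Set.finite_range _).bddBelow h)
    (quad_nonneg (S.covX_posDef _).posSemidef v)).trans h1

/-- The pseudo-inverse of the stacked source weights recombines the source heads into the target
head. -/
theorem mul_pinv_mul_stackedWeights (hS : S.SourcesSpanTarget) :
    S.Fstar (Fin.last H) * pinv S.stackedWeights * S.stackedWeights = S.Fstar (Fin.last H) := by
  have h1 : ∀ v : Fin k → ℝ, S.Fstar (Fin.last H) *ᵥ (v - (pinv S.stackedWeights * S.stackedWeights) *ᵥ v)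
      = 0 := fun v => hS _ (by
    rw [Matrix.mulVec_sub, Matrix.mulVec_mulVec, ← Matrix.mul_assoc, (pinv_penrose S.stackedWeights).1,
      sub_self])
  rw [Matrix.mul_assoc]
  refine Matrix.ext_of_mulVec_single fun j => ?_
  have h2 := h1 (Pi.single j 1)
  rw [Matrix.mulVec_sub, Matrix.mulVec_mulVec, sub_eq_zero] at h2
  exact h2.symm

/-- Recombining the source heads like the true source weights gives a target head whose error is a linear
image of the stacked source errors. -/
theorem exists_target_head (hS : S.SourcesSpanTarget) (Φ : Matrix (Fin k) (Fin nx) ℝ)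
    (F : Fin H → Matrix (Fin nu) (Fin k) ℝ) (hc : 0 ≤ S.coverage) : ∃ F₀ : Matrix (Fin nu) (Fin k) ℝ,
      S.coverage * energy (S.covX (Fin.last H)) (F₀ * Φ - S.K (Fin.last H))
        ≤ ‖S.Fstar (Fin.last H) * pinv S.stackedWeights‖ ^ 2
          * ∑ h, energy (S.covX h.castSucc) (F h * Φ - S.K h.castSucc) := by
  let P := S.Fstar (Fin.last H) * pinv S.stackedWeights
  let Fs : Matrix (Fin H × Fin nu) (Fin k) ℝ := fun p j => F p.1 p.2 j
  let D : Matrix (Fin H × Fin nu) (Fin nx) ℝ := Fs * Φ - S.stackedWeights * S.Φstar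
  refine ⟨P * Fs, ?_⟩
  have h1 : P * Fs * Φ - S.K (Fin.last H) = P * D := by
    rw [Matrix.mul_sub, ← Matrix.mul_assoc, ← Matrix.mul_assoc, S.mul_pinv_mul_stackedWeights hS]
    rfl
  have h2 : S.coverage * energy (S.covX (Fin.last H)) D
      ≤ ∑ h, energy (S.covX h.castSucc) (F h * Φ - S.K h.castSucc) := by
    rw [energy, Fintype.sum_prod_type, Finset.mul_sum]
    refine Finset.sum_le_sum fun h _ => ?_
    rw [Finset.mul_sum]
    exact Finset.sum_le_sum fun a _ => S.coverage_mul_quad_le h _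
  rw [h1]
  calc S.coverage * energy (S.covX (Fin.last H)) (P * D)
      ≤ S.coverage * (‖P‖ ^ 2 * energy (S.covX (Fin.last H)) D) := by
        gcongr
        exact energy_mul_le_opNorm (S.covX_posDef _).posSemidef P D
    _ = ‖P‖ ^ 2 * (S.coverage * energy (S.covX (Fin.last H)) D) := by ring
    _ ≤ _ := by gcongr

end TaskFamily

namespace TaskFamily

variable {nx nu k H : ℕ} (S : TaskFamily nx nu k H)

/-! ### The target task -/

/-- The assignment of tasks to a batch of target trajectories. -/
abbrev targetTask (H : ℕ) : Unit → Fin (H + 1) := fun _ => Fin.last H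

/-- The event on which fine-tuning on top of `Φ` succeeds: in the row space of `Φ` the target data have
the right covariance and a small correlation with the actuator noise, and some head has a small
population and empirical bias. With strict inequalities this last condition is open in `Φ`. -/
def FineTuningEvent {N T : ℕ} (l ρ : ℝ) (Φ : Matrix (Fin k) (Fin nx) ℝ)
    (ξ : Unit × Fin N → TrajNoise nx nu T) : Prop :=
  S.CovarianceBounds (targetTask H) ξ () (LinearMap.range Φᵀ.toEuclideanLin) ∧
  (∀ G : Unit → Matrix (Fin nu) (Fin k) ℝ,
    inner ℝ (actuator ξ) (S.design (targetTask H) nu ξ fun g => G g * Φ)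
      ≤ 3 * (S.sigmaZ * √l) * √(N * T) * ‖S.weight (targetTask H) nu fun g => G g * Φ‖) ∧
  ∃ F₀ : Matrix (Fin nu) (Fin k) ℝ, energy (S.covX (Fin.last H)) (F₀ * Φ - S.K (Fin.last H)) < ρ ∧
    ‖S.design (targetTask H) nu ξ fun _ => F₀ * Φ - S.K (Fin.last H)‖ ^ 2 < 5 / 4 * (N * T * ρ)

/-- The logarithmic cardinalities entering the fine-tuning error. -/
noncomputable def targetComplexity (k nu : ℕ) (δ : ℝ) : ℝ :=
  Real.log (8 / δ) + k * nu * Real.log 9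

theorem targetComplexity_pos (k nu : ℕ) {δ : ℝ} (hδ : 0 < δ) (hδ1 : δ < 1) :
    0 < targetComplexity k nu δ :=
  add_pos_of_pos_of_nonneg (Real.log_pos (by rw [lt_div_iff₀ hδ]; linarith))
    (mul_nonneg (by positivity) (Real.log_nonneg (by norm_num)))

theorem norm_sq_weight_unit {p : ℕ} (D : Unit → Matrix (Fin p) (Fin nx) ℝ) :
    ‖S.weight (targetTask H) p D‖ ^ 2 = energy (S.covX (Fin.last H)) (D ()) := by
  rw [norm_sq_weight, Fintype.sum_unique]

theorem row_mem_range_transpose {n : ℕ} (F : Matrix (Fin nu) (Fin k) ℝ) (Φ : Matrix (Fin k) (Fin n) ℝ)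
    (a : Fin nu) : (WithLp.toLp 2 ((F * Φ) a) : EuclideanSpace ℝ (Fin n))
      ∈ LinearMap.range Φᵀ.toEuclideanLin := by
  rw [row_mul]
  exact LinearMap.mem_range_self _ _

theorem measure_not_fineTuningEvent_le [Nonempty (Fin nx)] {N T : ℕ} (hk : 1 ≤ k) {δ ρ : ℝ} (hδ : 0 < δ)
    (hδ1 : δ < 1) (hρ : 0 < ρ)
    (hN : 2000 * (stabilityConst (S.Acl (Fin.last H)) ^ 2 * condNumber (S.covX (Fin.last H))
      * (k + Real.log (1 / δ))) ≤ (N : ℝ) * T) {Φ : Matrix (Fin k) (Fin nx) ℝ}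
    (hΦ : ∃ F₀ : Matrix (Fin nu) (Fin k) ℝ,
      energy (S.covX (Fin.last H)) (F₀ * Φ - S.K (Fin.last H)) < ρ) :
    S.batchLaw (targetTask H) N T {ξ | ¬ S.FineTuningEvent (targetComplexity k nu δ) ρ Φ ξ}
      ≤ ENNReal.ofReal (3 / 8 * δ) := by
  obtain ⟨F₀, hF₀⟩ := hΦ
  have hk' : (1 : ℝ) ≤ k := by exact_mod_cast hk
  have h1δ : 1 ≤ 1 / δ := by
    rw [le_div_iff₀ hδ]
    linarith
  have hlog : 0 ≤ Real.log (1 / δ) := Real.log_nonneg h1δ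
  set d : ℝ := k + Real.log (1 / δ) with hd
  have hd0 : 0 < d := by linarith
  have hNT : (0 : ℝ) < N * T := by
    linarith [S.mul_le_sample_size hd0.le hN]
  set Λ : ℝ := N * T / (640 * d) with hΛ
  have hΛ0 : 0 < Λ := by positivity
  have hcorr : ∀ g, S.corr (targetTask H g) ≤ Λ := fun _ => S.corr_le_of_le hd0 hN
  set l := targetComplexity k nu δ with hl
  have hl0 : 0 < l := targetComplexity_pos k nu hδ hδ1
  have harg : (N : ℝ) * T / (128 * Λ) = 5 * d := by
    rw [div_eq_iff (by positivity), hΛ]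
    field_simp
    ring
  have hexp := two_mul_nine_pow_mul_exp_le hk h1δ
  rw [inv_div, div_one] at hexp
  have hcovE : S.batchLaw (targetTask H) N T
      {ξ | ¬ S.CovarianceBounds (targetTask H) ξ () (LinearMap.range Φᵀ.toEuclideanLin)}
        ≤ ENNReal.ofReal (1 / 8 * δ) := by
    refine (S.measure_not_covarianceBounds_le (targetTask H) () _ hcorr hΛ0).trans
      (ENNReal.ofReal_le_ofReal (le_trans ?_ hexp))
    rw [harg]
    gcongr
    · norm_num
    · exact (LinearMap.finrank_range_le _).trans (by rw [finrank_euclideanSpace_fin])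
  have hinE := (S.measure_inner_actuator_gt_le (targetTask H) (N := N) (T := T)
    (LinearMap.range (mulRight Unit nu Φ)) hl0 hNT).trans
      (ENNReal.ofReal_le_ofReal (q := 1 / 8 * δ) (by
        have h2 : (9 : ℝ) ^ (k * nu) = Real.exp (k * nu * Real.log 9) := by
          rw [mul_comm _ (Real.log 9), Real.exp_mul, Real.exp_log (by norm_num), ← Real.rpow_natCast]
          push_cast
          rfl
        calc (9 : ℝ) ^ Module.finrank ℝ (LinearMap.range (mulRight Unit nu Φ)) * Real.exp (-l)
            ≤ 9 ^ (k * nu) * Real.exp (-l) := by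
              gcongr
              · norm_num
              · refine (finrank_range_mulRight_le Unit nu Φ).trans (le_of_eq ?_)
                rw [Fintype.card_unit, one_mul, mul_comm]
          _ = Real.exp (-Real.log (8 / δ)) := by
              rw [h2, ← Real.exp_add]
              congr 1
              rw [hl, targetComplexity]
              ring
          _ = 1 / 8 * δ := by
              rw [Real.exp_neg, Real.exp_log (by positivity), inv_div]
              ring))
  have hdesE := (S.measure_design_ge_le (targetTask H) (N := N) (T := T)
    (fun _ => F₀ * Φ - S.K (Fin.last H)) hcorr hΛ0 hρ
    (by rw [norm_sq_weight_unit]; exact hF₀.le)).trans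
      (ENNReal.ofReal_le_ofReal (q := 1 / 8 * δ) (by
        refine le_trans ?_ hexp
        rw [harg]
        refine le_mul_of_one_le_left (Real.exp_pos _).le ?_
        have := one_le_pow₀ (n := k) (show (1 : ℝ) ≤ 9 by norm_num)
        linarith))
  refine (measure_mono ?_).trans ((measure_union_le _ _).trans ((add_le_add
    ((measure_union_le _ _).trans (add_le_add hcovE hinE)) hdesE).trans (le_of_eq ?_)))
  · intro ξ hξ
    by_contra hcon
    simp only [Set.mem_union, Set.mem_ofPred_eq, not_or, not_not, not_le] at hcon
    obtain ⟨⟨h1, h2⟩, h3⟩ := hcon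
    refine hξ ⟨h1, fun G => ?_, F₀, hF₀, h3⟩
    by_contra h4
    refine h2 ⟨fun D hD => ?_, fun h5 => h4 (h5 _ ⟨G, rfl⟩)⟩
    obtain ⟨G', rfl⟩ := hD
    exact (S.design_bounds_of_covarianceBounds (targetTask H) (fun _ => h1)
      fun g a => row_mem_range_transpose (G' g) Φ a).2
  · rw [← ENNReal.ofReal_add (by positivity) (by positivity),
      ← ENNReal.ofReal_add (by positivity) (by positivity)]
    congr 1
    ring

/-- On the event `FineTuningEvent`, fine-tuning on top of `Φ` has small excess risk. -/
theorem excessRisk_le_of_fineTuningEvent {N T : ℕ} {l ρ : ℝ} (hl : 0 ≤ l) (hNT : (0 : ℝ) < N * T)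
    {Φ : Matrix (Fin k) (Fin nx) ℝ} {F : Matrix (Fin nu) (Fin k) ℝ}
    {ξ : Unit × Fin N → TrajNoise nx nu T} (h : S.FineTuningEvent l ρ Φ ξ)
    (hF : IsFineTuned (fun i : Fin N => S.trajectory (Fin.last H) (ξ ((), i))) Φ F) :
    S.excessRisk T Φ F ≤ 2813 * (S.sigmaZ ^ 2 * l / (N * T)) + 880 * ρ := by
  obtain ⟨hcov, hin, F₀, hF₀, hdes⟩ := h
  have hT : T ≠ 0 := by
    rintro rfl
    simp at hNT
  set b := √((N : ℝ) * T) with hb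
  have hb2 : b ^ 2 = N * T := Real.sq_sqrt hNT.le
  have hρ : 0 ≤ ρ := (energy_nonneg (S.covX_posDef _).posSemidef _).trans hF₀.le
  let X := S.design (targetTask H) nu ξ
  let Y : Unit → Matrix (Fin nu) (Fin nx) ℝ := fun _ => F₀ * Φ - S.K (Fin.last H)
  let E : Unit → Matrix (Fin nu) (Fin nx) ℝ := fun _ => (F - F₀) * Φ
  have hEY : E + Y = fun _ => F * Φ - S.K (Fin.last H) := by
    funext _
    change (F - F₀) * Φ + (F₀ * Φ - S.K (Fin.last H)) = _
    rw [Matrix.sub_mul]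
    abel
  have hopt : ‖X E + X Y - actuator ξ‖ ^ 2 ≤ ‖X Y - actuator ξ‖ ^ 2 := by
    rw [← map_add, hEY]
    have h1 := S.sum_sqLoss_eq (targetTask H) ξ Φ fun _ => F
    have h2 := S.sum_sqLoss_eq (targetTask H) ξ Φ fun _ => F₀
    rw [Fintype.sum_unique] at h1 h2
    exact h1.symm.trans_le ((hF F₀).trans_eq h2)
  obtain ⟨hlow, hup⟩ := S.design_bounds_of_covarianceBounds (targetTask H) (D := E) (fun _ => hcov)
    fun _ a => row_mem_range_transpose (F - F₀) Φ a
  have hmain := basic_inequality_misspecified (b := b) (w := ‖S.weight (targetTask H) nu E‖)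
    (s := S.sigmaZ * √l) (ρ := ρ) (by positivity) (by positivity) hopt hlow hup
    (by rw [hb2]; exact hdes.le) (hin fun _ => F - F₀)
  rw [mul_pow, hb2, norm_sq_weight_unit, mul_pow, Real.sq_sqrt hl] at hmain
  have hE : energy (S.covX (Fin.last H)) (E ())
      ≤ 2813 * (S.sigmaZ ^ 2 * l / (N * T)) + 879 * ρ := by
    refine le_of_mul_le_mul_left (hmain.trans (le_of_eq ?_)) hNT
    rw [mul_add, mul_left_comm _ (2813 : ℝ), mul_div_cancel₀ _ hNT.ne']
    ring
  rw [S.excessRisk_eq hT]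
  have h3 : S.K (Fin.last H) - F * Φ = -(E () + Y ()) := by
    have := congrFun hEY ()
    rw [Pi.add_apply] at this
    rw [this]
    abel
  rw [h3, energy_neg]
  have h4 := energy_add_le (S.covX_posDef (Fin.last H)).posSemidef (E ()) (Y ())
  have h5 : energy (S.covX (Fin.last H)) (Y ()) < ρ := hF₀
  linarith

/-! ### Measurability of the fine-tuning event -/

theorem continuous_toEuclideanLin_apply {m n : ℕ} :
    Continuous fun p : (Fin m → Fin n → ℝ) × EuclideanSpace ℝ (Fin n) =>
      (Matrix.of p.1).toEuclideanLin p.2 := by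
  refine (PiLp.continuous_toLp 2 _).comp (continuous_pi fun i => ?_)
  change Continuous fun p : (Fin m → Fin n → ℝ) × EuclideanSpace ℝ (Fin n) => ∑ j, p.1 i j * p.2 j
  fun_prop

theorem continuous_mul_of {l m n : ℕ} (G : Matrix (Fin l) (Fin m) ℝ) :
    Continuous fun Φ : Fin m → Fin n → ℝ => (G * Matrix.of Φ : Matrix (Fin l) (Fin n) ℝ) := by
  refine continuous_pi fun i => continuous_pi fun j => ?_
  simp only [Matrix.mul_apply, Matrix.of_apply]
  fun_prop

theorem continuous_transpose_toEuclideanLin {m n : ℕ} (w : EuclideanSpace ℝ (Fin m)) :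
    Continuous fun Φ : Fin m → Fin n → ℝ => (Matrix.of Φ)ᵀ.toEuclideanLin w := by
  simp_rw [toEuclideanLin_transpose_eq_sum]
  have h : ∀ a : Fin m, Continuous fun Φ : Fin m → Fin n → ℝ =>
      (WithLp.toLp 2 (Matrix.of Φ a) : EuclideanSpace ℝ (Fin n)) := fun a =>
    (PiLp.continuous_toLp 2 _).comp (continuous_apply a)
  exact continuous_finsetSum _ fun a _ => (h a).fun_const_smul _

theorem continuous_quad {n : ℕ} (Q : Matrix (Fin n) (Fin n) ℝ) :
    Continuous fun v : EuclideanSpace ℝ (Fin n) => quad Q v :=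
  continuous_id.inner (LinearMap.continuous_of_finiteDimensional _)

theorem continuous_energy {m n : ℕ} (Q : Matrix (Fin n) (Fin n) ℝ) :
    Continuous fun D : Matrix (Fin m) (Fin n) ℝ => energy Q D :=
  continuous_finsetSum _ fun a _ => (continuous_quad Q).comp
    ((PiLp.continuous_toLp 2 _).comp (continuous_apply a))

theorem continuous_design_of {ι P : Type*} [TopologicalSpace P] (τ : ι → Fin (H + 1))
    {N T p : ℕ} {ξ : P → ι × Fin N → TrajNoise nx nu T} {D : P → ι → Matrix (Fin p) (Fin nx) ℝ}
    (hξ : Continuous ξ) (hD : Continuous D) : Continuous fun x => S.design τ p (ξ x) (D x) := by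
  refine (PiLp.continuous_toLp 2 _).comp (continuous_pi fun q => ?_)
  exact continuous_toEuclideanLin_apply.comp (((continuous_apply q.1.1).comp hD).prodMk
    ((S.continuous_state _ _).comp ((continuous_apply q.1).comp hξ)))

theorem continuous_weight {ι : Type*} (τ : ι → Fin (H + 1)) (p : ℕ) :
    Continuous (S.weight τ p) := by
  have hc : ∀ g, Continuous (CFC.sqrt (S.covX (τ g))).toEuclideanLin :=
    fun g => LinearMap.continuous_of_finiteDimensional _
  refine (PiLp.continuous_toLp 2 _).comp (continuous_pi fun q => (hc q.1).comp ?_)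
  exact (PiLp.continuous_toLp 2 _).comp ((continuous_apply q.2).comp (continuous_apply q.1))

theorem isClosed_covarianceBounds {N T : ℕ} :
    IsClosed {x : (Fin k → Fin nx → ℝ) × (Unit × Fin N → TrajNoise nx nu T) |
      S.CovarianceBounds (targetTask H) x.2 () (LinearMap.range (Matrix.of x.1)ᵀ.toEuclideanLin)} := by
  have hst : ∀ (i : Fin N) (t : Fin T), Continuous
      fun x : (Fin k → Fin nx → ℝ) × (Unit × Fin N → TrajNoise nx nu T) =>
        S.state (Fin.last H) (x.2 ((), i)) t := fun i t =>
    (S.continuous_state _ _).comp ((continuous_apply ((), i)).comp continuous_snd)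
  have htr : ∀ w : EuclideanSpace ℝ (Fin k), Continuous
      fun x : (Fin k → Fin nx → ℝ) × (Unit × Fin N → TrajNoise nx nu T) =>
        (Matrix.of x.1)ᵀ.toEuclideanLin w := fun w =>
    (continuous_transpose_toEuclideanLin w).comp continuous_fst
  have hquad : ∀ (c : ℝ) (w : EuclideanSpace ℝ (Fin k)), Continuous
      fun x : (Fin k → Fin nx → ℝ) × (Unit × Fin N → TrajNoise nx nu T) =>
        c * (N * T * quad (S.covX (Fin.last H)) ((Matrix.of x.1)ᵀ.toEuclideanLin w)) := fun c w =>
    continuous_const.mul (continuous_const.mul ((continuous_quad _).comp (htr w)))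
  have hsum : ∀ w : EuclideanSpace ℝ (Fin k), Continuous
      fun x : (Fin k → Fin nx → ℝ) × (Unit × Fin N → TrajNoise nx nu T) =>
        ∑ i : Fin N, ∑ t : Fin T, inner ℝ ((Matrix.of x.1)ᵀ.toEuclideanLin w)
          (S.state (Fin.last H) (x.2 ((), i)) t) ^ 2 := fun w =>
    continuous_finsetSum _ fun i _ => continuous_finsetSum _ fun t _ => ((htr w).inner (hst i t)).pow 2
  have heq : {x : (Fin k → Fin nx → ℝ) × (Unit × Fin N → TrajNoise nx nu T) |
      S.CovarianceBounds (targetTask H) x.2 () (LinearMap.range (Matrix.of x.1)ᵀ.toEuclideanLin)}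
      = ⋂ w : EuclideanSpace ℝ (Fin k),
        {x | 4 / 25 * (N * T * quad (S.covX (Fin.last H)) ((Matrix.of x.1)ᵀ.toEuclideanLin w))
          ≤ ∑ i : Fin N, ∑ t : Fin T, inner ℝ ((Matrix.of x.1)ᵀ.toEuclideanLin w)
            (S.state (Fin.last H) (x.2 ((), i)) t) ^ 2} ∩
        {x | ∑ i : Fin N, ∑ t : Fin T, inner ℝ ((Matrix.of x.1)ᵀ.toEuclideanLin w)
            (S.state (Fin.last H) (x.2 ((), i)) t) ^ 2
          ≤ 9 / 4 * (N * T * quad (S.covX (Fin.last H)) ((Matrix.of x.1)ᵀ.toEuclideanLin w))} := by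
    ext x
    simp only [Set.mem_iInter, Set.mem_inter_iff, Set.mem_ofPred_eq]
    exact ⟨fun h w => h _ ⟨w, rfl⟩, fun h v hv => by obtain ⟨w, rfl⟩ := hv; exact h w⟩
  rw [heq]
  exact isClosed_iInter fun w =>
    (isClosed_le (hquad _ w) (hsum w)).inter (isClosed_le (hsum w) (hquad _ w))

theorem isClosed_inner_actuator_le {N T : ℕ} (s : ℝ) :
    IsClosed {x : (Fin k → Fin nx → ℝ) × (Unit × Fin N → TrajNoise nx nu T) |
      ∀ G : Unit → Matrix (Fin nu) (Fin k) ℝ,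
        inner ℝ (actuator x.2) (S.design (targetTask H) nu x.2 fun g => G g * Matrix.of x.1)
          ≤ s * ‖S.weight (targetTask H) nu fun g => G g * Matrix.of x.1‖} := by
  have hmul : ∀ G : Unit → Matrix (Fin nu) (Fin k) ℝ, Continuous
      fun x : (Fin k → Fin nx → ℝ) × (Unit × Fin N → TrajNoise nx nu T) =>
        (fun g => G g * Matrix.of x.1 : Unit → Matrix (Fin nu) (Fin nx) ℝ) := fun G =>
    continuous_pi fun g => (continuous_mul_of (G g)).comp continuous_fst
  rw [Set.ofPred_forall]
  refine isClosed_iInter fun G => isClosed_le ?_ ?_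
  · exact (continuous_actuator.comp continuous_snd).inner
      (S.continuous_design_of (targetTask H) continuous_snd (hmul G))
  · exact continuous_const.mul ((S.continuous_weight (targetTask H) nu).comp (hmul G)).norm

theorem isOpen_exists_head {N T : ℕ} (ρ ρ' : ℝ) :
    IsOpen {x : (Fin k → Fin nx → ℝ) × (Unit × Fin N → TrajNoise nx nu T) |
      ∃ F₀ : Matrix (Fin nu) (Fin k) ℝ,
        energy (S.covX (Fin.last H)) (F₀ * Matrix.of x.1 - S.K (Fin.last H)) < ρ ∧
        ‖S.design (targetTask H) nu x.2 fun _ => F₀ * Matrix.of x.1 - S.K (Fin.last H)‖ ^ 2 < ρ'} := by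
  have hdev : ∀ F₀ : Matrix (Fin nu) (Fin k) ℝ, Continuous
      fun x : (Fin k → Fin nx → ℝ) × (Unit × Fin N → TrajNoise nx nu T) =>
        (F₀ * Matrix.of x.1 - S.K (Fin.last H) : Matrix (Fin nu) (Fin nx) ℝ) := fun F₀ =>
    ((continuous_mul_of F₀).comp continuous_fst).sub continuous_const
  rw [Set.ofPred_exists]
  have hdes : ∀ F₀ : Matrix (Fin nu) (Fin k) ℝ, IsOpen
      {x : (Fin k → Fin nx → ℝ) × (Unit × Fin N → TrajNoise nx nu T) |
        ‖S.design (targetTask H) nu x.2 fun _ => F₀ * Matrix.of x.1 - S.K (Fin.last H)‖ ^ 2 < ρ'} :=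
    fun F₀ => isOpen_lt ((S.continuous_design_of (targetTask H) continuous_snd
      (continuous_pi fun _ => hdev F₀)).norm.pow 2) continuous_const
  exact isOpen_iUnion fun F₀ => (isOpen_lt ((continuous_energy _).comp (hdev F₀))
    continuous_const).inter (hdes F₀)

/-- The complement of `FineTuningEvent`, among the representations admitting a good target head, is a
Borel set, so that Fubini applies to a representation depending on the source data. -/
theorem measurableSet_not_fineTuningEvent {N T : ℕ} (l ρ : ℝ) :
    MeasurableSet {x : (Fin k → Fin nx → ℝ) × (Unit × Fin N → TrajNoise nx nu T) |
      (∃ F₀ : Matrix (Fin nu) (Fin k) ℝ,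
        energy (S.covX (Fin.last H)) (F₀ * Matrix.of x.1 - S.K (Fin.last H)) < ρ) ∧
      ¬ S.FineTuningEvent l ρ (Matrix.of x.1) x.2} := by
  have hdev : ∀ F₀ : Matrix (Fin nu) (Fin k) ℝ, Continuous
      fun x : (Fin k → Fin nx → ℝ) × (Unit × Fin N → TrajNoise nx nu T) =>
        (F₀ * Matrix.of x.1 - S.K (Fin.last H) : Matrix (Fin nu) (Fin nx) ℝ) := fun F₀ =>
    ((continuous_mul_of F₀).comp continuous_fst).sub continuous_const
  have hopen : IsOpen {x : (Fin k → Fin nx → ℝ) × (Unit × Fin N → TrajNoise nx nu T) |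
      ∃ F₀ : Matrix (Fin nu) (Fin k) ℝ,
        energy (S.covX (Fin.last H)) (F₀ * Matrix.of x.1 - S.K (Fin.last H)) < ρ} := by
    rw [Set.ofPred_exists]
    exact isOpen_iUnion fun F₀ => isOpen_lt ((continuous_energy _).comp (hdev F₀)) continuous_const
  have : SecondCountableTopologyEither (Fin k → Fin nx → ℝ) (Unit × Fin N → TrajNoise nx nu T) :=
    ⟨Or.inl inferInstance⟩
  have : OpensMeasurableSpace ((Fin k → Fin nx → ℝ) × (Unit × Fin N → TrajNoise nx nu T)) :=
    Prod.opensMeasurableSpace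
  exact hopen.measurableSet.inter (S.isClosed_covarianceBounds.measurableSet.inter
    ((S.isClosed_inner_actuator_le _).measurableSet.inter (S.isOpen_exists_head _ _).measurableSet)).compl

end TaskFamily

variable {nx nu k H : ℕ}

/-! ### The joint law of the data -/

theorem TaskFamily.measurable_trajectory (S : TaskFamily nx nu k H) (h : Fin (H + 1)) (T : ℕ) :
    Measurable fun ξ : TrajNoise nx nu T => S.trajectory h ξ := by
  have hK : Measurable (S.K h).toEuclideanLin :=
    (LinearMap.continuous_of_finiteDimensional _).measurable
  refine measurable_pi_lambda _ fun t => (S.measurable_state h T t).prodMk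
    ((hK.comp (S.measurable_state h T t)).add ?_)
  exact (measurable_pi_apply t).comp (measurable_fst.comp measurable_snd)

variable {N₁ N₂ T : ℕ} {Ω : Type*} [MeasurableSpace Ω] {μ : Measure Ω} [IsProbabilityMeasure μ]
  {src : Fin H → Fin N₁ → Ω → TrajNoise nx nu T} {tgt : Fin N₂ → Ω → TrajNoise nx nu T}

/-- The noises of the source and of the target data, as two independent batches. -/
theorem IsDemonstrationNoise.measure_preimage_le {S : TaskFamily nx nu k H}
    (hD : IsDemonstrationNoise S μ src tgt)
    (E : Set ((Fin H × Fin N₁ → TrajNoise nx nu T) × (Unit × Fin N₂ → TrajNoise nx nu T))) :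
    μ {ω | (fun p => src p.1 p.2 ω, fun p => tgt p.2 ω) ∈ E}
      ≤ ((S.batchLaw Fin.castSucc N₁ T).prod (S.batchLaw (TaskFamily.targetTask H) N₂ T)) E := by
  let X : (Fin H × Fin N₁) ⊕ (Unit × Fin N₂) → Ω → TrajNoise nx nu T :=
    Sum.elim (fun p => src p.1 p.2) (fun p => tgt p.2)
  let ν : (Fin H × Fin N₁) ⊕ (Unit × Fin N₂) → Measure (TrajNoise nx nu T) :=
    Sum.elim (fun p => S.noiseLaw p.1.castSucc T) (fun _ => S.noiseLaw (Fin.last H) T)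
  have hlaw : ∀ i, HasLaw (X i) (ν i) μ := by
    rintro (p | p)
    · exact hD.law_src p.1 p.2
    · exact hD.law_tgt p.2
  have : ∀ i, IsProbabilityMeasure (ν i) := by
    rintro (p | p)
    · exact inferInstanceAs (IsProbabilityMeasure (S.noiseLaw p.1.castSucc T))
    · exact inferInstanceAs (IsProbabilityMeasure (S.noiseLaw (Fin.last H) T))
  have hind : iIndepFun X μ := by
    have h := hD.indep.precomp (g := Sum.map id (Prod.snd : Unit × Fin N₂ → Fin N₂))
      (Sum.map_injective.2 ⟨Function.injective_id, fun a b hab => Prod.ext rfl hab⟩)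
    convert h using 1
    funext i
    rcases i with p | p <;> rfl
  have hae : ∀ i, AEMeasurable (X i) μ := fun i => (hlaw i).aemeasurable
  have hmap : μ.map (fun ω i => X i ω) = Measure.pi ν := by
    rw [(iIndepFun_iff_map_fun_eq_pi_map hae).1 hind]
    congr 1
    funext i
    exact (hlaw i).map_eq
  have hmp := measurePreserving_sumPiEquivProdPi ν
  have hae' : AEMeasurable (fun ω i => X i ω) μ := aemeasurable_pi_iff.2 hae
  have hmap2 : μ.map (fun ω => (MeasurableEquiv.sumPiEquivProdPi fun _ => TrajNoise nx nu T)
      (fun i => X i ω)) = (S.batchLaw Fin.castSucc N₁ T).prod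
        (S.batchLaw (TaskFamily.targetTask H) N₂ T) := by
    have h := AEMeasurable.map_map_of_aemeasurable hmp.measurable.aemeasurable hae'
    rw [hmap, hmp.map_eq] at h
    exact h.symm
  rw [← hmap2]
  exact Measure.le_map_apply (hmp.measurable.comp_aemeasurable hae') E

/-- Fubini for an event of the source data followed by an event of the target data depending on the
representation learnt from the source data. -/
theorem measure_prod_union_le {α β γ : Type*} [MeasurableSpace α] [MeasurableSpace β]
    [MeasurableSpace γ] {P : Measure α} {Q : Measure β} [IsProbabilityMeasure P]
    [IsProbabilityMeasure Q] {A : Set α} {f : α → γ} (hf : Measurable f) {M : Set (γ × β)}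
    (hM : MeasurableSet M) {ε : ENNReal} (hA : P A ≤ ε) (hMε : ∀ c, Q {b | (c, b) ∈ M} ≤ ε) :
    (P.prod Q) {x | x.1 ∈ A ∨ (f x.1, x.2) ∈ M} ≤ ε + ε := by
  have hM' : MeasurableSet {x : α × β | (f x.1, x.2) ∈ M} :=
    ((hf.comp measurable_fst).prodMk measurable_snd) hM
  have h1 : {x : α × β | x.1 ∈ A ∨ (f x.1, x.2) ∈ M}
      = A ×ˢ Set.univ ∪ {x | (f x.1, x.2) ∈ M} := by
    ext x
    simp
  rw [h1]
  refine (measure_union_le _ _).trans (add_le_add ?_ ?_)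
  · rw [Measure.prod_prod, measure_univ, mul_one]
    exact hA
  · rw [Measure.prod_apply hM']
    calc _ ≤ ∫⁻ _, ε ∂P := lintegral_mono fun a => hMε (f a)
      _ = ε := by rw [lintegral_const, measure_univ, mul_one]

/-! ### The excess risk -/

theorem TaskFamily.excessRisk_eq_zero (S : TaskFamily nx nu k H) (h : k = 0 ∨ nu = 0) (T : ℕ) (Φ : Matrix (Fin k) (Fin nx) ℝ)
    (F : Matrix (Fin nu) (Fin k) ℝ) : S.excessRisk T Φ F = 0 := by
  have h0 : S.Fstar (Fin.last H) * S.Φstar - F * Φ = 0 := by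
    ext i j
    rcases h with rfl | rfl
    · simp
    · exact i.elim0
  rw [TaskFamily.excessRisk, h0]
  simp

/-- The bound on the excess risk obtained from fine-tuning, `a = k nu + log (1 / δ)`,
`b = k nx log (N₁ T λ̄ / λ̲)`, in terms of the rates of the two stages. -/
theorem risk_constants_le {v a b c n₁ n₂ C₀ C₁ H l₁ l₂ t : ℝ} (hv : 0 ≤ v) (ha : 0 ≤ a) (hb : 0 ≤ b)
    (hc : 0 < c) (hn₁ : 0 < n₁) (hn₂ : 0 < n₂) (hH : 1 ≤ H) (ht : 0 < t) (hn : n₂ ≤ C₁ * (c * n₁))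
    (hl₁ : l₁ ≤ 9 * (H * a) + 3 * b) (hl₂ : l₂ ≤ 6 * a) :
    2813 * (v * l₂ / (n₂ * t)) + 880 * ((|C₀| + 1) * (22500 * (v * l₁)) / (c * (n₁ * t) * H))
      ≤ (17000 + 19800000 * (|C₀| + 1) * (9 * |C₁| + 3))
        * (v * (b / (c * n₁ * t * H) + a / (n₂ * t))) := by
  have hC₁ : n₂ ≤ |C₁| * (c * n₁) := hn.trans (by gcongr; exact le_abs_self _)
  have hinv : a / (c * n₁ * t) ≤ |C₁| * (a / (n₂ * t)) := by
    rw [← mul_div_assoc, div_le_div_iff₀ (by positivity) (by positivity)]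
    calc a * (n₂ * t) ≤ a * (|C₁| * (c * n₁) * t) := by gcongr
      _ = |C₁| * a * (c * n₁ * t) := by ring
  set X := a / (n₂ * t) with hX
  set Y := b / (c * n₁ * t * H) with hY
  have hX0 : 0 ≤ X := by positivity
  have hY0 : 0 ≤ Y := by positivity
  have h1 : v * l₂ / (n₂ * t) ≤ 6 * (v * X) := by
    calc v * l₂ / (n₂ * t) ≤ v * (6 * a) / (n₂ * t) := by gcongr
      _ = 6 * (v * X) := by rw [hX]; ring
  have h2 : (|C₀| + 1) * (22500 * (v * l₁)) / (c * (n₁ * t) * H)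
      ≤ 22500 * (|C₀| + 1) * (v * (9 * (|C₁| * X) + 3 * Y)) := by
    calc (|C₀| + 1) * (22500 * (v * l₁)) / (c * (n₁ * t) * H)
        ≤ (|C₀| + 1) * (22500 * (v * (9 * (H * a) + 3 * b))) / (c * (n₁ * t) * H) := by gcongr
      _ = 22500 * (|C₀| + 1) * (v * (9 * (a / (c * n₁ * t)) + 3 * Y)) := by
        rw [hY]
        field_simp
      _ ≤ _ := by gcongr
  have hvX : 0 ≤ v * X := mul_nonneg hv hX0
  have hvY : 0 ≤ v * Y := mul_nonneg hv hY0
  have hA : 0 ≤ (|C₀| + 1) * |C₁| * (v * Y) := by positivity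
  have hB : 0 ≤ (|C₀| + 1) * (v * X) := by positivity
  nlinarith

theorem TaskFamily.sourceComplexity_pos (S : TaskFamily nx nu k H) {N T : ℕ} {δ : ℝ} (hδ : 0 < δ) (hδ1 : δ < 1)
    (hL : 0 ≤ Real.log (N * T * (S.lambdaBar / S.lambdaUnderbar))) : 0 < S.sourceComplexity N T δ := by
  have h1 : 0 < Real.log (8 / δ) := Real.log_pos (by rw [lt_div_iff₀ hδ]; linarith)
  have h2 : 0 ≤ Real.log 9 := Real.log_nonneg (by norm_num)
  rw [TaskFamily.sourceComplexity]
  positivity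

theorem log_eight_div_le {δ x : ℝ} (hδ : 0 < δ) (hx : 1 ≤ x) :
    Real.log (8 / δ) ≤ 3 * x + Real.log (1 / δ) := by
  have h1 : Real.log 8 ≤ 3 := by
    rw [Real.log_le_iff_le_exp (by norm_num)]
    have h2 := Real.add_one_le_exp 1
    calc (8 : ℝ) = 2 ^ 3 := by norm_num
      _ ≤ Real.exp 1 ^ 3 := by gcongr; linarith
      _ = Real.exp 3 := by rw [← Real.exp_nat_mul]; norm_num
  have h3 : (8 : ℝ) / δ = 8 * (1 / δ) := by ring
  rw [h3, Real.log_mul (by norm_num) (by positivity)]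
  linarith

theorem log_nine_le : Real.log 9 ≤ 3 := by
  rw [Real.log_le_iff_le_exp (by norm_num)]
  have h2 := Real.exp_one_gt_d9
  calc (9 : ℝ) ≤ 2.7 ^ 3 := by norm_num
    _ ≤ Real.exp 1 ^ 3 := by gcongr; linarith
    _ = Real.exp 3 := by rw [← Real.exp_nat_mul]; norm_num

/-- The excess risk in terms of the bias `ρ` that the pretrained representation leaves on the target
task. -/
theorem measure_excessRisk_gt_le {S : TaskFamily nx nu k H} [Nonempty (Fin nx)] [Nonempty (Fin H)]
    (hk : 1 ≤ k) (hkn : 2 * k ≤ nx) {δ : ℝ} (hδ : 0 < δ) (hδ1 : δ < 1) (hspan : S.SourcesSpanTarget)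
    {C₀ ρ : ℝ} (hdiv : S.DiverseSources C₀)
    (hN₁ : 2000 * (⨆ h : Fin H, stabilityConst (S.Acl h.castSucc) ^ 2 *
      condNumber (S.covX h.castSucc) * (nx + Real.log (H / δ))) ≤ (N₁ : ℝ) * T)
    (hN₂ : 2000 * (stabilityConst (S.Acl (Fin.last H)) ^ 2 * condNumber (S.covX (Fin.last H)) *
      (k + Real.log (1 / δ))) ≤ (N₂ : ℝ) * T)
    (hN₁T : (0 : ℝ) < N₁ * T) (hN₂T : (0 : ℝ) < N₂ * T) (hl : 0 < S.sourceComplexity N₁ T δ)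
    (hρ : ρ = (|C₀| + 1) * (22500 * (S.sigmaZ ^ 2 * S.sourceComplexity N₁ T δ))
      / (S.coverage * (N₁ * T) * H))
    {Φhat : (Fin H → Fin N₁ → Trajectory nx nu T) → Matrix (Fin k) (Fin nx) ℝ}
    {Fhat : Ω → Matrix (Fin nu) (Fin k) ℝ} (hdata : IsDemonstrationNoise S μ src tgt)
    (hΦmeas : ∀ a b, Measurable fun D => Φhat D a b)
    (hpre : ∀ᵐ ω ∂μ, IsPretrained (fun (h : Fin H) i => S.trajectory h.castSucc (src h i ω))
      (Φhat fun h i => S.trajectory h.castSucc (src h i ω)))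
    (hfine : ∀ᵐ ω ∂μ, IsFineTuned (fun i => S.trajectory (Fin.last H) (tgt i ω))
      (Φhat fun h i => S.trajectory h.castSucc (src h i ω)) (Fhat ω)) :
    μ {ω | ¬ S.excessRisk T (Φhat fun h i => S.trajectory h.castSucc (src h i ω)) (Fhat ω)
      ≤ 2813 * (S.sigmaZ ^ 2 * TaskFamily.targetComplexity k nu δ / (N₂ * T)) + 880 * ρ}
        ≤ ENNReal.ofReal δ := by
  have hσ := S.sigmaZ_pos
  have hc := S.coverage_pos
  have hH : (0 : ℝ) < H := by exact_mod_cast Fin.pos_iff_nonempty.2 ‹Nonempty (Fin H)›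
  have hρ0 : 0 < ρ := by
    rw [hρ]
    positivity
  let l₂ := TaskFamily.targetComplexity k nu δ
  let Φc : (Fin H × Fin N₁ → TrajNoise nx nu T) → Fin k → Fin nx → ℝ :=
    fun ξ a b => Φhat (fun h i => S.trajectory h.castSucc (ξ (h, i))) a b
  have hΦc : Measurable Φc := measurable_pi_iff.2 fun a => measurable_pi_iff.2 fun b =>
    (hΦmeas a b).comp (measurable_pi_iff.2 fun h => measurable_pi_iff.2 fun i =>
      (S.measurable_trajectory h.castSucc T).comp (measurable_pi_apply (h, i)))
  have hA := S.measure_source_error_gt_le (N := N₁) (T := T) hk hkn hδ hδ1 hN₁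
  have hM := S.measurableSet_not_fineTuningEvent (k := k) (N := N₂) (T := T) l₂ ρ
  refine (measure_mono_ae ?_).trans ((hdata.measure_preimage_le _).trans
    ((measure_prod_union_le hΦc hM hA fun Φ => ?_).trans ?_))
  · filter_upwards [hpre, hfine] with ω h1 h2 hbad
    by_contra hgood
    obtain ⟨hsrc, htgt⟩ := not_or.1 hgood
    refine hbad (S.excessRisk_le_of_fineTuningEvent (ξ := fun p => tgt p.2 ω)
      (TaskFamily.targetComplexity_pos k nu hδ hδ1).le hN₂T ?_ h2)
    by_contra hev
    refine htgt ⟨?_, hev⟩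
    obtain ⟨F, hF⟩ := not_not.1 hsrc _ h1
    obtain ⟨F₀, hF₀⟩ := S.exists_target_head hspan
      (Φhat fun h i => S.trajectory h.castSucc (src h i ω)) F hc.le
    refine ⟨F₀, ?_⟩
    change energy (S.covX (Fin.last H)) (F₀ * (Φhat fun h i => S.trajectory h.castSucc (src h i ω))
      - S.K (Fin.last H)) < ρ
    set e := energy (S.covX (Fin.last H)) (F₀ * (Φhat fun h i => S.trajectory h.castSucc (src h i ω))
      - S.K (Fin.last H))
    set s := ∑ h : Fin H, energy (S.covX h.castSucc)
      (F h * (Φhat fun h i => S.trajectory h.castSucc (src h i ω)) - S.K h.castSucc)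
    have hs : 0 ≤ s := Finset.sum_nonneg fun h _ => energy_nonneg (S.covX_posDef _).posSemidef _
    rw [hρ, lt_div_iff₀ (by positivity)]
    calc e * (S.coverage * (N₁ * T) * H) = S.coverage * e * (N₁ * T * H) := by ring
      _ ≤ |C₀| / H * s * (N₁ * T * H) := by
        refine mul_le_mul_of_nonneg_right ?_ (by positivity)
        refine hF₀.trans (mul_le_mul_of_nonneg_right (hdiv.trans ?_) hs)
        gcongr
        exact le_abs_self _
      _ = |C₀| * (N₁ * T * s) := by field_simp
      _ ≤ |C₀| * (22500 * (S.sigmaZ ^ 2 * S.sourceComplexity N₁ T δ)) := by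
        exact mul_le_mul_of_nonneg_left hF (abs_nonneg _)
      _ < _ := by
        have : 0 < 22500 * (S.sigmaZ ^ 2 * S.sourceComplexity N₁ T δ) := by positivity
        linarith
  · by_cases hex : ∃ F₀ : Matrix (Fin nu) (Fin k) ℝ,
        energy (S.covX (Fin.last H)) (F₀ * Matrix.of Φ - S.K (Fin.last H)) < ρ
    · exact (measure_mono fun ξ hξ => hξ.2).trans
        (S.measure_not_fineTuningEvent_le hk hδ hδ1 hρ0 hN₂ hex)
    · exact (measure_mono (t := ∅) fun ξ hξ => hex hξ.1).trans (by simp)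
  · rw [← ENNReal.ofReal_add (by positivity) (by positivity)]
    exact ENNReal.ofReal_le_ofReal (by linarith)

end MultiTaskIL

theorem theorem3p1 :
    ∃ Cb : ℝ, 0 < Cb ∧ ∀ C₀ C₁ : ℝ, ∃ C : ℝ, 0 < C ∧
      ∀ (nx nu k H N₁ N₂ T : ℕ) (S : MultiTaskIL.TaskFamily nx nu k H) (δ : ℝ),
        0 < δ → δ < 1 → 1 ≤ H → 2 * k ≤ nx →
        S.SourcesSpanTarget → S.DiverseSources C₀ →
        (N₂ : ℝ) ≤ C₁ * (S.coverage * N₁) →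
        Cb * (⨆ h : Fin H, MultiTaskIL.stabilityConst (S.Acl h.castSucc) ^ 2 *
            MultiTaskIL.condNumber (S.covX h.castSucc) * (nx + Real.log (H / δ))) ≤ (N₁ : ℝ) * T →
        Cb * (MultiTaskIL.stabilityConst (S.Acl (Fin.last H)) ^ 2 *
            MultiTaskIL.condNumber (S.covX (Fin.last H)) * (k + Real.log (1 / δ))) ≤ (N₂ : ℝ) * T →
        ∀ (Ω : Type*) [MeasurableSpace Ω] (μ : MeasureTheory.Measure Ω)
          [MeasureTheory.IsProbabilityMeasure μ]
          (src : Fin H → Fin N₁ → Ω → MultiTaskIL.TrajNoise nx nu T)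
          (tgt : Fin N₂ → Ω → MultiTaskIL.TrajNoise nx nu T)
          (Φhat : (Fin H → Fin N₁ → MultiTaskIL.Trajectory nx nu T) →
            Matrix (Fin k) (Fin nx) ℝ)
          (Fhat : Ω → Matrix (Fin nu) (Fin k) ℝ),
          MultiTaskIL.IsDemonstrationNoise S μ src tgt →
          (∀ a b, Measurable fun D => Φhat D a b) →
          (∀ᵐ ω ∂μ, MultiTaskIL.IsPretrained
            (fun (h : Fin H) i => S.trajectory h.castSucc (src h i ω))
            (Φhat fun h i => S.trajectory h.castSucc (src h i ω))) →
          (∀ᵐ ω ∂μ, MultiTaskIL.IsFineTuned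
            (fun i => S.trajectory (Fin.last H) (tgt i ω))
            (Φhat fun h i => S.trajectory h.castSucc (src h i ω)) (Fhat ω)) →
          μ {ω | ¬ S.excessRisk T (Φhat fun h i => S.trajectory h.castSucc (src h i ω)) (Fhat ω) ≤
            C * (S.sigmaZ ^ 2 *
              (k * nx * Real.log (N₁ * T * (S.lambdaBar / S.lambdaUnderbar)) /
                  (S.coverage * N₁ * T * H)
                + (k * nu + Real.log (1 / δ)) / (N₂ * T)))} ≤ ENNReal.ofReal δ := by
  -- `17000 ≥ 2813 · 6` from the fine-tuning noise, `19800000 = 880 · 22500` from the pretraining error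
  refine ⟨2000, by norm_num, fun C₀ C₁ =>
    ⟨17000 + 19800000 * (|C₀| + 1) * (9 * |C₁| + 3), by positivity, ?_⟩⟩
  intro nx nu k H N₁ N₂ T S δ hδ hδ1 hH hkn hspan hdiv hN₂₁ hN₁ hN₂ Ω _ μ _ src tgt Φhat Fhat hdata
    hΦmeas hpre hfine
  have hH' : (1 : ℝ) ≤ H := by exact_mod_cast hH
  have hne : Nonempty (Fin H) := ⟨⟨0, hH⟩⟩
  have hσ := S.sigmaZ_pos
  have hlogδ : 0 ≤ Real.log (1 / δ) := Real.log_nonneg (by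
    rw [le_div_iff₀ hδ]
    linarith)
  rcases Nat.eq_zero_or_pos k with hk0 | hk
  · -- without features there is nothing to learn
    refine (measure_mono (t := ∅) fun ω (hω : ¬ _) => hω ?_).trans (by simp)
    have hk0' : (k : ℝ) = 0 := by exact_mod_cast hk0
    rw [S.excessRisk_eq_zero (Or.inl hk0), hk0']
    simp only [zero_mul, zero_div, zero_add]
    positivity
  have hk' : (1 : ℝ) ≤ k := by exact_mod_cast hk
  have hnx : 1 ≤ nx := by omega
  have hnx' : (1 : ℝ) ≤ nx := by exact_mod_cast hnx
  have hnenx : Nonempty (Fin nx) := ⟨⟨0, hnx⟩⟩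
  have hlogH : 0 ≤ Real.log (H / δ) := Real.log_nonneg (by
    rw [le_div_iff₀ hδ]
    linarith)
  have hN₁T : 2000 * (nx + Real.log (H / δ)) ≤ (N₁ : ℝ) * T := by
    obtain ⟨h⟩ := hne
    refine S.mul_le_sample_size (h := h.castSucc) (by positivity) (le_trans ?_ hN₁)
    gcongr
    exact le_ciSup (f := fun h : Fin H => MultiTaskIL.stabilityConst (S.Acl h.castSucc) ^ 2 *
      MultiTaskIL.condNumber (S.covX h.castSucc) * (nx + Real.log (H / δ))) (Set.finite_range _).bddAbove h
  have hN₂T : 2000 * (k + Real.log (1 / δ)) ≤ (N₂ : ℝ) * T :=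
    S.mul_le_sample_size (h := Fin.last H) (by positivity) hN₂
  have hT : (0 : ℝ) < T := by
    refine lt_of_le_of_ne (Nat.cast_nonneg T) fun h => ?_
    rw [← h, mul_zero] at hN₂T
    linarith
  have hN₁0 : (0 : ℝ) < N₁ := by
    refine pos_of_mul_pos_left ?_ hT.le
    linarith
  have hN₂0 : (0 : ℝ) < N₂ := by
    refine pos_of_mul_pos_left ?_ hT.le
    linarith
  have hc := S.coverage_pos
  have hratio : 1 ≤ S.lambdaBar / S.lambdaUnderbar :=
    (one_le_div S.lambdaUnderbar_pos).2 S.lambdaUnderbar_le_lambdaBar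
  set L := Real.log (N₁ * T * (S.lambdaBar / S.lambdaUnderbar)) with hL
  have hL0 : 0 ≤ L := Real.log_nonneg (one_le_mul_of_one_le_of_one_le (by linarith) hratio)
  -- without inputs there is nothing to predict
  rcases Nat.eq_zero_or_pos nu with hnu0 | hnu
  · refine (measure_mono (t := ∅) fun ω (hω : ¬ _) => hω ?_).trans (by simp)
    rw [S.excessRisk_eq_zero (Or.inr hnu0)]
    positivity
  have hknu : (1 : ℝ) ≤ k * nu := by exact_mod_cast Nat.mul_pos hk hnu
  have hl₁ : S.sourceComplexity N₁ T δ
      ≤ 9 * (H * (k * nu + Real.log (1 / δ))) + 3 * (k * nx * L) := by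
    have h1 := MultiTaskIL.log_eight_div_le hδ hknu
    have h2 : 2 * (k * nu * H) * Real.log 9 ≤ 2 * (k * nu * H) * 3 := by
      gcongr
      exact MultiTaskIL.log_nine_le
    have h3 : 3 * (k * nu) + Real.log (1 / δ) ≤ H * (3 * (k * nu) + Real.log (1 / δ)) :=
      le_mul_of_one_le_left (by positivity) hH'
    have h4 : 0 ≤ H * Real.log (1 / δ) := by positivity
    rw [MultiTaskIL.TaskFamily.sourceComplexity, ← hL]
    linarith
  have hl₂ : MultiTaskIL.TaskFamily.targetComplexity k nu δ ≤ 6 * (k * nu + Real.log (1 / δ)) := by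
    have h1 := MultiTaskIL.log_eight_div_le hδ hknu
    have h2 : (k : ℝ) * nu * Real.log 9 ≤ k * nu * 3 := by
      gcongr
      exact MultiTaskIL.log_nine_le
    rw [MultiTaskIL.TaskFamily.targetComplexity]
    linarith
  have hrisk := MultiTaskIL.measure_excessRisk_gt_le hk hkn hδ hδ1 hspan hdiv hN₁ hN₂ (by positivity)
    (by positivity) (S.sourceComplexity_pos hδ hδ1 hL0) rfl hdata hΦmeas hpre hfine
  refine le_trans (MeasureTheory.measure_mono ?_) hrisk
  intro ω hω h
  refine hω (h.trans ?_)
  exact MultiTaskIL.risk_constants_le (sq_nonneg _) (by positivity) (by positivity) hc hN₁0 hN₂0 hH' hT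
    hN₂₁ hl₁ hl₂
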